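/- **Setting.** Let $\nabla'$ be the set of sequences $\lambda=(\lambda_1,\lambda_2,\dots)\in[0,1]^\infty$ with $\lambda_1\ge\lambda_2\ge\cdots$ and $\sum_{j\ge1}\lambda_j=1$. Let $p$ be a probability measure on $\nabla'$ with *exponential decay*: there is $r\in(0,1)$ such that for $p$-almost every $\lambda$ there is $C>0$ with $\lambda_j\le Cr^j$ for all $j\ge1$. Let $y=(y_1,y_2,\dots)$ be a random vector with law $p$. Given $y$, let $E_y=\bigsqcup_{j\ge1}\mathcal C_j$ be a disjoint union of circles, $\mathcal C_j$ having perimeter $y_j$, and let $x_1,x_2,\dots$ be, conditionally on $y$, i.i.d. uniformly distributed on $E_y$. For $n\ge1$ let $\sigma_n$ be the (almost surely well defined) permutation of $\{1,\dots,n\}$ that maps $k$ to the index of the first point of $\{x_1,\dots,x_n\}$ encountered after $x_k$ when one follows counterclockwise, starting from $x_k$, the circle that contains $x_k$ (so $\sigma_n(k)=k$ if $x_k$ is the only one of these points on its circle). Let $M_n=(\mathbf 1_{i=\sigma_n(j)})_{1\le i,j\le n}$ and $Z_n(z)=\det(zI-M_n)$. Let $(u_j)_{j\ge1}$ be i.i.d.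 uniform variables on the unit circle, independent of $(\sigma_n)_{n\ge1}$. A *random modified virtual permutation* generated by $(\sigma_n)$ and $(u_j)$ is a sequence of random matrices $(\widetilde M_n)_{n\ge1}$ on the same probability space such that, almost surely for all $n\ge1$: $\widetilde M_n$ is obtained from $M_n$ by replacing the entries equal to one by complex numbers of modulus one; $1$ is not an eigenvalue of $\widetilde M_n$; $\operatorname{rank}(\widetilde M_{n+1}-\operatorname{diag}(\widetilde M_n,1))=1$; for every $j$ such that $\mathcal C_j$ contains at least one of $x_1,\dots,x_n$, the product of the non-zero entries of $\widetilde M_n$ over the cycle of $\sigma_n$ formed by the points on $\mathcal C_j$ equals $u_j$; and, for each $n\ge 1$, the non-zero entries of $\widetilde M_n$ (indexed by their column) are i.i.d. uniform on the unit circle. Let $\widetilde Z_n(z)=\det(zI-\widetilde M_n)$. For $z\in\mathbb C$ and $\alpha\in\mathbb R$ put $$\widetilde\xi_n(z)=\frac{\widetilde Z_n(e^{2i\pi z/n})}{\widetilde Z_n(1)},\qquad \xi_{n,\alpha}(z)=\frac{Z_n(e^{2i\pi(z/n+\alpha)})}{Z_n(e^{2i\pi\alpha})},\qquad \widetilde\xi_\infty(z)=\prod_{j=1}^{\infty}\frac{e^{2i\pi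 z y_j}-u_j}{1-u_j}.$$ The *type* of a real number $a$ is $\sup\{\gamma\in\mathbb R:\liminf_{n\to\infty}n^\gamma\|na\|=0\}\in[0,+\infty]$, where $\|\cdot\|$ is the distance to the nearest integer; $a$ is of *finite type* if its type is finite. **Theorem.** Almost surely, the product defining $\widetilde\xi_\infty(z)$ converges for all $z\in\mathbb C$ and $\widetilde\xi_\infty$ is an entire function. Moreover: (i) For every random modified virtual permutation $(\widetilde M_n)$ generated by $(\sigma_n)$ and $(u_j)$, almost surely $\widetilde\xi_n$ converges to $\widetilde\xi_\infty$ uniformly on every compact subset of $\mathbb C$. (ii) Assume in addition that, almost surely, $y_j>0$ for all $j\ge1$. Then for every irrational $\alpha$ of finite type, $\xi_{n,\alpha}$ converges in law to $\widetilde\xi_\infty$ as $n\to\infty$, in the space $C(\mathbb C,\mathbb C)$ of continuous functions with the topology of uniform convergence on compact sets. -/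

import Mathlib

open MeasureTheory ProbabilityTheory Filter Topology

namespace PermChar

/-! ## Distributions on the simplex -/

/-- The set `∇'` of non-increasing sequences in `[0,1]` with sum `1`
(a sequence `(λ₁, λ₂, …)` is indexed by `ℕ`, so that `λ_j` is `l (j - 1)`). -/
def nablaPrime : Set (ℕ → ℝ) :=
  {l | (∀ j, l j ∈ Set.Icc (0 : ℝ) 1) ∧ Antitone l ∧ HasSum l 1}

/-- Exponential decay: there is a deterministic rate `r ∈ (0,1)` such that for almost every
`λ` there is `C > 0` with `λ_j ≤ C r ^ j` for all `j ≥ 1`. -/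
def ExponentialDecay (p : Measure (ℕ → ℝ)) : Prop :=
  ∃ r ∈ Set.Ioo (0 : ℝ) 1, ∀ᵐ l ∂p, ∃ C > 0, ∀ j : ℕ, l j ≤ C * r ^ (j + 1)

/-! ## Points on a disjoint union of circles and the permutations they generate

The circle `𝒞_j`, of perimeter `l j`, is `{j} × [0, l j)` inside `ℕ × ℝ`, the second coordinate
being the arc length, counterclockwise, from a base point. -/

/-- The uniform distribution on the disjoint union `E_l` of the circles: the sum over `j` of
the arc length measure of `𝒞_j` (a probability measure when the perimeters sum to `1`). -/
noncomputable def uniformOnCircles (l : ℕ → ℝ) : Measure (ℕ × ℝ) :=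
  Measure.sum fun j => (volume.restrict (Set.Ico (0 : ℝ) (l j))).map (Prod.mk j)

/-- The length of the counterclockwise arc from position `s` to position `t` on a circle of
perimeter `L`; a full turn if `s = t`. -/
noncomputable def arcLength (L s t : ℝ) : ℝ :=
  if s < t then t - s else t - s + L

theorem exists_next (l : ℕ → ℝ) (x : ℕ → ℕ × ℝ) {n : ℕ} (k : Fin n) :
    ∃ m ∈ Finset.univ.filter (fun m : Fin n => (x m).1 = (x k).1),
      ∀ m' ∈ Finset.univ.filter (fun m : Fin n => (x m).1 = (x k).1),
        arcLength (l (x k).1) (x k).2 (x m).2 ≤ arcLength (l (x k).1) (x k).2 (x m').2 :=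
  Finset.exists_min_image _ (fun m : Fin n => arcLength (l (x k).1) (x k).2 (x m).2)
    ⟨k, by simp⟩

/-- The index of the first point among `x_1, …, x_n` that is met after `x_k` when one follows
counterclockwise the circle that contains `x_k`. -/
noncomputable def nextIndex (l : ℕ → ℝ) (x : ℕ → ℕ × ℝ) (n : ℕ) (k : Fin n) : Fin n :=
  (exists_next l x k).choose

/-- The permutation `σ_n(l, x)`. When the points are distinct, `nextIndex` is a bijection;
the other case, which has probability zero, gets the identity. -/
noncomputable def circlePerm (l : ℕ → ℝ) (x : ℕ → ℕ × ℝ) (n : ℕ) : Equiv.Perm (Fin n) :=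
  if h : Function.Bijective (nextIndex l x n) then Equiv.ofBijective _ h else 1

/-- The circle coupling: `y` is a random vector with law `p`, and conditionally on `y` the points
`x_1, x_2, …` are i.i.d. and uniformly distributed on the union of circles of perimeters
`y_1, y_2, …`. -/
structure CircleCoupling {Ω : Type*} [MeasurableSpace Ω] (μ : Measure Ω)
    (p : Measure (ℕ → ℝ)) (y : Ω → ℕ → ℝ) (x : ℕ → Ω → ℕ × ℝ) : Prop where
  measurable_y : Measurable y
  measurable_x : ∀ k, Measurable (x k)
  law_y : μ.map y = p
  cond_iid : ∀ B : Set (ℕ → ℝ), MeasurableSet B →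
    ∀ (s : Finset ℕ) (A : ℕ → Set (ℕ × ℝ)), (∀ k, MeasurableSet (A k)) →
      μ (y ⁻¹' B ∩ ⋂ k ∈ s, x k ⁻¹' A k) =
        ∫⁻ ω in y ⁻¹' B, ∏ k ∈ s, uniformOnCircles (y ω) (A k) ∂μ

/-- The random permutations `σ_n` generated by the perimeters `y` and the points `x`. -/
noncomputable def sigma {Ω : Type*} (y : Ω → ℕ → ℝ) (x : ℕ → Ω → ℕ × ℝ) (n : ℕ) (ω : Ω) :
    Equiv.Perm (Fin n) :=
  circlePerm (y ω) (fun k => x k ω) n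

/-- The uniform distribution on the unit circle of `ℂ`. -/
noncomputable def uniformUnitCircle : Measure ℂ :=
  (volume.restrict (Set.Ico (0 : ℝ) 1)).map
    fun t : ℝ => Complex.exp (2 * Real.pi * Complex.I * t)

/-- `u_1, u_2, …` are i.i.d. uniform variables on the unit circle, independent of the virtual
permutation `(σ_n)` generated by `y` and `x`. -/
structure UniformMarks {Ω : Type*} [MeasurableSpace Ω] (μ : Measure Ω)
    (y : Ω → ℕ → ℝ) (x : ℕ → Ω → ℕ × ℝ) (u : ℕ → Ω → ℂ) : Prop where
  measurable_u : ∀ j, Measurable (u j)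
  law_u : ∀ j, μ.map (u j) = uniformUnitCircle
  indep_u : iIndepFun u μ
  indep_sigma :
    IndepFun (fun ω (n : ℕ) (k : Fin n) => sigma y x n ω k) (fun ω (j : ℕ) => u j ω) μ

/-! ## Permutation matrices and modified permutation matrices -/

/-- The permutation matrix with entries `1_{i = σ(j)}`. -/
def permMat {n : ℕ} (σ : Equiv.Perm (Fin n)) : Matrix (Fin n) (Fin n) ℂ :=
  Matrix.of fun i j => if i = σ j then 1 else 0

/-- `M` is a modified permutation matrix corresponding to `σ`: the entries equal to one of the
permutation matrix of `σ` are replaced by complex numbers of modulus one. -/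
def IsModifiedPermMat {n : ℕ} (σ : Equiv.Perm (Fin n)) (M : Matrix (Fin n) (Fin n) ℂ) : Prop :=
  (∀ j, ‖M (σ j) j‖ = 1) ∧ ∀ i j, i ≠ σ j → M i j = 0

/-- The set `𝒯_n` of modified permutation matrices that do not have `1` as an eigenvalue. -/
def setT (n : ℕ) : Set (Matrix (Fin n) (Fin n) ℂ) :=
  {M | (∃ σ, IsModifiedPermMat σ M) ∧ ¬ Module.End.HasEigenvalue (Matrix.toLin' M) 1}

/-- The block diagonal matrix `diag(N, 1)` of size `n + 1`. -/
noncomputable def diagOne {n : ℕ} (N : Matrix (Fin n) (Fin n) ℂ) : Matrix (Fin (n + 1)) (Fin (n + 1)) ℂ :=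
  Matrix.reindex finSumFinEquiv finSumFinEquiv
    (Matrix.fromBlocks N 0 0 (1 : Matrix (Fin 1) (Fin 1) ℂ))

/-- Modified virtual permutations. -/
def IsModifiedVirtualPerm (M : (n : ℕ) → Matrix (Fin n) (Fin n) ℂ) : Prop :=
  ∀ n, 1 ≤ n → M n ∈ setT n ∧ (M (n + 1) - diagOne (M n)).rank = 1

/-- `(M̃_n)` is a random modified virtual permutation generated by `(σ_n)` and `(u_j)`: each
`M̃_n` corresponds to `σ_n`, its non-zero entries are i.i.d. uniform on the unit circle, and for
every circle `𝒞_j` that contains a point among `x_1, …, x_n`, the product of the non-zero entries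
of `M̃_n` over the corresponding cycle of `σ_n` is `u_j`. -/
structure ModifiedCoupling {Ω : Type*} [MeasurableSpace Ω] (μ : Measure Ω)
    (y : Ω → ℕ → ℝ) (x : ℕ → Ω → ℕ × ℝ) (u : ℕ → Ω → ℂ)
    (Mt : (n : ℕ) → Ω → Matrix (Fin n) (Fin n) ℂ) : Prop where
  measurable_entries : ∀ n i j, Measurable fun ω => Mt n ω i j
  modified_virtual : ∀ᵐ ω ∂μ, IsModifiedVirtualPerm fun n => Mt n ω
  corresponds : ∀ᵐ ω ∂μ, ∀ n, 1 ≤ n → IsModifiedPermMat (sigma y x n ω) (Mt n ω)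
  law_entries : ∀ n, 1 ≤ n → ∀ k : Fin n,
    μ.map (fun ω => Mt n ω (sigma y x n ω k) k) = uniformUnitCircle
  indep_entries : ∀ n, 1 ≤ n →
    iIndepFun (fun (k : Fin n) (ω : Ω) => Mt n ω (sigma y x n ω k) k) μ
  cycle_products : ∀ᵐ ω ∂μ, ∀ n j, (∃ k : Fin n, (x k ω).1 = j) →
    ∏ k ∈ Finset.univ.filter (fun k : Fin n => (x k ω).1 = j), Mt n ω (sigma y x n ω k) k = u j ω

/-! ## Characteristic polynomials and their renormalizations -/

/-- The characteristic polynomial `det(z I - M)`. -/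
noncomputable def charDet {n : ℕ} (M : Matrix (Fin n) (Fin n) ℂ) (z : ℂ) : ℂ :=
  (z • (1 : Matrix (Fin n) (Fin n) ℂ) - M).det

/-- `Z(e^{2iπz/n}) / Z(1)`, where `Z` is the characteristic polynomial of `M`. -/
noncomputable def xiTilde {n : ℕ} (M : Matrix (Fin n) (Fin n) ℂ) (z : ℂ) : ℂ :=
  charDet M (Complex.exp (2 * Complex.I * Real.pi * z / n)) / charDet M 1

/-- `Z(e^{2iπ(z/n + α)}) / Z(e^{2iπα})`, where `Z` is the characteristic polynomial of `M`. -/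
noncomputable def xiAlpha (α : ℝ) {n : ℕ} (M : Matrix (Fin n) (Fin n) ℂ) (z : ℂ) : ℂ :=
  charDet M (Complex.exp (2 * Complex.I * Real.pi * (z / n + α))) /
    charDet M (Complex.exp (2 * Complex.I * Real.pi * α))

theorem continuous_xiAlpha (α : ℝ) {n : ℕ} (M : Matrix (Fin n) (Fin n) ℂ) :
    Continuous (xiAlpha α M) := by
  unfold xiAlpha charDet
  refine Continuous.div_const (Continuous.matrix_det ?_) _
  fun_prop

/-- The `j`-th factor `(e^{2iπ z y_j} - u_j) / (1 - u_j)`. -/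
noncomputable def xiFactor (y : ℕ → ℝ) (u : ℕ → ℂ) (j : ℕ) (z : ℂ) : ℂ :=
  (Complex.exp (2 * Complex.I * Real.pi * z * y j) - u j) / (1 - u j)

/-- The limiting function `ξ̃_∞`. -/
noncomputable def xiInfty (y : ℕ → ℝ) (u : ℕ → ℂ) (z : ℂ) : ℂ :=
  ∏' j, xiFactor y u j z

/-- The space `C(ℂ, ℂ)`, whose topology is that of uniform convergence on compact sets, with its
Borel σ-algebra. -/
noncomputable instance instMeasurableSpaceContMap : MeasurableSpace C(ℂ, ℂ) := borel _

instance instBorelSpaceContMap : BorelSpace C(ℂ, ℂ) := ⟨rfl⟩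

/-- `ξ_{n,α}` as an element of `C(ℂ, ℂ)`. -/
noncomputable def xiAlphaMap (α : ℝ) {n : ℕ} (M : Matrix (Fin n) (Fin n) ℂ) : C(ℂ, ℂ) :=
  ⟨xiAlpha α M, continuous_xiAlpha α M⟩

open Classical in
/-- `ξ̃_∞` as an element of `C(ℂ, ℂ)`; the value `0` is used only where `ξ̃_∞` fails to be
continuous, which has probability zero. -/
noncomputable def xiInftyMap (y : ℕ → ℝ) (u : ℕ → ℂ) : C(ℂ, ℂ) :=
  if h : Continuous (xiInfty y u) then ⟨xiInfty y u, h⟩ else 0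

/-! ## Type of a real number -/

/-- The distance from `t` to the nearest integer. -/
noncomputable def distInt (t : ℝ) : ℝ := |t - round t|

/-- The type `sup {γ ∈ ℝ : liminf n^γ ‖n a‖ = 0}` of `a`, in the extended reals. -/
noncomputable def diophantineType (a : ℝ) : EReal :=
  sSup ((fun γ : ℝ => (γ : EReal)) ''
    {γ : ℝ | liminf (fun n : ℕ => ENNReal.ofReal ((n : ℝ) ^ γ * distInt (n * a))) atTop = 0})

/-- `a` is of finite type. -/
def IsFiniteType (a : ℝ) : Prop := diophantineType a < ⊤

end PermChar

/-! All the functions involved are values of one map, Φ(a, v)(z) = ∏_j (e^{2iπ z a_j} - v_j) / (1 -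
v_j). The cycles of `σ_n` are the circles that carry a point, so the characteristic polynomial of a
modified permutation matrix is the product over these circles of z^{N_j} - (product of the weights),
N_j being the number of points on the circle j (`charDet_eq_prod`). Hence almost surely ξ̃_n =
Φ(N_j/n, u_j) for n ≥ 1 and ξ_{n,α} = Φ(N_j/n, e^{-2iπαN_j}), while ξ̃_∞ = Φ(y, u). On the set
`markBox b d`, where a_j ≤ b_j, |v_j| = 1 and |1 - v_j| ≥ d_j with ∑ b_j/d_j finite, the product
converges uniformly for bounded z. So Φ is continuous there, with values in C(ℂ, ℂ)
(`continuousOn_xiInftyMap`), and each value is entire.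

For (i), a second moment computation gives N_j/n → y_j almost surely, with a geometric bound in j
that is uniform in n (`CircleCoupling.ae_tendsto_and_le`). By Borel–Cantelli, |1 - u_j| ≥ c/(j+1)².
Almost every trajectory thus stays in one `markBox`, and the continuity of Φ concludes.

For (ii), two facts are needed about (N_j/n, e^{-2iπαN_j})_j. The first is its convergence in law to
(y, u). Given y the counts are multinomial, so the Fourier coefficients of the marks are powers (1 +
∑ y_j (w_j - 1))^n with w_j = e^{-2iπk_jα}. Since α is irrational and some mass always remains
outside finitely many circles, the base has modulus < 1 unless all k_j vanish, so the marks become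
uniform and independent of y (`tendsto_integral_markMonomial`). The limit y, u is indeed an
independent pair, because y is a function of the permutations. Stone–Weierstrass extends this from
monomials to all test functions. The second fact is tightness: uniformly in n, the pair lies in one
`markBox` with probability close to 1 (`exists_markBox_measureReal_le`). The finite type of α enters
here: it prevents the marks of large circles from concentrating near 1, by a Fejér type estimate,
and bounds the marks of small circles away from 1 directly. A mapping theorem for maps continuous on
closed sets of large probability then transports the convergence through Φ. -/

namespace PermChar

/-! ### The infinite product as a continuous function of perimeters and marks -/

/-- Perimeters and marks such that the perimeters lie in `[0,1]` and below `b`, and the marks lie on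
the unit circle, at distance at least `d` from `1`. -/
def markBox (b d : ℕ → ℝ) : Set ((ℕ → ℝ) × (ℕ → ℂ)) :=
  {q | ∀ j, (q.1 j ∈ Set.Icc (0 : ℝ) 1 ∧ q.1 j ≤ b j) ∧ ‖q.2 j‖ = 1 ∧ d j ≤ ‖1 - q.2 j‖}

/-- Tychonoff. Compactness serves the Weierstrass test for products; closedness serves the mapping
theorem. -/
theorem isCompact_markBox (b d : ℕ → ℝ) : IsCompact (markBox b d) := by
  have h : markBox b d = (Set.pi Set.univ fun j => Set.Icc (0 : ℝ) 1 ∩ Set.Iic (b j)) ×ˢ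
      (Set.pi Set.univ fun j => Metric.sphere (0 : ℂ) 1 ∩ {v | d j ≤ ‖1 - v‖}) := by
    ext q
    simp only [markBox, Set.mem_ofPred_eq, Set.mem_prod, Set.mem_pi, Set.mem_univ, true_imp_iff,
      Set.mem_inter_iff, mem_sphere_zero_iff_norm, Set.mem_Iic, ← forall_and]
  rw [h]
  refine (isCompact_univ_pi fun j => isCompact_Icc.inter_right isClosed_Iic).prod
    (isCompact_univ_pi fun j => (isCompact_sphere _ _).inter_right ?_)
  exact isClosed_le continuous_const (by fun_prop)

theorem xiFactor_eq_one_add {a : ℕ → ℝ} {v : ℕ → ℂ} {j : ℕ} (h : v j ≠ 1) (z : ℂ) :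
    xiFactor a v j z =
      1 + (Complex.exp (2 * Complex.I * Real.pi * z * a j) - 1) / (1 - v j) := by
  have : 1 - v j ≠ 0 := sub_ne_zero.2 h.symm
  unfold xiFactor
  field_simp
  ring

/-- From |e^w - 1| ≤ |w| e^{|w|}. The constant depends on `R` alone, so the summability of `b j / d
j` provides the majorant for the product. -/
theorem norm_exp_sub_one_div_le {R t b d : ℝ} {v z : ℂ} (ht : t ∈ Set.Icc (0 : ℝ) 1) (htb : t ≤ b)
    (hd : 0 < d) (hv : d ≤ ‖1 - v‖) (hz : ‖z‖ ≤ R) :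
    ‖(Complex.exp (2 * Complex.I * Real.pi * z * t) - 1) / (1 - v)‖ ≤
      (2 * Real.pi * R * Real.exp (2 * Real.pi * R)) * (b / d) := by
  have hpi := Real.pi_pos
  have hR : 0 ≤ R := (norm_nonneg z).trans hz
  have hw : ‖2 * Complex.I * Real.pi * z * t‖ = 2 * Real.pi * ‖z‖ * t := by
    simp [abs_of_nonneg ht.1, abs_of_pos hpi]
  have h1 := Complex.norm_exp_sub_sum_le_norm_mul_exp (2 * Complex.I * Real.pi * z * t) 1
  simp only [Finset.range_one, Finset.sum_singleton, pow_zero, Nat.factorial_zero, Nat.cast_one,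
    div_one, pow_one, hw] at h1
  rw [norm_div]
  have hzt : ‖z‖ * t ≤ R := by nlinarith [ht.1, ht.2, norm_nonneg z]
  have ht0 : 0 ≤ t := ht.1
  calc _ ≤ (2 * Real.pi * ‖z‖ * t * Real.exp (2 * Real.pi * ‖z‖ * t)) / d :=
        div_le_div₀ (by positivity) h1 hd hv
    _ ≤ (2 * Real.pi * R * b * Real.exp (2 * Real.pi * R)) / d := by
        have : 0 ≤ b := ht.1.trans htb
        gcongr ?_ / d
        gcongr ?_ * Real.exp ?_
        · gcongr
        · nlinarith
    _ = _ := by ring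

section

variable {b d : ℕ → ℝ} (hd : ∀ j, 0 < d j) (hbd : Summable fun j => b j / d j)
include hd

theorem ne_one_of_mem_markBox {q : (ℕ → ℝ) × (ℕ → ℂ)} (hq : q ∈ markBox b d) (j : ℕ) :
    q.2 j ≠ 1 := by
  intro h
  have := (hq j).2.2
  rw [h] at this
  simp at this
  linarith [hd j]

include hbd

theorem multipliable_xiFactor {q : (ℕ → ℝ) × (ℕ → ℂ)} (hq : q ∈ markBox b d) (z : ℂ) :
    Multipliable fun j => xiFactor q.1 q.2 j z := by
  have h : (fun j => xiFactor q.1 q.2 j z) = fun j =>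
      1 + (Complex.exp (2 * Complex.I * Real.pi * z * q.1 j) - 1) / (1 - q.2 j) :=
    funext fun j => xiFactor_eq_one_add (ne_one_of_mem_markBox hd hq j) z
  rw [h]
  refine multipliable_one_add_of_summable ?_
  refine Summable.of_nonneg_of_le (fun _ => norm_nonneg _) (fun j => ?_)
    (hbd.mul_left (2 * Real.pi * ‖z‖ * Real.exp (2 * Real.pi * ‖z‖)))
  exact norm_exp_sub_one_div_le (hq j).1.1 (hq j).1.2 (hd j) (hq j).2.2 le_rfl

/-- The partial products are continuous and, by the Weierstrass test, converge uniformly on the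
product of the box and a closed ball. -/
theorem continuousOn_xiInfty :
    ContinuousOn (Function.uncurry fun (q : (ℕ → ℝ) × (ℕ → ℂ)) z => xiInfty q.1 q.2 z)
      (markBox b d ×ˢ Set.univ) := by
  have key : ∀ R : ℝ, ContinuousOn (Function.uncurry
      fun (q : (ℕ → ℝ) × (ℕ → ℂ)) z => xiInfty q.1 q.2 z)
      (markBox b d ×ˢ Metric.closedBall (0 : ℂ) R) := by
    intro R
    have hcts : ∀ j, ContinuousOn (fun s : ((ℕ → ℝ) × (ℕ → ℂ)) × ℂ =>
        (Complex.exp (2 * Complex.I * Real.pi * s.2 * s.1.1 j) - 1) / (1 - s.1.2 j))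
        (markBox b d ×ˢ Metric.closedBall (0 : ℂ) R) := by
      intro j
      refine ContinuousOn.div (by fun_prop) (by fun_prop) fun s hs => ?_
      exact sub_ne_zero.2 (ne_one_of_mem_markBox hd hs.1 j).symm
    have h := Summable.hasProdUniformlyOn_one_add
      ((isCompact_markBox b d).prod (isCompact_closedBall (0 : ℂ) R))
      (hbd.mul_left (2 * Real.pi * R * Real.exp (2 * Real.pi * R)))
      (f := fun j (s : ((ℕ → ℝ) × (ℕ → ℂ)) × ℂ) =>
        (Complex.exp (2 * Complex.I * Real.pi * s.2 * s.1.1 j) - 1) / (1 - s.1.2 j))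
      (Eventually.of_forall fun j s hs => norm_exp_sub_one_div_le (hs.1 j).1.1 (hs.1 j).1.2 (hd j)
        (hs.1 j).2.2 (by simpa using hs.2)) hcts
    rw [hasProdUniformlyOn_iff_tendstoUniformlyOn] at h
    have hc := h.continuousOn (Eventually.of_forall fun J =>
      continuousOn_finsetProd _ fun j _ => continuousOn_const.add (hcts j)).frequently
    refine hc.congr fun s hs => ?_
    exact tprod_congr fun j => xiFactor_eq_one_add (ne_one_of_mem_markBox hd hs.1 j) _
  rintro ⟨q, z⟩ ⟨hq, -⟩
  refine (key (‖z‖ + 1) (q, z) ⟨hq, by simp⟩).mono_of_mem_nhdsWithin ?_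
  rw [nhdsWithin_prod_eq]
  refine prod_mem_prod self_mem_nhdsWithin ?_
  rw [nhdsWithin_univ]
  exact mem_of_superset (Metric.isOpen_ball.mem_nhds (by simp)) Metric.ball_subset_closedBall

/-- Joint continuity, curried: this is continuity for the topology of uniform convergence on compact
sets. -/
theorem continuousOn_xiInftyMap :
    ContinuousOn (fun q : (ℕ → ℝ) × (ℕ → ℂ) => xiInftyMap q.1 q.2) (markBox b d) :=
  ContinuousMap.continuousOn_mkD_of_uncurry
    (fun (q : (ℕ → ℝ) × (ℕ → ℂ)) z => xiInfty q.1 q.2 z) 0 (continuousOn_xiInfty hd hbd)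

theorem continuous_xiInfty {q : (ℕ → ℝ) × (ℕ → ℂ)} (hq : q ∈ markBox b d) :
    Continuous (xiInfty q.1 q.2) := by
  have h := (continuousOn_xiInfty hd hbd).comp_continuous (f := fun z : ℂ => (q, z))
    (Continuous.prodMk_right q) fun _ => ⟨hq, trivial⟩
  exact h

theorem coe_xiInftyMap {q : (ℕ → ℝ) × (ℕ → ℂ)} (hq : q ∈ markBox b d) :
    ⇑(xiInftyMap q.1 q.2) = xiInfty q.1 q.2 := by
  rw [xiInftyMap, dif_pos (continuous_xiInfty hd hbd hq)]
  rfl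

theorem differentiable_xiInfty {q : (ℕ → ℝ) × (ℕ → ℂ)} (hq : q ∈ markBox b d) :
    Differentiable ℂ (xiInfty q.1 q.2) := by
  have hf : ∀ j, Differentiable ℂ fun z : ℂ =>
      (Complex.exp (2 * Complex.I * Real.pi * z * q.1 j) - 1) / (1 - q.2 j) := by
    intro j; fun_prop
  have h := hasProdLocallyUniformlyOn_of_forall_compact (s := (Set.univ : Set ℂ))
    (f := fun j z => 1 + (Complex.exp (2 * Complex.I * Real.pi * z * q.1 j) - 1) / (1 - q.2 j))
    (g := xiInfty q.1 q.2) isOpen_univ (by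
      intro K _ hK
      obtain ⟨R, hR⟩ := hK.isBounded.exists_norm_le
      have := Summable.hasProdUniformlyOn_one_add hK
        (hbd.mul_left (2 * Real.pi * R * Real.exp (2 * Real.pi * R)))
        (f := fun j z => (Complex.exp (2 * Complex.I * Real.pi * z * q.1 j) - 1) / (1 - q.2 j))
        (Eventually.of_forall fun j z hz => norm_exp_sub_one_div_le (hq j).1.1 (hq j).1.2 (hd j)
          (hq j).2.2 (hR z hz)) (fun j => (hf j).continuous.continuousOn)
      refine this.congr_right fun z _ => ?_
      exact (tprod_congr fun j => xiFactor_eq_one_add (ne_one_of_mem_markBox hd hq j) z).symm)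
  rw [hasProdLocallyUniformlyOn_iff_tendstoLocallyUniformlyOn] at h
  rw [← differentiableOn_univ]
  refine h.differentiableOn (Eventually.of_forall fun J => ?_) isOpen_univ
  exact DifferentiableOn.fun_finsetProd fun j _ =>
    ((differentiable_const 1).add (hf j)).differentiableOn

end

/-! ### Characteristic polynomials of weighted permutation matrices -/

/-- A permutation all of whose nonempty invariant sets are everything. -/
theorem perm_eq_one_or_eq_of_forall {ι : Type*} {τ π : Equiv.Perm ι}
    (hτ : ∀ T : Set ι, T.Nonempty → (∀ i ∈ T, τ i ∈ T) → T = Set.univ)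
    (h : ∀ i, π i = i ∨ π i = τ i) : π = 1 ∨ π = τ := by
  by_cases hT : {i | π i = τ i}.Nonempty
  · right
    -- The agreement set of `π` and `τ` is `τ`-invariant: if `π` fixes `τ i = π i`, injectivity
    -- gives `τ i = i`, and the two still agree at `τ i`.
    have := hτ _ hT fun i hi => by
      simp only [Set.mem_ofPred_eq] at hi ⊢
      rcases h (τ i) with h1 | h1
      · have h2 : τ i = i := π.injective (h1.trans hi.symm)
        rw [h2, hi, h2]
      · exact h1
    ext i
    exact Set.eq_univ_iff_forall.1 this i
  · left
    ext i
    rcases h i with h1 | h1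
    · simpa using h1
    · exact absurd ⟨i, h1⟩ hT

theorem ne_of_forall_invariant {ι : Type*} {τ : Equiv.Perm ι}
    (hτ : ∀ T : Set ι, T.Nonempty → (∀ i ∈ T, τ i ∈ T) → T = Set.univ) (h1 : τ ≠ 1) (i : ι) :
    τ i ≠ i := by
  intro hi
  have hs := hτ {i} ⟨i, rfl⟩ (by simpa using hi)
  refine h1 (Equiv.ext fun k => ?_)
  have h2 : τ k = i := Set.eq_univ_iff_forall.1 hs (τ k)
  have h3 : k = i := Set.eq_univ_iff_forall.1 hs k
  exact h2.trans h3.symm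

/-- Orbits are invariant, so `τ` is a single cycle; it has no fixed point, so the cycle has full
length. -/
theorem sign_of_forall_invariant {ι : Type*} [Fintype ι] [DecidableEq ι] {τ : Equiv.Perm ι}
    (hτ : ∀ T : Set ι, T.Nonempty → (∀ i ∈ T, τ i ∈ T) → T = Set.univ) (h1 : τ ≠ 1) :
    (Equiv.Perm.sign τ : ℤ) = -(-1) ^ Fintype.card ι := by
  have hne := ne_of_forall_invariant hτ h1
  have hc : τ.IsCycle := by
    obtain ⟨i, hi⟩ := not_forall.1 (fun h => h1 (Equiv.ext h))
    refine ⟨i, hi, fun k _ => ?_⟩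
    have := hτ {k | τ.SameCycle i k} ⟨i, Equiv.Perm.SameCycle.refl _ _⟩ fun k hk =>
      Equiv.Perm.sameCycle_apply_right.2 hk
    exact Set.eq_univ_iff_forall.1 this k
  have hs : τ.support = Finset.univ := by
    ext i; simp [hne i]
  rw [hc.sign, hs]
  simp

/-- The characteristic polynomial of a weighted transitive permutation matrix. -/
theorem det_smul_one_sub_of_forall_invariant {ι : Type*} [Fintype ι] [DecidableEq ι] [Nonempty ι]
    {τ : Equiv.Perm ι} (hτ : ∀ T : Set ι, T.Nonempty → (∀ i ∈ T, τ i ∈ T) → T = Set.univ)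
    {A : Matrix ι ι ℂ} (hA : ∀ i j, i ≠ τ j → A i j = 0) (z : ℂ) :
    (z • (1 : Matrix ι ι ℂ) - A).det = z ^ Fintype.card ι - ∏ j, A (τ j) j := by
  -- When `τ = 1` there is a single index, and the two surviving terms of the Leibniz expansion
  -- would be the same one.
  by_cases h1 : τ = 1
  · have hsub : Subsingleton ι := by
      refine ⟨fun i k => ?_⟩
      have := hτ {i} ⟨i, rfl⟩ (by simp [h1])
      exact (Set.eq_univ_iff_forall.1 this k).symm
    obtain ⟨i⟩ := ‹Nonempty ι›
    rw [Matrix.det_eq_elem_of_subsingleton _ i]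
    have : Unique ι := ⟨⟨i⟩, fun k => Subsingleton.elim _ _⟩
    have hcard : Fintype.card ι = 1 := Fintype.card_unique
    rw [hcard, Fintype.prod_subsingleton _ i]
    simp [h1]
  · rw [Matrix.det_apply]
    -- A nonzero term requires `π i = i` or `π i = τ i` for every `i`, which leaves only the
    -- identity and `τ`.
    have h0 : ∀ π : Equiv.Perm ι, π ∉ ({1, τ} : Finset (Equiv.Perm ι)) →
        Equiv.Perm.sign π • ∏ j, (z • (1 : Matrix ι ι ℂ) - A) (π j) j = 0 := by
      intro π hπ
      rw [Finset.mem_insert, Finset.mem_singleton] at hπ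
      have : ∃ i, π i ≠ i ∧ π i ≠ τ i := by
        by_contra! hcon
        exact hπ (perm_eq_one_or_eq_of_forall hτ fun i =>
          or_iff_not_imp_left.2 fun h => hcon i h)
      obtain ⟨i, hi1, hi2⟩ := this
      rw [Finset.prod_eq_zero (Finset.mem_univ i), smul_zero]
      simp [hi1, hA _ _ hi2]
    rw [← Finset.sum_subset (Finset.subset_univ {1, τ}) fun π _ hπ => h0 π hπ,
      Finset.sum_pair (Ne.symm h1)]
    have hne := ne_of_forall_invariant hτ h1
    have e1 : ∏ j, (z • (1 : Matrix ι ι ℂ) - A) ((1 : Equiv.Perm ι) j) j = z ^ Fintype.card ι := by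
      rw [Finset.prod_congr rfl (g := fun _ => z), Finset.prod_const, Finset.card_univ]
      intro j _
      simp [hA j j (hne j).symm]
    have e2 : ∏ j, (z • (1 : Matrix ι ι ℂ) - A) (τ j) j =
        (-1) ^ Fintype.card ι * ∏ j, A (τ j) j := by
      rw [← Finset.card_univ, ← Finset.prod_const, ← Finset.prod_mul_distrib]
      refine Finset.prod_congr rfl fun j _ => ?_
      simp [hne j]
    rw [e1, e2, Equiv.Perm.sign_one, one_smul, Units.smul_def, sign_of_forall_invariant hτ h1,
      zsmul_eq_mul]
    push_cast
    rw [← mul_assoc, neg_mul, ← mul_pow]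
    simp
    ring

/-- The characteristic polynomial of a modified permutation matrix, when the fibres of `c` are the
supports of the cycles of the permutation. -/
theorem charDet_eq_prod {n : ℕ} {σ : Equiv.Perm (Fin n)} {M : Matrix (Fin n) (Fin n) ℂ}
    (hM : ∀ i j, i ≠ σ j → M i j = 0) {c : Fin n → ℕ} (hc : ∀ k, c (σ k) = c k)
    (hσ : ∀ T : Set (Fin n), (∀ i ∈ T, σ i ∈ T) → ∀ i ∈ T, ∀ k, c k = c i → k ∈ T) (z : ℂ) :
    charDet M z = ∏ a ∈ Finset.univ.image c,
      (z ^ (Finset.univ.filter fun k => c k = a).card -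
        ∏ k ∈ Finset.univ.filter (fun k => c k = a), M (σ k) k) := by
  -- No entry links two different fibres of `c`, so the determinant splits into those of the
  -- diagonal blocks.
  have hbt : (z • (1 : Matrix (Fin n) (Fin n) ℂ) - M).BlockTriangular c := by
    intro i j hij
    have h1 : i ≠ j := by rintro rfl; exact lt_irrefl _ hij
    have h2 : i ≠ σ j := by rintro rfl; rw [hc] at hij; exact lt_irrefl _ hij
    simp [h1, hM i j h2]
  rw [charDet, hbt.det]
  refine Finset.prod_congr rfl fun a ha => ?_
  obtain ⟨k₀, -, hk₀⟩ := Finset.mem_image.1 ha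
  have : Nonempty {k // c k = a} := ⟨⟨k₀, hk₀⟩⟩
  let τ : Equiv.Perm {k // c k = a} := σ.subtypePerm (p := fun k => c k = a) fun k => by rw [hc]
  have hτ : ∀ T : Set {k // c k = a}, T.Nonempty → (∀ i ∈ T, τ i ∈ T) → T = Set.univ := by
    rintro T ⟨i, hi⟩ hT
    refine Set.eq_univ_iff_forall.2 fun k => ?_
    have := hσ (Subtype.val '' T) (by
      rintro _ ⟨i, hi, rfl⟩
      exact ⟨τ i, hT i hi, rfl⟩) i ⟨i, hi, rfl⟩ k (k.2.trans i.2.symm)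
    obtain ⟨k', hk', e⟩ := this
    rwa [← Subtype.ext e]
  have hblock : (z • (1 : Matrix (Fin n) (Fin n) ℂ) - M).toSquareBlock c a =
      z • (1 : Matrix {k // c k = a} {k // c k = a} ℂ) - M.toSquareBlock c a := by
    ext i j
    simp [Matrix.toSquareBlock_def, Matrix.one_apply, Subtype.ext_iff]
  rw [hblock, det_smul_one_sub_of_forall_invariant hτ (A := M.toSquareBlock c a)]
  · rw [Fintype.card_subtype]
    congr 1
    rw [← Finset.prod_subtype_eq_prod_filter, Finset.subtype_univ]
    rfl
  · intro i j hij
    refine hM _ _ fun h => hij (Subtype.ext h)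

/-! ### Arcs on a circle; the cycles of the permutation are the occupied circles -/

theorem arcLength_pos {L s t : ℝ} (hs : s ≤ L) (ht : 0 < t) : 0 < arcLength L s t := by
  unfold arcLength; split_ifs <;> linarith

theorem arcLength_injective {L s t t' : ℝ} (ht : t ∈ Set.Ioc 0 L) (ht' : t' ∈ Set.Ioc 0 L)
    (h : arcLength L s t = arcLength L s t') : t = t' := by
  obtain ⟨h1, h2⟩ := ht
  obtain ⟨h3, h4⟩ := ht'
  unfold arcLength at h; split_ifs at h <;> linarith

theorem arcLength_injective_left {L s s' t : ℝ} (hs : s ∈ Set.Ioc 0 L) (hs' : s' ∈ Set.Ioc 0 L)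
    (h : arcLength L s t = arcLength L s' t) : s = s' := by
  obtain ⟨h1, h2⟩ := hs
  obtain ⟨h3, h4⟩ := hs'
  unfold arcLength at h; split_ifs at h <;> linarith

/-- Concatenation of arcs: a point `t` met before `t'` cuts the arc from `s` to `t'` in two. -/
theorem arcLength_sub {L s t t' : ℝ} (hs : s ∈ Set.Ioc 0 L) (ht : t ∈ Set.Ioc 0 L)
    (ht' : t' ∈ Set.Ioc 0 L) (h : arcLength L s t < arcLength L s t') :
    arcLength L t t' = arcLength L s t' - arcLength L s t := by
  obtain ⟨h1, h2⟩ := hs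
  obtain ⟨h3, h4⟩ := ht
  obtain ⟨h5, h6⟩ := ht'
  unfold arcLength at h ⊢; split_ifs at h ⊢ <;> linarith

theorem arcLength_sub_left {L s s' t : ℝ} (hs : s ∈ Set.Ioc 0 L) (hs' : s' ∈ Set.Ioc 0 L)
    (ht : t ∈ Set.Ioc 0 L) (h : arcLength L s t < arcLength L s' t) :
    arcLength L s' s = arcLength L s' t - arcLength L s t := by
  obtain ⟨h1, h2⟩ := hs
  obtain ⟨h3, h4⟩ := hs'
  obtain ⟨h5, h6⟩ := ht
  unfold arcLength at h ⊢; split_ifs at h ⊢ <;> linarith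

/-- The points are distinct and have positions in `(0, L]` on their circle of perimeter `L`. -/
def GoodPoints (l : ℕ → ℝ) (x : ℕ → ℕ × ℝ) : Prop :=
  (∀ k, (x k).2 ∈ Set.Ioc 0 (l (x k).1)) ∧ Function.Injective x

section

variable {l : ℕ → ℝ} {x : ℕ → ℕ × ℝ} {n : ℕ}

theorem nextIndex_fst (k : Fin n) : (x (nextIndex l x n k)).1 = (x k).1 :=
  (Finset.mem_filter.1 (exists_next l x k).choose_spec.1).2

theorem arcLength_nextIndex_le {k m : Fin n} (h : (x m).1 = (x k).1) :
    arcLength (l (x k).1) (x k).2 (x (nextIndex l x n k)).2 ≤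
      arcLength (l (x k).1) (x k).2 (x m).2 :=
  (exists_next l x k).choose_spec.2 m (by simpa using h)

variable (hx : GoodPoints l x)
include hx

theorem GoodPoints.mem_Ioc {j : ℕ} {k : ℕ} (h : (x k).1 = j) : (x k).2 ∈ Set.Ioc 0 (l j) :=
  h ▸ hx.1 k

theorem GoodPoints.fin_ext {k m : Fin n} (h1 : (x k).1 = (x m).1) (h2 : (x k).2 = (x m).2) :
    k = m :=
  Fin.ext (hx.2 (Prod.ext h1 h2))

/-- Suppose two points have the same successor. The one with the shorter arc to it would lie between
the other point and that successor, contradicting that no point is met earlier. So the arcs, hence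
the points, coincide. -/
theorem nextIndex_injective : Function.Injective (nextIndex l x n) := by
  have key : ∀ k k' : Fin n, nextIndex l x n k = nextIndex l x n k' →
      ¬ arcLength (l (x k').1) (x k).2 (x (nextIndex l x n k')).2 <
        arcLength (l (x k').1) (x k').2 (x (nextIndex l x n k')).2 := by
    intro k k' h hlt
    have hkk : (x k).1 = (x k').1 := by
      rw [← nextIndex_fst (l := l) k, h, nextIndex_fst]
    have h1 := arcLength_sub_left (hx.mem_Ioc hkk) (hx.1 k') (hx.mem_Ioc (nextIndex_fst k')) hlt
    have h2 := arcLength_nextIndex_le (l := l) hkk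
    have h3 := arcLength_pos (hx.mem_Ioc hkk).2 (hx.1 (nextIndex l x n k')).1
    linarith
  intro k k' h
  have hkk : (x k).1 = (x k').1 := by
    rw [← nextIndex_fst (l := l) k, h, nextIndex_fst]
  have h1 := key k k' h
  have h2 := key k' k h.symm
  rw [h, hkk] at h2
  exact hx.fin_ext hkk
    (arcLength_injective_left (hx.mem_Ioc hkk) (hx.1 k') (le_antisymm (not_lt.1 h2) (not_lt.1 h1)))

theorem circlePerm_apply (k : Fin n) : circlePerm l x n k = nextIndex l x n k := by
  rw [circlePerm, dif_pos (Finite.injective_iff_bijective.1 (nextIndex_injective hx))]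
  rfl

theorem circlePerm_fst (k : Fin n) : (x (circlePerm l x n k)).1 = (x k).1 := by
  rw [circlePerm_apply hx, nextIndex_fst]

/-- The circles are the cycles: a set invariant by `σ_n` that meets a circle contains all the points
of this circle. -/
theorem mem_of_circlePerm_invariant {T : Set (Fin n)} (hT : ∀ i ∈ T, circlePerm l x n i ∈ T)
    {i : Fin n} (hi : i ∈ T) {k : Fin n} (hk : (x k).1 = (x i).1) : k ∈ T := by
  classical
  by_contra hkT
  -- Take the point of `T` on the circle with the shortest arc to `k`. Its successor is again in `T`
  -- and, not being `k`, is strictly closer to `k`.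
  obtain ⟨t, ht, hmin⟩ := Finset.exists_min_image
    (Finset.univ.filter fun t : Fin n => t ∈ T ∧ (x t).1 = (x k).1)
    (fun t => arcLength (l (x k).1) (x t).2 (x k).2) ⟨i, by simp [hi, hk]⟩
  simp only [Finset.mem_filter, Finset.mem_univ, true_and] at ht hmin
  have hT' := hT t ht.1
  rw [circlePerm_apply hx] at hT'
  have hf : (x (nextIndex l x n t)).1 = (x k).1 := (nextIndex_fst t).trans ht.2
  have h1 := hmin _ ⟨hT', hf⟩
  have h2 := arcLength_nextIndex_le (l := l) (k := t) ht.2.symm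
  rw [ht.2] at h2
  have hlt := h2.lt_of_ne fun h => hkT (hx.fin_ext hf
    (arcLength_injective (hx.mem_Ioc hf) (hx.1 k) h) ▸ hT')
  have h3 := arcLength_sub (hx.mem_Ioc ht.2) (hx.mem_Ioc hf) (hx.1 k) hlt
  have h4 := arcLength_pos (hx.mem_Ioc ht.2).2 (hx.mem_Ioc hf).1
  linarith

omit hx in
/-- The number of points among the first `n` ones that are on the circle `j`. -/
def circleCount (x : ℕ → ℕ × ℝ) (n j : ℕ) : ℕ := ((Finset.range n).filter fun k => (x k).1 = j).card

omit hx in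
theorem card_filter_fin_eq (j : ℕ) :
    (Finset.univ.filter fun k : Fin n => (x k).1 = j).card = circleCount x n j := by
  rw [circleCount, Finset.card_filter, Finset.card_filter,
    ← Fin.sum_univ_eq_sum_range (fun k => if (x k).1 = j then 1 else 0)]

theorem charDet_eq_prod_circleCount {M : Matrix (Fin n) (Fin n) ℂ}
    (hM : ∀ i j, i ≠ circlePerm l x n j → M i j = 0) (z : ℂ) :
    charDet M z = ∏ a ∈ Finset.univ.image fun k : Fin n => (x k).1,
      (z ^ circleCount x n a -
        ∏ k ∈ Finset.univ.filter (fun k : Fin n => (x k).1 = a), M (circlePerm l x n k) k) := by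
  rw [charDet_eq_prod hM (c := fun k : Fin n => (x k).1) (circlePerm_fst hx)
    fun T hT i hi k hk => mem_of_circlePerm_invariant hx hT hi hk]
  simp_rw [card_filter_fin_eq]

omit hx in
theorem circleCount_eq_zero {j : ℕ} (h : j ∉ Finset.univ.image fun k : Fin n => (x k).1) :
    circleCount x n j = 0 := by
  rw [← card_filter_fin_eq, Finset.card_eq_zero, Finset.filter_eq_empty_iff]
  intro k _ hk
  exact h (Finset.mem_image.2 ⟨k, Finset.mem_univ _, hk⟩)

omit hx in
theorem circleCount_pos {j : ℕ} (h : j ∈ Finset.univ.image fun k : Fin n => (x k).1) :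
    0 < circleCount x n j := by
  obtain ⟨k, -, rfl⟩ := Finset.mem_image.1 h
  rw [← card_filter_fin_eq, Finset.card_pos]
  exact ⟨k, by simp⟩

omit hx in
-- A circle without points contributes the factor 1 as soon as its mark is not 1, so the product is
-- finite.
theorem xiInfty_circleCount {v : ℕ → ℂ} (hv : ∀ j, circleCount x n j = 0 → v j ≠ 1) (z : ℂ) :
    xiInfty (fun j => circleCount x n j / n) v z =
      ∏ a ∈ Finset.univ.image fun k : Fin n => (x k).1,
        (Complex.exp (2 * Complex.I * Real.pi * z / n) ^ circleCount x n a - v a) / (1 - v a) := by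
  rw [xiInfty, tprod_eq_prod (s := Finset.univ.image fun k : Fin n => (x k).1)]
  · refine Finset.prod_congr rfl fun a _ => ?_
    rw [xiFactor, ← Complex.exp_nat_mul]
    congr 3
    push_cast
    ring
  · intro j hj
    have h0 := circleCount_eq_zero hj
    have : 1 - v j ≠ 0 := sub_ne_zero.2 (hv j h0).symm
    simp [xiFactor, h0, div_self this]

/-- The characteristic polynomial of a modified permutation matrix in terms of the number of
points and the marks of the circles. -/
theorem xiTilde_eq_xiInfty {M : Matrix (Fin n) (Fin n) ℂ}
    (hM : ∀ i j, i ≠ circlePerm l x n j → M i j = 0) {v : ℕ → ℂ} (hv1 : ∀ j, v j ≠ 1)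
    (hv : ∀ j, (∃ k : Fin n, (x k).1 = j) →
      ∏ k ∈ Finset.univ.filter (fun k : Fin n => (x k).1 = j), M (circlePerm l x n k) k = v j)
    (z : ℂ) :
    xiTilde M z = xiInfty (fun j => circleCount x n j / n) v z := by
  rw [xiTilde, charDet_eq_prod_circleCount hx hM, charDet_eq_prod_circleCount hx hM,
    xiInfty_circleCount (fun j _ => hv1 j), ← Finset.prod_div_distrib]
  refine Finset.prod_congr rfl fun a ha => ?_
  obtain ⟨k, -, hk⟩ := Finset.mem_image.1 ha
  rw [hv a ⟨k, hk⟩, one_pow]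

/-- The mark of a circle carrying `N` points that corresponds to the angle `α`. -/
noncomputable def angleMark (α : ℝ) (N : ℕ) : ℂ :=
  if N = 0 then -1 else Complex.exp (-(2 * Complex.I * Real.pi * α * N))

/-- Dividing numerator and denominator by e^{2iπαN} turns a rotation of the evaluation point into a
mark. An empty circle would get the mark 1 and the factor 0/0; the value -1 in `angleMark` makes
this factor 1. -/
theorem xiAlpha_eq_xiInfty (α : ℝ) (z : ℂ) :
    xiAlpha α (permMat (circlePerm l x n)) z =
      xiInfty (fun j => circleCount x n j / n) (fun j => angleMark α (circleCount x n j)) z := by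
  have hM : ∀ i j, i ≠ circlePerm l x n j → permMat (circlePerm l x n) i j = 0 := by
    intro i j h
    simp [permMat, h]
  rw [xiAlpha, charDet_eq_prod_circleCount hx hM, charDet_eq_prod_circleCount hx hM,
    xiInfty_circleCount (fun j h => by simp [angleMark, h]; norm_num), ← Finset.prod_div_distrib]
  refine Finset.prod_congr rfl fun a ha => ?_
  have hN := (circleCount_pos ha).ne'
  have h1 : ∏ k ∈ Finset.univ.filter (fun k : Fin n => (x k).1 = a),
      permMat (circlePerm l x n) (circlePerm l x n k) k = 1 :=
    Finset.prod_eq_one fun k _ => by simp [permMat]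
  rw [h1, angleMark, if_neg hN, ← Complex.exp_nat_mul, ← Complex.exp_nat_mul, ← Complex.exp_nat_mul]
  set N : ℂ := (circleCount x n a : ℂ)
  have e1 : Complex.exp (N * (2 * Complex.I * Real.pi * (z / n + α))) - 1 =
      Complex.exp (N * (2 * Complex.I * Real.pi * α)) *
      (Complex.exp (N * (2 * Complex.I * Real.pi * z / n)) -
        Complex.exp (-(2 * Complex.I * Real.pi * α * N))) := by
    rw [mul_sub, ← Complex.exp_add, ← Complex.exp_add]
    congr 1
    · congr 1; ring
    · rw [eq_comm, Complex.exp_eq_one_iff]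
      exact ⟨0, by simp; ring⟩
  have e2 : Complex.exp (N * (2 * Complex.I * Real.pi * α)) - 1 =
      Complex.exp (N * (2 * Complex.I * Real.pi * α)) *
      (1 - Complex.exp (-(2 * Complex.I * Real.pi * α * N))) := by
    rw [mul_sub, mul_one, ← Complex.exp_add]
    congr 1
    rw [eq_comm, Complex.exp_eq_one_iff]
    exact ⟨0, by simp; ring⟩
  rw [e1, e2, mul_div_mul_left _ _ (Complex.exp_ne_zero _)]

end

/-! ### Consequences of the circle coupling: masses, almost sure position of the points -/

theorem uniformOnCircles_prod (l : ℕ → ℝ) (j : ℕ) {A : Set ℝ} (hA : MeasurableSet A) :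
    uniformOnCircles l ({j} ×ˢ A) = volume (A ∩ Set.Ico 0 (l j)) := by
  have hm : MeasurableSet (({j} : Set ℕ) ×ˢ A) := (measurableSet_singleton j).prod hA
  rw [uniformOnCircles, Measure.sum_apply _ hm, tsum_eq_single j]
  · have : Prod.mk j ⁻¹' (({j} : Set ℕ) ×ˢ A) = A := by ext; simp
    rw [Measure.map_apply measurable_prodMk_left hm, this, Measure.restrict_apply hA]
  · intro i hi
    have : Prod.mk i ⁻¹' (({j} : Set ℕ) ×ˢ A) = ∅ := by ext; simp [hi]
    rw [Measure.map_apply measurable_prodMk_left hm, this, measure_empty]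

/-- The total perimeter of the circles with index in `D`. -/
noncomputable def massOn (D : Set ℕ) (l : ℕ → ℝ) : ENNReal :=
  ∑' j, D.indicator (fun j => ENNReal.ofReal (l j)) j

theorem measurable_massOn (D : Set ℕ) : Measurable (massOn D) := by
  refine Measurable.tsum fun j => ?_
  by_cases hj : j ∈ D
  · simp only [Set.indicator_of_mem hj]; fun_prop
  · simp only [Set.indicator_of_notMem hj]; fun_prop

theorem uniformOnCircles_preimage_fst (l : ℕ → ℝ) (D : Set ℕ) :
    uniformOnCircles l (Prod.fst ⁻¹' D) = massOn D l := by
  have hm : MeasurableSet (Prod.fst ⁻¹' D : Set (ℕ × ℝ)) := measurable_fst (Set.to_countable D).measurableSet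
  rw [uniformOnCircles, Measure.sum_apply _ hm, massOn]
  refine tsum_congr fun j => ?_
  rw [Measure.map_apply measurable_prodMk_left hm]
  by_cases hj : j ∈ D
  · have : Prod.mk j ⁻¹' (Prod.fst ⁻¹' D) = (Set.univ : Set ℝ) := by ext; simp [hj]
    rw [this, Set.indicator_of_mem hj, Measure.restrict_apply_univ, Real.volume_Ico, sub_zero]
  · have : Prod.mk j ⁻¹' (Prod.fst ⁻¹' D) = (∅ : Set ℝ) := by ext; simp [hj]
    rw [this, Set.indicator_of_notMem hj, measure_empty]

theorem massOn_singleton (j : ℕ) (l : ℕ → ℝ) : massOn {j} l = ENNReal.ofReal (l j) := by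
  rw [massOn, tsum_eq_single j]
  · simp
  · intro i hi; simp [hi]

theorem massOn_toReal {D : Set ℕ} {l : ℕ → ℝ} (hl : l ∈ nablaPrime) :
    (massOn D l).toReal = ∑' j, D.indicator l j := by
  rw [massOn, ENNReal.tsum_toReal_eq]
  · refine tsum_congr fun j => ?_
    by_cases hj : j ∈ D
    · simp [hj, (hl.1 j).1]
    · simp [hj]
  · intro j
    by_cases hj : j ∈ D <;> simp [hj]

theorem massOn_ne_top {D : Set ℕ} {l : ℕ → ℝ} (hl : l ∈ nablaPrime) : massOn D l ≠ ⊤ := by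
  have h1 : massOn D l ≤ ∑' j, ENNReal.ofReal (l j) :=
    ENNReal.tsum_le_tsum fun j => Set.indicator_le_self _ _ _
  rw [← ENNReal.ofReal_tsum_of_nonneg (fun j => (hl.1 j).1) hl.2.2.summable] at h1
  exact ne_top_of_le_ne_top ENNReal.ofReal_ne_top h1

theorem massOn_Ici_toReal {J : ℕ} {l : ℕ → ℝ} (hl : l ∈ nablaPrime) :
    (massOn (Set.Ici J) l).toReal = 1 - ∑ j ∈ Finset.range J, l j := by
  rw [massOn_toReal hl, eq_sub_iff_add_eq, ← hl.2.2.tsum_eq,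
    ← hl.2.2.summable.sum_add_tsum_nat_add J, add_comm]
  congr 1
  have hs : Summable ((Set.Ici J).indicator l) := hl.2.2.summable.indicator _
  rw [← hs.sum_add_tsum_nat_add J, Finset.sum_eq_zero, zero_add]
  · refine tsum_congr fun j => ?_
    rw [Set.indicator_of_mem]
    simp
  · intro j hj
    rw [Set.indicator_of_notMem]
    simpa using hj

section

variable {Ω : Type*} [MeasurableSpace Ω] {μ : Measure Ω}
  {p : Measure (ℕ → ℝ)} {y : Ω → ℕ → ℝ} {x : ℕ → Ω → ℕ × ℝ}
  (h : CircleCoupling μ p y x)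
include h

theorem CircleCoupling.ae_y {P : (ℕ → ℝ) → Prop} (hP : ∀ᵐ l ∂p, P l) : ∀ᵐ ω ∂μ, P (y ω) :=
  ae_of_ae_map h.measurable_y.aemeasurable (h.law_y.symm ▸ hP)

theorem CircleCoupling.measure_inter {B : Set (ℕ → ℝ)} (hB : MeasurableSet B) (k : ℕ)
    {A : Set (ℕ × ℝ)} (hA : MeasurableSet A) :
    μ (y ⁻¹' B ∩ x k ⁻¹' A) = ∫⁻ ω in y ⁻¹' B, uniformOnCircles (y ω) A ∂μ := by
  simpa using h.cond_iid B hB {k} (fun _ => A) fun _ => hA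

theorem CircleCoupling.measure_preimage (k : ℕ) {A : Set (ℕ × ℝ)} (hA : MeasurableSet A) :
    μ (x k ⁻¹' A) = ∫⁻ ω, uniformOnCircles (y ω) A ∂μ := by
  simpa using h.measure_inter MeasurableSet.univ k hA

theorem CircleCoupling.measure_preimage_inter {k m : ℕ} (hkm : k ≠ m) {A : Set (ℕ × ℝ)}
    (hA : MeasurableSet A) :
    μ (x k ⁻¹' A ∩ x m ⁻¹' A) =
      ∫⁻ ω, uniformOnCircles (y ω) A * uniformOnCircles (y ω) A ∂μ := by
  simpa [Finset.prod_pair hkm] using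
    h.cond_iid Set.univ MeasurableSet.univ {k, m} (fun _ => A) fun _ => hA

theorem CircleCoupling.ae_pos (k : ℕ) : ∀ᵐ ω ∂μ, 0 < (x k ω).2 := by
  have h0 : ∀ j : ℕ, μ (x k ⁻¹' ({j} ×ˢ Set.Iic 0)) = 0 := by
    intro j
    rw [h.measure_preimage k ((measurableSet_singleton j).prod measurableSet_Iic)]
    simp_rw [uniformOnCircles_prod _ j measurableSet_Iic]
    have : ∀ ω, volume (Set.Iic 0 ∩ Set.Ico 0 (y ω j)) = 0 := fun ω =>
      measure_mono_null (t := {0}) (fun t ht => le_antisymm ht.1 ht.2.1) (by simp)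
    simp [this]
  have := measure_iUnion_null h0
  refine measure_mono_null (fun ω hω => ?_) this
  simp only [Set.mem_compl_iff, Set.mem_ofPred_eq, not_lt] at hω
  exact Set.mem_iUnion.2 ⟨(x k ω).1, rfl, hω⟩

/-- The coupling only tests rectangles in (y, x_k). The event that the position exceeds the
perimeter is covered by countably many of them by inserting a rational in between. -/
theorem CircleCoupling.ae_le (k : ℕ) : ∀ᵐ ω ∂μ, (x k ω).2 ≤ y ω (x k ω).1 := by
  have h0 : ∀ (j : ℕ) (q : ℚ),
      μ (y ⁻¹' {l | l j < q} ∩ x k ⁻¹' ({j} ×ˢ Set.Ioi (q : ℝ))) = 0 := by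
    intro j q
    have hB : MeasurableSet {l : ℕ → ℝ | l j < q} :=
      measurableSet_lt (measurable_pi_apply j) measurable_const
    rw [h.measure_inter hB k ((measurableSet_singleton j).prod measurableSet_Ioi)]
    rw [setLIntegral_congr_fun (g := fun _ => 0) (h.measurable_y hB)]
    · simp
    · intro ω hω
      simp only
      rw [uniformOnCircles_prod _ j measurableSet_Ioi]
      have : Set.Ioi (q : ℝ) ∩ Set.Ico 0 (y ω j) = ∅ := by
        ext t
        simp only [Set.mem_inter_iff, Set.mem_Ioi, Set.mem_Ico, Set.mem_empty_iff_false, iff_false]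
        intro ht
        have : y ω j < q := hω
        linarith [ht.1, ht.2.2]
      simp [this]
  have := measure_iUnion_null fun j => measure_iUnion_null (h0 j)
  refine measure_mono_null (fun ω hω => ?_) this
  simp only [Set.mem_compl_iff, Set.mem_ofPred_eq, not_le] at hω
  obtain ⟨q, hq1, hq2⟩ := exists_rat_btwn hω
  exact Set.mem_iUnion.2 ⟨(x k ω).1, Set.mem_iUnion.2 ⟨q, hq1, rfl, hq2⟩⟩

/-- Cut the circles into cells of length 1/(M+1). Given y, the second point falls in the cell of the
first with probability at most 1/(M+1), and `M` is arbitrary. -/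
theorem CircleCoupling.ae_ne [IsProbabilityMeasure μ] {k m : ℕ} (hkm : k ≠ m) : ∀ᵐ ω ∂μ, x k ω ≠ x m ω := by
  let I : ℕ → ℕ × ℤ → Set (ℕ × ℝ) := fun M q =>
    {q.1} ×ˢ Set.Ico ((q.2 : ℝ) / (M + 1)) ((q.2 + 1) / (M + 1))
  have hI : ∀ M q, MeasurableSet (I M q) := fun M q =>
    (measurableSet_singleton _).prod measurableSet_Ico
  have hfloor : ∀ (M : ℕ) (q : ℕ × ℤ) (t : ℕ × ℝ), t ∈ I M q ↔ q = (t.1, ⌊t.2 * (M + 1)⌋) := by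
    rintro M ⟨j, i⟩ ⟨a, t⟩
    have hM : (0 : ℝ) < M + 1 := by positivity
    simp only [I, Set.mem_prod, Set.mem_singleton_iff, Set.mem_Ico, Prod.mk.injEq]
    rw [div_le_iff₀ hM, lt_div_iff₀ hM, eq_comm (a := a), eq_comm (a := i), Int.floor_eq_iff]
  have hbound : ∀ M : ℕ, μ {ω | x k ω = x m ω} ≤ ENNReal.ofReal (1 / (M + 1)) := by
    intro M
    calc μ {ω | x k ω = x m ω} ≤ μ (⋃ q, x k ⁻¹' I M q ∩ x m ⁻¹' I M q) := by
          refine measure_mono fun ω hω => Set.mem_iUnion.2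
            ⟨((x k ω).1, ⌊(x k ω).2 * (M + 1)⌋), (hfloor _ _ _).2 rfl, (hfloor _ _ _).2 ?_⟩
          rw [show x k ω = x m ω from hω]
      _ ≤ ∑' q, μ (x k ⁻¹' I M q ∩ x m ⁻¹' I M q) := measure_iUnion_le _
      _ ≤ ∑' q, ENNReal.ofReal (1 / (M + 1)) * μ (x k ⁻¹' I M q) := by
          refine ENNReal.tsum_le_tsum fun q => ?_
          rw [h.measure_preimage_inter hkm (hI M q), h.measure_preimage k (hI M q),
            ← lintegral_const_mul' _ _ ENNReal.ofReal_ne_top]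
          refine lintegral_mono fun ω => mul_le_mul_left ?_ _
          rw [uniformOnCircles_prod _ _ measurableSet_Ico]
          refine (measure_mono Set.inter_subset_left).trans ?_
          rw [Real.volume_Ico]
          refine ENNReal.ofReal_le_ofReal (le_of_eq ?_)
          ring
      _ = ENNReal.ofReal (1 / (M + 1)) * μ (⋃ q, x k ⁻¹' I M q) := by
          rw [ENNReal.tsum_mul_left, measure_iUnion _ fun q => h.measurable_x k (hI M q)]
          intro q q' hq
          refine Set.disjoint_left.2 fun ω h1 h2 => hq ?_
          rw [(hfloor _ _ _).1 h1, (hfloor _ _ _).1 h2]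
      _ ≤ ENNReal.ofReal (1 / (M + 1)) * 1 := by
          gcongr
          exact prob_le_one
      _ = _ := mul_one _
  have hlim : Tendsto (fun M : ℕ => ENNReal.ofReal (1 / (M + 1))) atTop (𝓝 0) := by
    rw [← ENNReal.ofReal_zero]
    exact (ENNReal.continuous_ofReal.tendsto 0).comp tendsto_one_div_add_atTop_nhds_zero_nat
  have h0 : μ {ω | x k ω = x m ω} = 0 := le_antisymm (ge_of_tendsto' hlim hbound) bot_le
  simpa [ae_iff] using h0

theorem CircleCoupling.ae_goodPoints [IsProbabilityMeasure μ] : ∀ᵐ ω ∂μ, GoodPoints (y ω) fun k => x k ω := by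
  have h1 : ∀ᵐ ω ∂μ, ∀ k, 0 < (x k ω).2 := ae_all_iff.2 h.ae_pos
  have h2 : ∀ᵐ ω ∂μ, ∀ k, (x k ω).2 ≤ y ω (x k ω).1 := ae_all_iff.2 h.ae_le
  have h3 : ∀ᵐ ω ∂μ, ∀ k m, k ≠ m → x k ω ≠ x m ω := by
    refine ae_all_iff.2 fun k => ae_all_iff.2 fun m => ?_
    by_cases hkm : k = m
    · simp [hkm]
    · filter_upwards [h.ae_ne hkm] with ω hω _ using hω
  filter_upwards [h1, h2, h3] with ω a b c
  refine ⟨fun k => ⟨a k, b k⟩, fun k m e => ?_⟩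
  by_contra hne
  exact c k m hne e

variable (hp : ∀ᵐ l ∂p, l ∈ nablaPrime)
include hp

/-- On the event that each x_k falls in its prescribed set of circles, the law of y acquires as
density the product of the masses. Moments of the counts reduce to this form of conditional
independence. -/
theorem CircleCoupling.setIntegral_iInter {E : Type*} [NormedAddCommGroup E] [NormedSpace ℝ E]
    {g : (ℕ → ℝ) → E} (hg : StronglyMeasurable g) (s : Finset ℕ) (D : ℕ → Set ℕ) :
    ∫ ω in ⋂ k ∈ s, {ω | (x k ω).1 ∈ D k}, g (y ω) ∂μ =
      ∫ ω, (∏ k ∈ s, (massOn (D k) (y ω)).toReal) • g (y ω) ∂μ := by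
  have hd : Measurable fun ω => ∏ k ∈ s, massOn (D k) (y ω) :=
    Finset.measurable_fun_prod _ fun k _ => (measurable_massOn (D k)).comp h.measurable_y
  have hmeas : (μ.restrict (⋂ k ∈ s, {ω | (x k ω).1 ∈ D k})).map y =
      (μ.withDensity fun ω => ∏ k ∈ s, massOn (D k) (y ω)).map y := by
    ext B hB
    rw [Measure.map_apply h.measurable_y hB, Measure.map_apply h.measurable_y hB,
      Measure.restrict_apply (h.measurable_y hB), withDensity_apply _ (h.measurable_y hB)]
    simp_rw [← uniformOnCircles_preimage_fst]
    exact h.cond_iid B hB s (fun k => Prod.fst ⁻¹' D k) fun k =>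
      measurable_fst (Set.to_countable _).measurableSet
  rw [← integral_map (μ := μ.restrict _) h.measurable_y.aemeasurable hg.aestronglyMeasurable, hmeas,
    integral_map h.measurable_y.aemeasurable hg.aestronglyMeasurable,
    integral_withDensity_eq_integral_toReal_smul hd]
  · simp_rw [ENNReal.toReal_prod]
  · filter_upwards [h.ae_y hp] with ω hω
    exact ENNReal.prod_lt_top fun k _ => (massOn_ne_top hω).lt_top

end

/-! ### Generating function, mean and variance of the numbers of points -/

theorem sum_indicator_singleton_or_Ici (c : ℕ → ℂ) (J i : ℕ) :
    ∑ a ∈ Finset.range (J + 1), (if a < J then {a} else Set.Ici J).indicator (fun _ => c a) i =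
      if i < J then c i else c J := by
  rw [Finset.sum_range_succ, if_neg (lt_irrefl J)]
  have h : ∀ a ∈ Finset.range J, (if a < J then {a} else Set.Ici J).indicator (fun _ => c a) i =
      if a = i then c a else 0 := by
    intro a ha
    rw [if_pos (Finset.mem_range.1 ha), Set.indicator_apply]
    simp [eq_comm]
  rw [Finset.sum_congr rfl h, Finset.sum_ite_eq']
  by_cases hi : i < J
  · simp [hi]
  · simp [hi, not_lt.1 hi]

theorem massOn_toReal_le_one {D : Set ℕ} {l : ℕ → ℝ} (hl : l ∈ nablaPrime) :
    (massOn D l).toReal ≤ 1 := by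
  rw [massOn_toReal hl, ← hl.2.2.tsum_eq]
  exact (hl.2.2.summable.indicator D).tsum_le_tsum
    (fun j => Set.indicator_le_self' (fun _ _ => (hl.1 j).1) j) hl.2.2.summable

section

variable {Ω : Type*} [MeasurableSpace Ω] {μ : Measure Ω}
  {p : Measure (ℕ → ℝ)} {y : Ω → ℕ → ℝ} {x : ℕ → Ω → ℕ × ℝ}
  (h : CircleCoupling μ p y x) (hp : ∀ᵐ l ∂p, l ∈ nablaPrime)
include h

theorem CircleCoupling.measurable_y_apply (j : ℕ) : Measurable fun ω => y ω j :=
  (measurable_pi_apply j).comp h.measurable_y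

theorem CircleCoupling.measurable_fst (k : ℕ) : Measurable fun ω => (x k ω).1 :=
  _root_.measurable_fst.comp (h.measurable_x k)

theorem CircleCoupling.measurable_circleCount (n j : ℕ) :
    Measurable fun ω => circleCount (fun k => x k ω) n j := by
  simp_rw [circleCount, Finset.card_filter]
  refine Finset.measurable_fun_sum _ fun k _ => ?_
  exact Measurable.ite (h.measurable_fst k (measurableSet_singleton j)) measurable_const
    measurable_const

include hp

/-- The characteristic function of the numbers of points on the first `J` circles. -/
theorem CircleCoupling.integral_mul_prod {g : (ℕ → ℝ) → ℂ} (hg : StronglyMeasurable g)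
    (hgi : Integrable (fun ω => g (y ω)) μ) (w : ℕ → ℂ) (J n : ℕ) :
    ∫ ω, g (y ω) * ∏ k ∈ Finset.range n, (if (x k ω).1 < J then w (x k ω).1 else 1) ∂μ =
      ∫ ω, g (y ω) * (1 + ∑ j ∈ Finset.range J, y ω j * (w j - 1)) ^ n ∂μ := by
  classical
  set c : ℕ → ℂ := fun a => if a < J then w a else 1 with hc
  -- The circles of index at least `J` are merged into one cell. The product over the points then
  -- expands as a finite sum over the functions `φ` assigning a cell to each point.
  let D : ℕ → Set ℕ := fun a => if a < J then {a} else Set.Ici J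
  have hexp : ∀ i, (if i < J then w i else 1) =
      ∑ a ∈ Finset.range (J + 1), (D a).indicator (fun _ => c a) i := by
    intro i
    rw [sum_indicator_singleton_or_Ici]
    by_cases hi : i < J <;> simp [hc, hi]
  let D' : (Fin n → ℕ) → ℕ → Set ℕ := fun φ k => if hk : k < n then D (φ ⟨k, hk⟩) else Set.univ
  let S : (Fin n → ℕ) → Set Ω := fun φ => ⋂ k ∈ Finset.range n, {ω | (x k ω).1 ∈ D' φ k}
  let G : (Fin n → ℕ) → (ℕ → ℝ) → ℂ := fun φ l => (∏ k, c (φ k)) * g l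
  have hS : ∀ φ, MeasurableSet (S φ) := fun φ =>
    Finset.measurableSet_biInter _ fun k _ => h.measurable_fst k (Set.to_countable _).measurableSet
  have hmem : ∀ φ ω, ω ∈ S φ ↔ ∀ k : Fin n, (x k ω).1 ∈ D (φ k) := by
    intro φ ω
    simp only [S, D', Set.mem_iInter, Finset.mem_range, Set.mem_ofPred_eq]
    constructor
    · intro H k
      simpa using H k k.2
    · intro H k hk
      simpa [hk] using H ⟨k, hk⟩
  set Φ := Fintype.piFinset fun _ : Fin n => Finset.range (J + 1)
  have hL : ∀ ω, g (y ω) * ∏ k ∈ Finset.range n, (if (x k ω).1 < J then w (x k ω).1 else 1) =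
      ∑ φ ∈ Φ, (S φ).indicator (fun ω => G φ (y ω)) ω := by
    intro ω
    simp_rw [hexp]
    rw [Finset.prod_range, Finset.prod_univ_sum, Finset.mul_sum]
    refine Finset.sum_congr rfl fun φ _ => ?_
    by_cases hω : ω ∈ S φ
    · rw [Set.indicator_of_mem hω, mul_comm]
      congr 1
      exact Finset.prod_congr rfl fun k _ => Set.indicator_of_mem ((hmem φ ω).1 hω k) _
    · rw [Set.indicator_of_notMem hω]
      obtain ⟨k, hk⟩ := not_forall.1 (mt (hmem φ ω).2 hω)
      rw [Finset.prod_eq_zero (Finset.mem_univ k), mul_zero]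
      exact Set.indicator_of_notMem hk _
  have hGi : ∀ φ, Integrable (fun ω => G φ (y ω)) μ := fun φ => hgi.const_mul _
  simp_rw [hL]
  rw [integral_finsetSum _ fun φ _ => (hGi φ).indicator (hS φ)]
  have hR : ∀ φ ∈ Φ, ∫ ω, (S φ).indicator (fun ω => G φ (y ω)) ω ∂μ =
      ∫ ω, (∏ k : Fin n, (massOn (D (φ k)) (y ω)).toReal) • G φ (y ω) ∂μ := by
    intro φ _
    rw [integral_indicator (hS φ), h.setIntegral_iInter hp (hg.const_mul _)]
    refine integral_congr_ae (Eventually.of_forall fun ω => ?_)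
    simp only [Finset.prod_range]
    congr 1
    refine Finset.prod_congr rfl fun k _ => ?_
    simp [D']
  rw [Finset.sum_congr rfl hR, ← integral_finsetSum]
  · refine integral_congr_ae ?_
    filter_upwards [h.ae_y hp] with ω hω
    -- As the total mass is 1, the merged cell has weight 1 and mass one minus the sum of the first
    -- `J` perimeters.
    have hφ : (1 + ∑ j ∈ Finset.range J, (y ω j : ℂ) * (w j - 1)) =
        ∑ a ∈ Finset.range (J + 1), ((massOn (D a) (y ω)).toReal : ℂ) * c a := by
      rw [Finset.sum_range_succ]
      have e1 : ∀ a ∈ Finset.range J, ((massOn (D a) (y ω)).toReal : ℂ) * c a = y ω a * w a := by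
        intro a ha
        have ha' := Finset.mem_range.1 ha
        simp only [D, c, if_pos ha', massOn_singleton, ENNReal.toReal_ofReal (hω.1 a).1]
      rw [Finset.sum_congr rfl e1]
      simp only [D, c, lt_irrefl, if_false, massOn_Ici_toReal hω]
      push_cast
      simp only [mul_sub, Finset.sum_sub_distrib]
      ring_nf
    rw [hφ]
    have hpow : (∑ a ∈ Finset.range (J + 1), ((massOn (D a) (y ω)).toReal : ℂ) * c a) ^ n =
        ∏ _k : Fin n, ∑ a ∈ Finset.range (J + 1), ((massOn (D a) (y ω)).toReal : ℂ) * c a := by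
      simp
    rw [hpow, Finset.prod_univ_sum, Finset.mul_sum]
    refine Finset.sum_congr rfl fun φ _ => ?_
    rw [Finset.prod_mul_distrib, Complex.real_smul]
    push_cast
    ring
  · intro φ _
    refine Integrable.bdd_smul (hGi φ) 1 (φ := fun ω =>
      ∏ k : Fin n, (massOn (D (φ k)) (y ω)).toReal) ?_ ?_
    · refine Measurable.aestronglyMeasurable ?_
      exact Finset.measurable_fun_prod _ fun k _ =>
        ((measurable_massOn _).comp h.measurable_y).ennreal_toReal
    · filter_upwards [h.ae_y hp] with ω hω
      rw [Real.norm_eq_abs, abs_of_nonneg (Finset.prod_nonneg fun _ _ => ENNReal.toReal_nonneg)]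
      exact Finset.prod_le_one (fun _ _ => ENNReal.toReal_nonneg) fun k _ =>
        massOn_toReal_le_one hω

theorem CircleCoupling.integral_ite_mul {g : (ℕ → ℝ) → ℝ} (hg : StronglyMeasurable g) (j k : ℕ) :
    ∫ ω, (if (x k ω).1 = j then 1 else 0) * g (y ω) ∂μ = ∫ ω, y ω j * g (y ω) ∂μ := by
  have h1 := h.setIntegral_iInter hp hg {k} fun _ => {j}
  simp only [Finset.mem_singleton, Set.iInter_iInter_eq_left, Set.mem_singleton_iff,
    Finset.prod_singleton, massOn_singleton, smul_eq_mul] at h1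
  have hm : MeasurableSet {ω | (x k ω).1 = j} := h.measurable_fst k (measurableSet_singleton j)
  rw [← integral_indicator hm] at h1
  have e : ∀ ω, (if (x k ω).1 = j then 1 else 0) * g (y ω) =
      {ω | (x k ω).1 = j}.indicator (fun ω => g (y ω)) ω := fun ω => by
    by_cases hj : (x k ω).1 = j <;> simp [hj]
  simp_rw [e, h1]
  refine integral_congr_ae ?_
  filter_upwards [h.ae_y hp] with ω hω
  rw [ENNReal.toReal_ofReal (hω.1 j).1]

theorem CircleCoupling.integral_ite_mul_ite_mul {g : (ℕ → ℝ) → ℝ} (hg : StronglyMeasurable g)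
    (j : ℕ) {k m : ℕ} (hkm : k ≠ m) :
    ∫ ω, (if (x k ω).1 = j then 1 else 0) * ((if (x m ω).1 = j then 1 else 0) * g (y ω)) ∂μ =
      ∫ ω, y ω j * (y ω j * g (y ω)) ∂μ := by
  have h1 := h.setIntegral_iInter hp hg {k, m} fun _ => {j}
  simp only [Finset.prod_pair hkm, massOn_singleton, smul_eq_mul] at h1
  have hm : MeasurableSet (⋂ i ∈ ({k, m} : Finset ℕ), {ω | (x i ω).1 ∈ ({j} : Set ℕ)}) :=
    Finset.measurableSet_biInter _ fun i _ => h.measurable_fst i (measurableSet_singleton j)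
  rw [← integral_indicator hm] at h1
  have e : ∀ ω, (if (x k ω).1 = j then 1 else 0) * ((if (x m ω).1 = j then 1 else 0) * g (y ω)) =
      (⋂ i ∈ ({k, m} : Finset ℕ), {ω | (x i ω).1 ∈ ({j} : Set ℕ)}).indicator
        (fun ω => g (y ω)) ω := fun ω => by
    by_cases hj : (x k ω).1 = j <;> by_cases hj' : (x m ω).1 = j <;> simp [hj, hj']
  simp_rw [e, h1]
  refine integral_congr_ae ?_
  filter_upwards [h.ae_y hp] with ω hω
  rw [ENNReal.toReal_ofReal (hω.1 j).1, mul_assoc]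

omit h hp in
theorem circleCount_cast (x : ℕ → ℕ × ℝ) (n j : ℕ) :
    (circleCount x n j : ℝ) = ∑ k ∈ Finset.range n, if (x k).1 = j then (1 : ℝ) else 0 := by
  rw [circleCount, Finset.card_filter]
  push_cast
  rfl

theorem CircleCoupling.integral_circleCount_mul {g : (ℕ → ℝ) → ℝ} (hg : StronglyMeasurable g)
    (hgi : Integrable (fun ω => g (y ω)) μ) (n j : ℕ) :
    ∫ ω, circleCount (fun k => x k ω) n j * g (y ω) ∂μ = n * ∫ ω, y ω j * g (y ω) ∂μ := by
  simp_rw [circleCount_cast, Finset.sum_mul]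
  rw [integral_finsetSum]
  · simp_rw [h.integral_ite_mul hp hg]
    simp
  · intro k _
    refine hgi.bdd_mul (c := 1) ?_ ?_
    · exact (Measurable.ite (h.measurable_fst k (measurableSet_singleton j)) measurable_const
        measurable_const).aestronglyMeasurable
    · exact Eventually.of_forall fun ω => by split_ifs <;> simp

theorem CircleCoupling.setIntegral_circleCount [IsProbabilityMeasure μ] {B : Set (ℕ → ℝ)} (hB : MeasurableSet B)
    (n j : ℕ) :
    ∫ ω in y ⁻¹' B, (circleCount (fun k => x k ω) n j : ℝ) ∂μ = n * ∫ ω in y ⁻¹' B, y ω j ∂μ := by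
  have hg : StronglyMeasurable (B.indicator fun _ => (1 : ℝ)) :=
    stronglyMeasurable_const.indicator hB
  have := h.integral_circleCount_mul hp hg (Integrable.of_bound
    (hg.comp_measurable h.measurable_y).aestronglyMeasurable 1 (Eventually.of_forall fun ω => by
      by_cases hω : y ω ∈ B <;> simp [hω])) n j
  rw [← integral_indicator (h.measurable_y hB), ← integral_indicator (h.measurable_y hB)]
  have e : ∀ (f : Ω → ℝ) ω,
      (y ⁻¹' B).indicator f ω = f ω * B.indicator (fun _ => (1 : ℝ)) (y ω) := fun f ω => by
    by_cases hω : y ω ∈ B <;> simp [hω]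
  simp_rw [e]
  exact this

/-- The conditional variance of a binomial variable: centred indicators of distinct points are
conditionally uncorrelated. The integral is taken over an event of y because the decay constant is
random and has to be truncated. -/
theorem CircleCoupling.setIntegral_sq_circleCount_sub [IsProbabilityMeasure μ] {B : Set (ℕ → ℝ)} (hB : MeasurableSet B)
    (n j : ℕ) :
    ∫ ω in y ⁻¹' B, (circleCount (fun k => x k ω) n j - n * y ω j) ^ 2 ∂μ =
      n * ∫ ω in y ⁻¹' B, y ω j * (1 - y ω j) ∂μ := by
  have hi : ∀ (f : Ω → ℝ), Measurable f → (∀ᵐ ω ∂μ, |f ω| ≤ 1) → Integrable f μ := fun f hf hb =>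
    Integrable.of_bound hf.aestronglyMeasurable 1 hb
  set g : (ℕ → ℝ) → ℝ := B.indicator fun _ => (1 : ℝ) with hgdef
  have hgm : Measurable g := measurable_const.indicator hB
  have hyg : Measurable fun ω => g (y ω) := hgm.comp h.measurable_y
  have hyj := h.measurable_y_apply j
  have hlj : Measurable fun l : ℕ → ℝ => l j := measurable_pi_apply j
  let e : ℕ → Ω → ℝ := fun k ω => if (x k ω).1 = j then 1 else 0
  have he : ∀ k, Measurable (e k) := fun k =>
    Measurable.ite (h.measurable_fst k (measurableSet_singleton j)) measurable_const
      measurable_const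
  have he1 : ∀ k ω, e k ω ∈ Set.Icc (0 : ℝ) 1 := fun k ω => by simp only [e]; split_ifs <;> simp
  have hg1 : ∀ l, g l ∈ Set.Icc (0 : ℝ) 1 := fun l => by
    by_cases hl : l ∈ B <;> simp [g, hl]
  have hmul : ∀ a b : ℝ, a ∈ Set.Icc (0 : ℝ) 1 → b ∈ Set.Icc (0 : ℝ) 1 →
      a * b ∈ Set.Icc (0 : ℝ) 1 := fun a b ha hb =>
    ⟨mul_nonneg ha.1 hb.1, mul_le_one₀ ha.2 hb.1 hb.2⟩
  have habs : ∀ a : ℝ, a ∈ Set.Icc (0 : ℝ) 1 → |a| ≤ 1 := fun a ha =>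
    (abs_of_nonneg ha.1).trans_le ha.2
  have I1 : ∀ k m, Integrable (fun ω => e k ω * (e m ω * g (y ω))) μ := fun k m =>
    hi _ ((he k).mul ((he m).mul hyg)) (Eventually.of_forall fun ω =>
      habs _ (hmul _ _ (he1 k ω) (hmul _ _ (he1 m ω) (hg1 _))))
  have I2 : ∀ k, Integrable (fun ω => e k ω * (y ω j * g (y ω))) μ := fun k =>
    hi _ ((he k).mul (hyj.mul hyg)) (by
      filter_upwards [h.ae_y hp] with ω hω
      exact habs _ (hmul _ _ (he1 k ω) (hmul _ _ (hω.1 j) (hg1 _))))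
  have I3 : Integrable (fun ω => y ω j * (y ω j * g (y ω))) μ :=
    hi _ (hyj.mul (hyj.mul hyg)) (by
      filter_upwards [h.ae_y hp] with ω hω
      exact habs _ (hmul _ _ (hω.1 j) (hmul _ _ (hω.1 j) (hg1 _))))
  have I4 : Integrable (fun ω => y ω j * g (y ω)) μ :=
    hi _ (hyj.mul hyg) (by
      filter_upwards [h.ae_y hp] with ω hω
      exact habs _ (hmul _ _ (hω.1 j) (hg1 _)))
  have E2 : ∀ k, ∫ ω, e k ω * (y ω j * g (y ω)) ∂μ = ∫ ω, y ω j * (y ω j * g (y ω)) ∂μ := fun k =>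
    h.integral_ite_mul hp (g := fun l => l j * g l) (hlj.mul hgm).stronglyMeasurable j k
  have hkm : ∀ k m, ∫ ω, (e k ω - y ω j) * (e m ω - y ω j) * g (y ω) ∂μ =
      if k = m then ∫ ω, y ω j * (1 - y ω j) * g (y ω) ∂μ else 0 := by
    intro k m
    have hexp : ∀ ω, (e k ω - y ω j) * (e m ω - y ω j) * g (y ω) =
        e k ω * (e m ω * g (y ω)) - e k ω * (y ω j * g (y ω)) - e m ω * (y ω j * g (y ω)) +
          y ω j * (y ω j * g (y ω)) := fun ω => by ring
    have I12 : Integrable (fun ω => e k ω * (e m ω * g (y ω)) - e k ω * (y ω j * g (y ω))) μ :=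
      (I1 k m).sub (I2 k)
    have I122 : Integrable (fun ω => e k ω * (e m ω * g (y ω)) - e k ω * (y ω j * g (y ω)) -
      e m ω * (y ω j * g (y ω))) μ := I12.sub (I2 m)
    simp_rw [hexp]
    rw [integral_add I122 I3, integral_sub I12 (I2 m), integral_sub (I1 k m) (I2 k), E2, E2]
    split_ifs with hk
    · subst hk
      have e1 : ∀ ω, e k ω * (e k ω * g (y ω)) = e k ω * g (y ω) := fun ω => by
        simp only [e]; split_ifs <;> simp
      have e2 : ∀ ω, y ω j * (1 - y ω j) * g (y ω) = y ω j * g (y ω) - y ω j * (y ω j * g (y ω)) :=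
        fun ω => by ring
      simp_rw [e1, e2]
      rw [integral_sub I4 I3]
      have := h.integral_ite_mul hp hgm.stronglyMeasurable j k
      simp only [e]
      rw [this]
      ring
    · have := h.integral_ite_mul_ite_mul hp hgm.stronglyMeasurable j hk
      simp only [e]
      rw [this]
      ring
  have hsq : ∀ ω, (y ⁻¹' B).indicator
      (fun ω => (circleCount (fun k => x k ω) n j - n * y ω j) ^ 2) ω =
      ∑ k ∈ Finset.range n, ∑ m ∈ Finset.range n,
        (e k ω - y ω j) * (e m ω - y ω j) * g (y ω) := by
    intro ω
    have : ((circleCount (fun k => x k ω) n j : ℝ) - n * y ω j) =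
        ∑ k ∈ Finset.range n, (e k ω - y ω j) := by
      rw [circleCount_cast]
      simp [e]
    simp_rw [← Finset.sum_mul, ← Finset.mul_sum, ← Finset.sum_mul]
    rw [← this]
    by_cases hB : y ω ∈ B
    · simp [g, hB, sq]
    · simp [g, hB]
  have hRHS : ∫ ω in y ⁻¹' B, y ω j * (1 - y ω j) ∂μ =
      ∫ ω, y ω j * (1 - y ω j) * g (y ω) ∂μ := by
    rw [← integral_indicator (h.measurable_y hB)]
    refine integral_congr_ae (Eventually.of_forall fun ω => ?_)
    by_cases hB : y ω ∈ B <;> simp [g, hB]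
  rw [hRHS, ← integral_indicator (h.measurable_y hB)]
  simp_rw [hsq]
  have I5 : ∀ k m, Integrable (fun ω => (e k ω - y ω j) * (e m ω - y ω j) * g (y ω)) μ := by
    intro k m
    refine hi _ ((((he k).sub hyj).mul ((he m).sub hyj)).mul hyg) ?_
    filter_upwards [h.ae_y hp] with ω hω
    have := hω.1 j
    have a1 : |e k ω - y ω j| ≤ 1 := abs_le.2 ⟨by linarith [(he1 k ω).1, this.2], by
      linarith [(he1 k ω).2, this.1]⟩
    have a2 : |e m ω - y ω j| ≤ 1 := abs_le.2 ⟨by linarith [(he1 m ω).1, this.2], by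
      linarith [(he1 m ω).2, this.1]⟩
    rw [abs_mul, abs_mul]
    exact mul_le_one₀ (mul_le_one₀ a1 (abs_nonneg _) a2) (abs_nonneg _) (habs _ (hg1 _))
  rw [integral_finsetSum _ fun k _ => integrable_finsetSum _ fun m _ => I5 k m]
  simp_rw [integral_finsetSum _ fun m _ => I5 _ m, hkm]
  rw [Finset.sum_congr rfl (g := fun _ => ∫ ω, y ω j * (1 - y ω j) * g (y ω) ∂μ)]
  · simp
  · intro k hk
    rw [Finset.sum_ite_eq, if_pos hk]

end

/-! ### Law of large numbers for the proportions, with geometric domination -/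

/-- The sequences `l` with `l j ≤ C r ^ (j + 1)`. -/
def decaySet (C r : ℝ) : Set (ℕ → ℝ) := {l | ∀ j, l j ≤ C * r ^ (j + 1)}

theorem measurableSet_decaySet (C r : ℝ) : MeasurableSet (decaySet C r) := by
  have : decaySet C r = ⋂ j, {l | l j ≤ C * r ^ (j + 1)} := by ext; simp [decaySet]
  rw [this]
  exact MeasurableSet.iInter fun j => measurableSet_le (measurable_pi_apply j) measurable_const

theorem circleCount_mono (x : ℕ → ℕ × ℝ) (j : ℕ) : Monotone fun n => circleCount x n j := by
  intro n m hnm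
  exact Finset.card_le_card (Finset.filter_subset_filter _ (by simpa using hnm))

theorem circleCount_le (x : ℕ → ℕ × ℝ) (n j : ℕ) : circleCount x n j ≤ n :=
  (Finset.card_filter_le _ _).trans (Finset.card_range n).le

theorem circleCount_div_mem_Icc (x : ℕ → ℕ × ℝ) (n j : ℕ) :
    (circleCount x n j : ℝ) / n ∈ Set.Icc (0 : ℝ) 1 :=
  ⟨by positivity, div_le_one_of_le₀ (by exact_mod_cast circleCount_le x n j) (by positivity)⟩

/-- Counts are monotone in `n` and consecutive squares have ratio tending to 1, so convergence along
squares suffices. -/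
theorem tendsto_circleCount_div {x : ℕ → ℕ × ℝ} {j : ℕ} {a : ℝ}
    (h : Tendsto (fun m : ℕ => (circleCount x ((m + 1) ^ 2) j : ℝ) / ((m : ℝ) + 1) ^ 2)
      atTop (𝓝 a)) :
    Tendsto (fun n : ℕ => (circleCount x n j : ℝ) / n) atTop (𝓝 a) := by
  refine tendsto_div_of_monotone_of_exists_subseq_tendsto_div
    (fun n => (circleCount x n j : ℝ)) a (fun n m hnm => Nat.cast_le.2 (circleCount_mono x j hnm))
    fun b hb => ⟨fun m => (m + 1) ^ 2, ?_, ?_, ?_⟩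
  · have h1 : Tendsto (fun m : ℕ => (1 + 1 / ((m : ℝ) + 1)) ^ 2) atTop (𝓝 ((1 + 0) ^ 2)) :=
      (tendsto_const_nhds.add tendsto_one_div_add_atTop_nhds_zero_nat).pow 2
    have h2 := h1.eventually_lt_const (u := b) (by simpa using hb)
    filter_upwards [h2] with m hm
    have hm0 : (0 : ℝ) < m + 1 := by positivity
    push_cast
    calc ((m : ℝ) + 1 + 1) ^ 2 = (1 + 1 / ((m : ℝ) + 1)) ^ 2 * (m + 1) ^ 2 := by
          field_simp
      _ ≤ b * (m + 1) ^ 2 := by gcongr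
  · exact (tendsto_pow_atTop two_ne_zero).comp (tendsto_add_atTop_nat 1)
  · simpa using h

/-- The square (⌊√n⌋ + 1)² lies between `n` and `4 * n`, whence the factor 4. -/
theorem circleCount_div_le_of_forall_sq {x : ℕ → ℕ × ℝ} {j : ℕ} {a : ℝ}
    (h : ∀ m : ℕ, (circleCount x ((m + 1) ^ 2) j : ℝ) / ((m : ℝ) + 1) ^ 2 ≤ a) (n : ℕ) :
    (circleCount x n j : ℝ) / n ≤ 4 * a := by
  have ha : 0 ≤ a := le_trans (by positivity) (h 0)
  rcases Nat.eq_zero_or_pos n with rfl | hn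
  · simp [ha]
  · have h1 : n ≤ (n.sqrt + 1) ^ 2 := by
      have := Nat.lt_succ_sqrt n
      rw [Nat.succ_eq_add_one] at this
      nlinarith
    have h2 : (n.sqrt + 1) ^ 2 ≤ 4 * n := by
      have := Nat.sqrt_le n
      have := Nat.sqrt_pos.2 hn
      nlinarith
    have h3 := h n.sqrt
    rw [div_le_iff₀ (by positivity)] at h3 ⊢
    have h4 : (circleCount x n j : ℝ) ≤ circleCount x ((n.sqrt + 1) ^ 2) j :=
      Nat.cast_le.2 (circleCount_mono x j h1)
    have h5 : ((n.sqrt : ℝ) + 1) ^ 2 ≤ 4 * n := by exact_mod_cast h2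
    nlinarith

section

variable {Ω : Type*} [MeasurableSpace Ω] {μ : Measure Ω} [IsProbabilityMeasure μ]
  {p : Measure (ℕ → ℝ)} {y : Ω → ℕ → ℝ} {x : ℕ → Ω → ℕ × ℝ}
  (h : CircleCoupling μ p y x) (hp : ∀ᵐ l ∂p, l ∈ nablaPrime)
include h hp

theorem CircleCoupling.integrable_sq_circleCount_sub (n j : ℕ) :
    Integrable (fun ω => (circleCount (fun k => x k ω) n j - n * y ω j : ℝ) ^ 2) μ := by
  have hm : Measurable fun ω => (circleCount (fun k => x k ω) n j : ℝ) :=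
    measurable_from_top.comp (h.measurable_circleCount n j)
  refine Integrable.of_bound (C := (n : ℝ) ^ 2)
    (((hm.sub ((h.measurable_y_apply j).const_mul _)).pow_const 2)).aestronglyMeasurable ?_
  filter_upwards [h.ae_y hp] with ω hω
  have h1 : (circleCount (fun k => x k ω) n j : ℝ) ≤ n := by exact_mod_cast circleCount_le _ n j
  have h2 : (0 : ℝ) ≤ circleCount (fun k => x k ω) n j := by positivity
  have h3 := hω.1 j
  have h4 : (0 : ℝ) ≤ n := by positivity
  rw [Real.norm_eq_abs, abs_of_nonneg (sq_nonneg _)]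
  exact sq_le_sq' (by nlinarith [h3.2]) (by nlinarith [h3.1])

theorem CircleCoupling.setIntegral_sq_circleCount_sub_le {C r : ℝ} (n j : ℕ) :
    ∫ ω in y ⁻¹' decaySet C r, (circleCount (fun k => x k ω) n j - n * y ω j) ^ 2 ∂μ ≤
      n * (|C| * |r| ^ (j + 1)) := by
  rw [h.setIntegral_sq_circleCount_sub hp (measurableSet_decaySet C r)]
  refine mul_le_mul_of_nonneg_left ?_ (by positivity)
  have hm := h.measurable_y (measurableSet_decaySet C r)
  have : ∫ ω in y ⁻¹' decaySet C r, y ω j * (1 - y ω j) ∂μ ≤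
      ∫ ω in y ⁻¹' decaySet C r, |C| * |r| ^ (j + 1) ∂μ := by
    have hmy := h.measurable_y_apply j
    refine integral_mono_ae ?_ (integrable_const _) ?_
    · refine (Integrable.of_bound (C := 1)
        (hmy.mul (measurable_const.sub hmy)).aestronglyMeasurable ?_).integrableOn
      filter_upwards [h.ae_y hp] with ω hω
      have h3 := hω.1 j
      change ‖y ω j * (1 - y ω j)‖ ≤ 1
      rw [Real.norm_eq_abs, abs_of_nonneg (mul_nonneg h3.1 (by linarith [h3.2]))]
      nlinarith [h3.1, h3.2]
    · filter_upwards [ae_restrict_mem hm, ae_restrict_of_ae (h.ae_y hp)] with ω h1 hω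
      have h3 := hω.1 j
      have h4 : y ω j ≤ C * r ^ (j + 1) := h1 j
      calc y ω j * (1 - y ω j) ≤ y ω j := by nlinarith [h3.1, h3.2]
        _ ≤ |C * r ^ (j + 1)| := h4.trans (le_abs_self _)
        _ = _ := by rw [abs_mul, abs_pow]
  refine this.trans ?_
  rw [setIntegral_const, smul_eq_mul]
  exact mul_le_of_le_one_left (by positivity) measureReal_le_one

/-- At n = (m+1)² the variance of the proportion on the circle j, over the decay set, is at most |C|
ρ^{4(j+1)}/(m+1)². Dividing by ρ^{2(j+1)} keeps the expectations summable in both indices, and a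
series of nonnegative terms with finite expectation is almost surely finite. -/
theorem CircleCoupling.ae_summable_sq {C ρ : ℝ} (hρ : ρ ∈ Set.Ioo (0 : ℝ) 1) :
    ∀ᵐ ω ∂μ, y ω ∈ decaySet C (ρ ^ 4) → Summable fun q : ℕ × ℕ =>
      ((circleCount (fun k => x k ω) ((q.2 + 1) ^ 2) q.1 : ℝ) / ((q.2 : ℝ) + 1) ^ 2 - y ω q.1) ^ 2
        / (ρ ^ 2) ^ (q.1 + 1) := by
  obtain ⟨hρ0, hρ1⟩ := hρ
  set B := decaySet C (ρ ^ 4)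
  have hm := h.measurable_y (measurableSet_decaySet C (ρ ^ 4))
  let F : ℕ × ℕ → Ω → ℝ := fun q ω =>
    ((circleCount (fun k => x k ω) ((q.2 + 1) ^ 2) q.1 : ℝ) / ((q.2 : ℝ) + 1) ^ 2 - y ω q.1) ^ 2
        / (ρ ^ 2) ^ (q.1 + 1)
  have hF : ∀ q ω, F q ω = (((q.2 : ℝ) + 1) ^ 4 * (ρ ^ 2) ^ (q.1 + 1))⁻¹ *
      (circleCount (fun k => x k ω) ((q.2 + 1) ^ 2) q.1 - ((q.2 + 1) ^ 2 : ℕ) * y ω q.1) ^ 2 := by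
    intro q ω
    simp only [F]
    push_cast
    field_simp
  have hF0 : ∀ q ω, 0 ≤ F q ω := fun q ω => by positivity
  have hFi : ∀ q, Integrable (F q) μ := fun q => by
    rw [funext (hF q)]
    exact (h.integrable_sq_circleCount_sub hp _ _).const_mul _
  have hbound : ∀ q : ℕ × ℕ, ∫ ω in y ⁻¹' B, F q ω ∂μ ≤
      |C| * ((ρ ^ 2) ^ (q.1 + 1) * (1 / ((q.2 : ℝ) + 1) ^ 2)) := by
    intro q
    simp_rw [hF]
    rw [integral_const_mul]
    have := h.setIntegral_sq_circleCount_sub_le hp (C := C) (r := ρ ^ 4) ((q.2 + 1) ^ 2) q.1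
    refine (mul_le_mul_of_nonneg_left this (by positivity)).trans (le_of_eq ?_)
    rw [abs_of_pos (by positivity : 0 < ρ ^ 4)]
    push_cast
    have : (ρ ^ 4) ^ (q.1 + 1) = (ρ ^ 2) ^ (q.1 + 1) * (ρ ^ 2) ^ (q.1 + 1) := by
      rw [← mul_pow]; ring
    rw [this]
    field_simp
  have hsum : Summable fun q : ℕ × ℕ =>
      |C| * ((ρ ^ 2) ^ (q.1 + 1) * (1 / ((q.2 : ℝ) + 1) ^ 2)) := by
    refine Summable.mul_left _ (Summable.mul_of_nonneg (f := fun j : ℕ => (ρ ^ 2) ^ (j + 1))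
      (g := fun m : ℕ => 1 / ((m : ℝ) + 1) ^ 2) ?_ ?_ (fun j => by positivity)
      (fun m => by positivity))
    · exact (summable_nat_add_iff 1).2
        (summable_geometric_of_lt_one (by positivity) (pow_lt_one₀ hρ0.le hρ1 two_ne_zero))
    · have := (summable_nat_add_iff 1).2 (Real.summable_one_div_nat_pow.2 one_lt_two)
      simpa using this
  have hlint : ∫⁻ ω in y ⁻¹' B, ∑' q, ENNReal.ofReal (F q ω) ∂μ ≠ ⊤ := by
    rw [lintegral_tsum fun q => (hFi q).aemeasurable.ennreal_ofReal.restrict]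
    have h1 : ∀ q, ∫⁻ ω in y ⁻¹' B, ENNReal.ofReal (F q ω) ∂μ ≤
        ENNReal.ofReal (|C| * ((ρ ^ 2) ^ (q.1 + 1) * (1 / ((q.2 : ℝ) + 1) ^ 2))) := by
      intro q
      rw [← ofReal_integral_eq_lintegral_ofReal (hFi q).integrableOn
        (Eventually.of_forall fun ω => hF0 q ω)]
      exact ENNReal.ofReal_le_ofReal (hbound q)
    refine ne_top_of_le_ne_top ?_ (ENNReal.tsum_le_tsum h1)
    rw [← ENNReal.ofReal_tsum_of_nonneg (fun q => by positivity) hsum]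
    exact ENNReal.ofReal_ne_top
  have hae := ae_lt_top' (AEMeasurable.tsum fun q =>
    (hFi q).aemeasurable.ennreal_ofReal.restrict) hlint
  rw [ae_restrict_iff' hm] at hae
  filter_upwards [hae] with ω hω hB
  have h2 := (hω hB).ne
  have h3 := ENNReal.summable_toReal h2
  refine h3.congr fun q => ?_
  rw [ENNReal.toReal_ofReal (hF0 q ω)]

/-- The law of large numbers for the circles, with exponential domination. -/
theorem CircleCoupling.ae_tendsto_and_le {ρ : ℝ} (hρ : ρ ∈ Set.Ioo (0 : ℝ) 1)
    (hdec : ∀ᵐ l ∂p, ∃ C > 0, ∀ j : ℕ, l j ≤ C * (ρ ^ 4) ^ (j + 1)) :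
    ∀ᵐ ω ∂μ, (∀ j, Tendsto (fun n : ℕ => (circleCount (fun k => x k ω) n j : ℝ) / n) atTop
        (𝓝 (y ω j))) ∧
      ∃ K : ℝ, 0 < K ∧ (∀ j, y ω j ≤ K * ρ ^ (j + 1)) ∧
        ∀ j n : ℕ, (circleCount (fun k => x k ω) n j : ℝ) / n ≤ K * ρ ^ (j + 1) := by
  -- Integer constants keep the exceptional events countable; the random decay constant is rounded
  -- up below.
  have h1 : ∀ᵐ ω ∂μ, ∀ C : ℕ, y ω ∈ decaySet C (ρ ^ 4) → Summable fun q : ℕ × ℕ =>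
      ((circleCount (fun k => x k ω) ((q.2 + 1) ^ 2) q.1 : ℝ) / ((q.2 : ℝ) + 1) ^ 2 - y ω q.1) ^ 2
        / (ρ ^ 2) ^ (q.1 + 1) := ae_all_iff.2 fun C => h.ae_summable_sq hp hρ
  obtain ⟨hρ0, hρ1⟩ := hρ
  filter_upwards [h1, h.ae_y hdec, h.ae_y hp] with ω hs ⟨C, hC, hyC⟩ hω
  obtain ⟨C', hC'⟩ := exists_nat_ge C
  have hyC' : ∀ j, y ω j ≤ C' * (ρ ^ 4) ^ (j + 1) := fun j =>
    (hyC j).trans (by gcongr)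
  have hsum := hs C' hyC'
  set S := ∑' q : ℕ × ℕ,
    ((circleCount (fun k => x k ω) ((q.2 + 1) ^ 2) q.1 : ℝ) / ((q.2 : ℝ) + 1) ^ 2 - y ω q.1) ^ 2
        / (ρ ^ 2) ^ (q.1 + 1)
  -- Each term is at most the sum `S`, so along squares the proportion deviates from y_j by at most
  -- √S ρ^{j+1}, whatever `m`.
  have hle : ∀ j m : ℕ, (circleCount (fun k => x k ω) ((m + 1) ^ 2) j : ℝ) / ((m : ℝ) + 1) ^ 2
      ≤ (C' + √S) * ρ ^ (j + 1) := by
    intro j m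
    have h2 := hsum.le_tsum (j, m) fun q _ => by positivity
    simp only at h2
    rw [div_le_iff₀ (by positivity)] at h2
    have h3 := Real.abs_le_sqrt h2
    rw [Real.sqrt_mul' _ (by positivity), ← pow_mul, mul_comm 2, pow_mul,
      Real.sqrt_sq (by positivity)] at h3
    have h4 := (abs_le.1 h3).2
    have h5 : (ρ ^ 4) ^ (j + 1) ≤ ρ ^ (j + 1) := by
      refine pow_le_pow_left₀ (by positivity) ?_ _
      exact pow_le_of_le_one hρ0.le hρ1.le (by norm_num)
    have h6 : (C' : ℝ) * (ρ ^ 4) ^ (j + 1) ≤ C' * ρ ^ (j + 1) := by gcongr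
    linarith [hyC' j]
  have hyle : ∀ j, y ω j ≤ C' * ρ ^ (j + 1) := fun j => (hyC' j).trans (by
    gcongr
    exact pow_le_of_le_one hρ0.le hρ1.le (by norm_num))
  have hS : 0 ≤ √S := Real.sqrt_nonneg _
  have hC0 : (0 : ℝ) < C' := hC.trans_le hC'
  refine ⟨fun j => tendsto_circleCount_div ?_, 4 * (C' + √S), by positivity, fun j => ?_,
    fun j n => ?_⟩
  · have h2 : Summable fun m : ℕ =>
        ((circleCount (fun k => x k ω) ((m + 1) ^ 2) j : ℝ) / ((m : ℝ) + 1) ^ 2 - y ω j) ^ 2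
          / (ρ ^ 2) ^ (j + 1) :=
      hsum.comp_injective (i := fun m : ℕ => (j, m)) fun m m' e => (Prod.ext_iff.1 e).2
    have h3 := (h2.tendsto_atTop_zero.mul_const ((ρ ^ 2) ^ (j + 1)))
    have h4 : (ρ ^ 2) ^ (j + 1) ≠ 0 := by positivity
    simp only [div_mul_cancel₀ _ h4, zero_mul] at h3
    have h5 := (Real.continuous_sqrt.tendsto 0).comp h3
    simp only [Function.comp_def, Real.sqrt_sq_eq_abs, Real.sqrt_zero] at h5
    exact tendsto_sub_nhds_zero_iff.1 (tendsto_zero_iff_abs_tendsto_zero _ |>.2 h5)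
  · refine (hyle j).trans ?_
    gcongr
    linarith
  · rw [mul_assoc]
    exact circleCount_div_le_of_forall_sq (hle j) n

end

/-! ### Fourier coefficients and the probability of being close to 1 -/

theorem norm_one_sub_pow_le {v : ℂ} (hv : ‖v‖ = 1) (k : ℕ) : ‖1 - v ^ k‖ ≤ k * ‖1 - v‖ := by
  rw [← mul_neg_geom_sum, norm_mul, mul_comm]
  gcongr
  refine (norm_sum_le _ _).trans (le_of_eq ?_)
  simp [hv]

/-- Each `v ^ k` is within k/K of 1, so the sum of the K first powers is within K/2 of K. -/
theorem half_le_norm_sum_pow {v : ℂ} (hv : ‖v‖ = 1) {K : ℕ} (h : ‖1 - v‖ ≤ 1 / K) :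
    (K : ℝ) / 2 ≤ ‖∑ k ∈ Finset.range K, v ^ k‖ := by
  rcases Nat.eq_zero_or_pos K with rfl | hK
  · simp
  have hK' : (0 : ℝ) < K := by exact_mod_cast hK
  have h1 : ‖(K : ℂ) - ∑ k ∈ Finset.range K, v ^ k‖ ≤ K / 2 := by
    have : (K : ℂ) - ∑ k ∈ Finset.range K, v ^ k = ∑ k ∈ Finset.range K, (1 - v ^ k) := by simp
    rw [this]
    refine (norm_sum_le _ _).trans ?_
    calc ∑ k ∈ Finset.range K, ‖1 - v ^ k‖ ≤ ∑ k ∈ Finset.range K, (k : ℝ) * (1 / K) :=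
          Finset.sum_le_sum fun k _ => (norm_one_sub_pow_le hv k).trans (by gcongr)
      _ = ((∑ k ∈ Finset.range K, k : ℕ) : ℝ) * (1 / K) := by
          rw [← Finset.sum_mul]; push_cast; rfl
      _ ≤ K / 2 := by
          have h2 := Finset.sum_range_id_mul_two K
          have h3 : ((∑ k ∈ Finset.range K, k : ℕ) : ℝ) * 2 ≤ K * K := by
            rw [← Nat.cast_ofNat, ← Nat.cast_mul, h2]
            exact_mod_cast Nat.mul_le_mul_left K (Nat.sub_le K 1)
          rw [mul_one_div, div_le_div_iff₀ hK' two_pos]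
          exact h3
  have h2 := norm_sub_norm_le (K : ℂ) (∑ k ∈ Finset.range K, v ^ k)
  rw [Complex.norm_natCast] at h2
  linarith

/-- A random variable on the unit circle with small first Fourier coefficients is rarely close
to `1`. -/
theorem measureReal_norm_one_sub_le {Ω : Type*} [MeasurableSpace Ω] {ν : Measure Ω}
    [IsFiniteMeasure ν] (hν : ν.real Set.univ ≤ 1) {v : Ω → ℂ} (hvm : Measurable v)
    (hv : ∀ᵐ ω ∂ν, ‖v ω‖ = 1) {K : ℕ} (hK : 0 < K) {δ : ℝ} (hδ : 0 ≤ δ)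
    (h : ∀ k : ℕ, 0 < k → k < K → ‖∫ ω, v ω ^ k ∂ν‖ ≤ δ) :
    ν.real {ω | ‖1 - v ω‖ ≤ 1 / K} ≤ 4 / K + 4 * δ := by
  have hK' : (0 : ℝ) < K := by exact_mod_cast hK
  set S : Ω → ℂ := fun ω => ∑ k ∈ Finset.range K, v ω ^ k
  have hSm : Measurable S := Finset.measurable_fun_sum _ fun k _ => hvm.pow_const k
  have hint : ∀ a b : ℕ, Integrable (fun ω => v ω ^ a * (starRingEnd ℂ) (v ω ^ b)) ν := by
    intro a b
    refine Integrable.of_bound (C := 1) (Measurable.aestronglyMeasurable ?_) ?_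
    · exact (hvm.pow_const a).mul (Complex.continuous_conj.measurable.comp (hvm.pow_const b))
    · filter_upwards [hv] with ω hω
      simp [hω]
  have hab : ∀ a b : ℕ, a < K → b < K →
      ‖∫ ω, v ω ^ a * (starRingEnd ℂ) (v ω ^ b) ∂ν‖ ≤ if a = b then 1 else δ := by
    have hlt : ∀ a b : ℕ, a < b → b < K →
        ‖∫ ω, v ω ^ b * (starRingEnd ℂ) (v ω ^ a) ∂ν‖ ≤ δ := by
      intro a b hab hb
      rw [integral_congr_ae (g := fun ω => v ω ^ (b - a))]
      · exact h _ (by omega) (by omega)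
      · filter_upwards [hv] with ω hω
        have h1 : v ω ^ a * (starRingEnd ℂ) (v ω ^ a) = 1 := by
          rw [Complex.mul_conj, Complex.normSq_eq_norm_sq]
          simp [hω]
        have h2 : v ω ^ b = v ω ^ (b - a) * v ω ^ a := by
          rw [← pow_add]; congr 1; omega
        rw [h2, mul_assoc, h1, mul_one]
    intro a b ha hb
    split_ifs with hab
    · subst hab
      rw [integral_congr_ae (g := fun _ => 1)]
      · simpa [abs_of_nonneg measureReal_nonneg] using hν
      · filter_upwards [hv] with ω hω
        rw [Complex.mul_conj, Complex.normSq_eq_norm_sq]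
        simp [hω]
    · rcases lt_or_gt_of_ne hab with hlt' | hlt'
      · have := hlt a b hlt' hb
        rw [← RCLike.norm_conj, ← integral_conj] at this
        simpa [mul_comm] using this
      · exact hlt b a hlt' ha
  -- In the second moment, each of the K diagonal pairs contributes at most 1, and any other pair a
  -- Fourier coefficient of order |a - b| < K, at most δ. Markov's inequality at level K²/4 then
  -- gives 4/K + 4δ.
  have hsq : ∫ ω, ‖S ω‖ ^ 2 ∂ν ≤ K + K ^ 2 * δ := by
    have h1 : ((∫ ω, ‖S ω‖ ^ 2 ∂ν : ℝ) : ℂ) = ∑ a ∈ Finset.range K, ∑ b ∈ Finset.range K,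
        ∫ ω, v ω ^ a * (starRingEnd ℂ) (v ω ^ b) ∂ν := by
      rw [← integral_complex_ofReal]
      have h2 : ∀ ω, ((‖S ω‖ ^ 2 : ℝ) : ℂ) = ∑ a ∈ Finset.range K, ∑ b ∈ Finset.range K,
          v ω ^ a * (starRingEnd ℂ) (v ω ^ b) := by
        intro ω
        rw [← Complex.normSq_eq_norm_sq, ← Complex.mul_conj, map_sum, Finset.sum_mul_sum]
      simp_rw [h2]
      rw [integral_finsetSum _ fun a _ => integrable_finsetSum _ fun b _ => hint a b]
      exact Finset.sum_congr rfl fun a _ => integral_finsetSum _ fun b _ => hint a b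
    have h3 : ∫ ω, ‖S ω‖ ^ 2 ∂ν ≤ ‖((∫ ω, ‖S ω‖ ^ 2 ∂ν : ℝ) : ℂ)‖ := by
      rw [Complex.norm_real]; exact le_abs_self _
    refine h3.trans ?_
    rw [h1]
    calc _ ≤ ∑ a ∈ Finset.range K, ∑ b ∈ Finset.range K, ((if a = b then 1 else 0) + δ) := by
          refine (norm_sum_le _ _).trans (Finset.sum_le_sum fun a ha =>
            (norm_sum_le _ _).trans (Finset.sum_le_sum fun b hb =>
              (hab a b (Finset.mem_range.1 ha) (Finset.mem_range.1 hb)).trans ?_))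
          split_ifs <;> linarith
      _ = K + K ^ 2 * δ := by
          have : ∀ a ∈ Finset.range K, ∑ b ∈ Finset.range K, ((if a = b then (1 : ℝ) else 0) + δ) =
              1 + K * δ := by
            intro a ha
            rw [Finset.sum_add_distrib, Finset.sum_ite_eq, if_pos ha]
            simp
          rw [Finset.sum_congr rfl this]
          simp
          ring
  have hSi : Integrable (fun ω => ‖S ω‖ ^ 2) ν := by
    refine Integrable.of_bound (C := (K : ℝ) ^ 2) (hSm.norm.pow_const 2).aestronglyMeasurable ?_
    filter_upwards [hv] with ω hω
    rw [Real.norm_eq_abs, abs_of_nonneg (sq_nonneg _)]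
    gcongr
    refine (norm_sum_le _ _).trans (le_of_eq ?_)
    simp [hω]
  have hmarkov := mul_meas_ge_le_integral_of_nonneg (μ := ν) (f := fun ω => ‖S ω‖ ^ 2)
    (Eventually.of_forall fun ω => sq_nonneg _) hSi ((K : ℝ) ^ 2 / 4)
  have hsub : ν.real {ω | ‖1 - v ω‖ ≤ 1 / K} ≤ ν.real {ω | (K : ℝ) ^ 2 / 4 ≤ ‖S ω‖ ^ 2} := by
    refine ENNReal.toReal_mono (measure_ne_top _ _) (measure_mono_ae ?_)
    filter_upwards [hv] with ω hω hle
    have := half_le_norm_sum_pow hω hle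
    change (K : ℝ) ^ 2 / 4 ≤ ‖S ω‖ ^ 2
    calc (K : ℝ) ^ 2 / 4 = (K / 2) ^ 2 := by ring
      _ ≤ ‖S ω‖ ^ 2 := by gcongr
  refine hsub.trans ?_
  have h4 : ν.real {ω | (K : ℝ) ^ 2 / 4 ≤ ‖S ω‖ ^ 2} ≤ (K + K ^ 2 * δ) / (K ^ 2 / 4) := by
    rw [le_div_iff₀ (by positivity), mul_comm]
    exact hmarkov.trans hsq
  refine h4.trans (le_of_eq ?_)
  field_simp

theorem ae_norm_eq_one_uniformUnitCircle : ∀ᵐ z ∂uniformUnitCircle, ‖z‖ = 1 := by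
  rw [uniformUnitCircle, ae_map_iff (by fun_prop) (measurableSet_eq_fun (by fun_prop) (by fun_prop))]
  refine Eventually.of_forall fun t => ?_
  rw [show (2 * Real.pi * Complex.I * t : ℂ) = ((2 * Real.pi * t : ℝ) : ℂ) * Complex.I by
    push_cast; ring]
  exact Complex.norm_exp_ofReal_mul_I _

theorem integral_zpow_uniformUnitCircle {k : ℤ} (hk : k ≠ 0) :
    ∫ z, z ^ k ∂uniformUnitCircle = 0 := by
  have hm : Measurable fun z : ℂ => z ^ k := by fun_prop
  rw [uniformUnitCircle, integral_map (by fun_prop) hm.aestronglyMeasurable,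
    integral_Ico_eq_integral_Ioc, ← intervalIntegral.integral_of_le zero_le_one]
  have h1 : ∀ t : ℝ, Complex.exp (2 * Real.pi * Complex.I * t) ^ k =
      Complex.exp ((k * (2 * Real.pi * Complex.I)) * t) := fun t => by
    rw [← Complex.exp_int_mul]; ring_nf
  simp_rw [h1]
  rw [integral_exp_mul_complex]
  · have : Complex.exp (k * (2 * Real.pi * Complex.I) * (1 : ℝ)) = 1 := by
      rw [Complex.ofReal_one, mul_one, Complex.exp_int_mul_two_pi_mul_I]
    rw [this]
    simp
  · simp [hk, Real.pi_ne_zero]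

theorem exists_pos_forall_le_of_eventually {f : ℕ → ℝ} (h0 : ∀ j, 0 < f j) {a : ℝ} (ha : 0 < a)
    (h1 : ∀ᶠ j in atTop, a ≤ f j) : ∃ c > 0, ∀ j, c ≤ f j := by
  obtain ⟨J, hJ⟩ := eventually_atTop.1 h1
  obtain ⟨i, hi, hmin⟩ := Finset.exists_min_image (Finset.range (J + 1)) f ⟨0, by simp⟩
  refine ⟨min a (f i), lt_min ha (h0 i), fun j => ?_⟩
  rcases lt_or_ge j J with hj | hj
  · exact (min_le_right _ _).trans (hmin j (by simp; omega))
  · exact (min_le_left _ _).trans (hJ j hj)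

section

variable {Ω : Type*} [MeasurableSpace Ω] {μ : Measure Ω} [IsProbabilityMeasure μ]
  {y : Ω → ℕ → ℝ} {x : ℕ → Ω → ℕ × ℝ} {u : ℕ → Ω → ℂ} (hu : UniformMarks μ y x u)
include hu

omit [IsProbabilityMeasure μ] in
theorem UniformMarks.ae_norm (j : ℕ) : ∀ᵐ ω ∂μ, ‖u j ω‖ = 1 :=
  ae_of_ae_map (hu.measurable_u j).aemeasurable
    ((hu.law_u j).symm ▸ ae_norm_eq_one_uniformUnitCircle)

omit [IsProbabilityMeasure μ] in
theorem UniformMarks.integral_zpow (j : ℕ) {k : ℤ} (hk : k ≠ 0) : ∫ ω, u j ω ^ k ∂μ = 0 := by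
  have hm : Measurable fun z : ℂ => z ^ k := by fun_prop
  rw [← integral_zpow_uniformUnitCircle hk, ← hu.law_u j,
    integral_map (hu.measurable_u j).aemeasurable hm.aestronglyMeasurable]

theorem UniformMarks.measureReal_le (j : ℕ) {K : ℕ} (hK : 0 < K) :
    μ.real {ω | ‖1 - u j ω‖ ≤ 1 / K} ≤ 4 / K := by
  have := measureReal_norm_one_sub_le (ν := μ) (by simp) (hu.measurable_u j) (hu.ae_norm j) hK le_rfl
    fun k hk _ => by
      have := hu.integral_zpow j (k := k) (by exact_mod_cast hk.ne')
      simp only [zpow_natCast] at this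
      rw [this, norm_zero]
  simpa using this

theorem UniformMarks.ae_ne_one (j : ℕ) : ∀ᵐ ω ∂μ, u j ω ≠ 1 := by
  have h1 : ∀ K : ℕ, μ.real {ω | u j ω = 1} ≤ 4 * (1 / ((K : ℝ) + 1)) := by
    intro K
    have := hu.measureReal_le j (Nat.succ_pos K)
    rw [mul_one_div]
    push_cast at this
    refine le_trans (measureReal_mono fun ω hω => ?_) this
    have : u j ω = 1 := hω
    simp only [Set.mem_ofPred_eq, this, sub_self, norm_zero]
    positivity
  have h2 : μ.real {ω | u j ω = 1} ≤ 4 * 0 :=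
    ge_of_tendsto' (tendsto_one_div_add_atTop_nhds_zero_nat.const_mul 4) h1
  rw [mul_zero] at h2
  have h3 := le_antisymm h2 measureReal_nonneg
  rw [measureReal_eq_zero_iff] at h3
  simpa [ae_iff] using h3

/-- Almost surely, the marks are at polynomial distance from `1`. -/
theorem UniformMarks.ae_exists_le : ∀ᵐ ω ∂μ, ∃ c > 0, ∀ j : ℕ,
    ‖u j ω‖ = 1 ∧ c / ((j : ℝ) + 1) ^ 2 ≤ ‖1 - u j ω‖ := by
  -- With K = (j+1)² the probabilities are at most 4/(j+1)², which is summable: Borel–Cantelli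
  -- applies.
  have hsum : ∑' j : ℕ, μ {ω | ‖1 - u j ω‖ ≤ 1 / ((j + 1) ^ 2 : ℕ)} ≠ ⊤ := by
    have h1 : ∀ j : ℕ, μ {ω | ‖1 - u j ω‖ ≤ 1 / ((j + 1) ^ 2 : ℕ)} ≤
        ENNReal.ofReal (4 / ((j : ℝ) + 1) ^ 2) := by
      intro j
      have := hu.measureReal_le j (K := (j + 1) ^ 2) (by positivity)
      rw [← ofReal_measureReal]
      refine ENNReal.ofReal_le_ofReal (this.trans (le_of_eq ?_))
      push_cast
      rfl
    refine ne_top_of_le_ne_top ?_ (ENNReal.tsum_le_tsum h1)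
    rw [← ENNReal.ofReal_tsum_of_nonneg (fun j => by positivity)]
    · exact ENNReal.ofReal_ne_top
    · have := ((summable_nat_add_iff 1).2 (Real.summable_one_div_nat_pow.2 one_lt_two)).mul_left 4
      simpa [div_eq_mul_inv] using this
  have h2 := ae_eventually_notMem hsum
  filter_upwards [h2, ae_all_iff.2 hu.ae_ne_one, ae_all_iff.2 hu.ae_norm] with ω h3 h4 h5
  obtain ⟨c, hc, h6⟩ := exists_pos_forall_le_of_eventually
    (f := fun j : ℕ => ‖1 - u j ω‖ * ((j : ℝ) + 1) ^ 2) (fun j => by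
      have := norm_pos_iff.2 (sub_ne_zero.2 (h4 j).symm)
      positivity) one_pos (by
    filter_upwards [h3] with j hj
    simp only [not_le] at hj
    push_cast at hj
    rw [div_lt_iff₀ (by positivity)] at hj
    exact hj.le)
  exact ⟨c, hc, fun j => ⟨h5 j, (div_le_iff₀ (by positivity)).2 (h6 j)⟩⟩

end

/-! ### Diophantine approximation -/

/-- The chord is 2|sin πs| with |s| ≤ 1/2 the distance to the nearest integer, and |sin| lies above
its chord on [0, π/2]. -/
theorem four_mul_distInt_le (t : ℝ) :
    4 * distInt t ≤ ‖1 - Complex.exp (-(2 * Complex.I * Real.pi * t))‖ := by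
  set s := t - round t with hs
  have hs2 : |s| ≤ 1 / 2 := abs_sub_round t
  have h1 : Complex.exp (-(2 * Complex.I * Real.pi * t)) =
      Complex.exp (Complex.I * ((-(2 * Real.pi * s) : ℝ) : ℂ)) := by
    rw [Complex.exp_eq_exp_iff_exists_int]
    refine ⟨-round t, ?_⟩
    rw [hs]
    push_cast
    ring
  rw [h1, norm_sub_rev, Complex.norm_exp_I_mul_ofReal_sub_one]
  have h2 : -(2 * Real.pi * s) / 2 = -(Real.pi * s) := by ring
  rw [h2, Real.sin_neg, mul_neg, norm_neg, norm_mul, Real.norm_eq_abs, Real.norm_eq_abs]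
  have hpi := Real.pi_pos
  have h3 := Real.mul_abs_le_abs_sin (x := Real.pi * s) (by
    rw [abs_mul, abs_of_pos hpi]; nlinarith)
  rw [abs_mul, abs_of_pos hpi] at h3
  have h4 : 2 / Real.pi * (Real.pi * |s|) = 2 * |s| := by field_simp
  rw [h4] at h3
  rw [distInt, abs_two]
  linarith

/-- An irrational number of finite type is badly approximable up to a power. -/
theorem IsFiniteType.exists_le {α : ℝ} (hα : Irrational α) (h : IsFiniteType α) :
    ∃ (g : ℕ) (c : ℝ), 0 < c ∧ ∀ k : ℕ, 0 < k →
      c ≤ (k : ℝ) ^ g * ‖1 - Complex.exp (-(2 * Complex.I * Real.pi * (k * α : ℝ)))‖ := by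
  obtain ⟨g, hg⟩ : ∃ g : ℕ, diophantineType α < ((g : ℝ) : EReal) := by
    obtain ⟨r, hr, -⟩ := EReal.lt_iff_exists_real_btwn.1 h
    obtain ⟨g, hg⟩ := exists_nat_ge r
    exact ⟨g, hr.trans_le (by exact_mod_cast hg)⟩
  -- An exponent `g` above the type is not in the defining set, so n^g‖nα‖ is eventually bounded
  -- below. The remaining finitely many terms are positive by irrationality.
  have hlim : liminf (fun n : ℕ => ENNReal.ofReal ((n : ℝ) ^ (g : ℝ) * distInt (n * α))) atTop ≠ 0 := by
    intro h0
    have : ((g : ℝ) : EReal) ≤ diophantineType α := le_sSup ⟨g, h0, rfl⟩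
    exact absurd hg (not_lt.2 this)
  obtain ⟨a, ha0, ha⟩ := exists_between (pos_iff_ne_zero.2 hlim)
  have hev := eventually_lt_of_lt_liminf ha
  have hatop : a ≠ ⊤ := (ha.trans_le le_top).ne
  have hpos : ∀ k : ℕ, 0 < ((k + 1 : ℕ) : ℝ) ^ g * distInt ((k + 1 : ℕ) * α) := by
    intro k
    refine mul_pos (by positivity) (abs_pos.2 (sub_ne_zero.2 ?_))
    exact (hα.natCast_mul (Nat.succ_ne_zero k)).ne_int _
  obtain ⟨c, hc, hle⟩ := exists_pos_forall_le_of_eventually hpos (ENNReal.toReal_pos ha0.ne' hatop)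
    (by
      have := (tendsto_add_atTop_nat 1).eventually hev
      filter_upwards [this] with k hk
      rw [Real.rpow_natCast] at hk
      exact ((ENNReal.lt_ofReal_iff_toReal_lt hatop).1 hk).le)
  refine ⟨g, c, hc, fun k hk => ?_⟩
  obtain ⟨k, rfl⟩ := Nat.exists_eq_succ_of_ne_zero hk.ne'
  refine (hle k).trans ?_
  refine mul_le_mul_of_nonneg_left ?_ (by positivity)
  have h5 := four_mul_distInt_le ((k + 1 : ℕ) * α)
  have h6 : 0 ≤ distInt ((k + 1 : ℕ) * α) := abs_nonneg _
  exact le_trans (by linarith) h5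

/-! ### Almost sure convergence for the modified matrices -/

/-- The law of large numbers loses part of the rate: of the variance bound ρ^{4(j+1)}, half is spent
on summing over j, and the square root of the other half leaves ρ^{j+1}. -/
theorem ExponentialDecay.exists_pow_four {p : Measure (ℕ → ℝ)} (h : ExponentialDecay p) :
    ∃ ρ ∈ Set.Ioo (0 : ℝ) 1, ∀ᵐ l ∂p, ∃ C > 0, ∀ j : ℕ, l j ≤ C * (ρ ^ 4) ^ (j + 1) := by
  obtain ⟨r, ⟨hr0, hr1⟩, hr⟩ := h
  refine ⟨√√r, ⟨by positivity, ?_⟩, ?_⟩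
  · rw [Real.sqrt_lt' one_pos, one_pow, Real.sqrt_lt' one_pos, one_pow]
    exact hr1
  · have : √√r ^ 4 = r := by
      rw [show (4 : ℕ) = 2 * 2 from rfl, pow_mul, Real.sq_sqrt (Real.sqrt_nonneg r),
        Real.sq_sqrt hr0.le]
    rwa [this]

theorem summable_succ_pow_mul_geometric {ρ : ℝ} (hρ : ρ ∈ Set.Ioo (0 : ℝ) 1) (e : ℕ) :
    Summable fun j : ℕ => ((j : ℝ) + 1) ^ e * ρ ^ (j + 1) := by
  have := (summable_nat_add_iff 1).2 (summable_pow_mul_geometric_of_norm_lt_one e (r := ρ)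
    (by rw [Real.norm_eq_abs, abs_of_pos hρ.1]; exact hρ.2))
  simpa using this

section

variable {Ω : Type*} [MeasurableSpace Ω] {μ : Measure Ω} [IsProbabilityMeasure μ]
  {p : Measure (ℕ → ℝ)} {y : Ω → ℕ → ℝ} {x : ℕ → Ω → ℕ × ℝ} {u : ℕ → Ω → ℂ}
  (h : CircleCoupling μ p y x) (hp : ∀ᵐ l ∂p, l ∈ nablaPrime) (hdecay : ExponentialDecay p)
  (hu : UniformMarks μ y x u)
include h hp hdecay hu

/-- Almost surely, the perimeters and marks, together with their empirical versions, stay in one of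
the sets on which the limiting product depends continuously on its parameters. -/
theorem ae_exists_markBox : ∀ᵐ ω ∂μ,
    (∀ j, Tendsto (fun n : ℕ => (circleCount (fun k => x k ω) n j : ℝ) / n) atTop (𝓝 (y ω j))) ∧
    ∃ b d : ℕ → ℝ, (∀ j, 0 < d j) ∧ (Summable fun j => b j / d j) ∧
      (y ω, fun j => u j ω) ∈ markBox b d ∧
      ∀ n : ℕ, ((fun j => (circleCount (fun k => x k ω) n j : ℝ) / n), fun j => u j ω) ∈
        markBox b d := by
  obtain ⟨ρ, hρ, hdec⟩ := hdecay.exists_pow_four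
  filter_upwards [h.ae_tendsto_and_le hp hρ hdec, hu.ae_exists_le, h.ae_y hp] with ω
    ⟨hlim, K, hK, hyK, hNK⟩ ⟨c, hc, hcu⟩ hω
  refine ⟨hlim, fun j => K * ρ ^ (j + 1), fun j => c / ((j : ℝ) + 1) ^ 2, fun j => by positivity,
    ?_, fun j => ⟨⟨hω.1 j, hyK j⟩, hcu j⟩,
    fun n j => ⟨⟨circleCount_div_mem_Icc _ n j, hNK j n⟩, hcu j⟩⟩
  refine ((summable_succ_pow_mul_geometric hρ 2).mul_left (K / c)).congr fun j => ?_
  field_simp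

theorem ae_multipliable_and_differentiable : ∀ᵐ ω ∂μ,
    (∀ z : ℂ, Multipliable fun j => xiFactor (y ω) (fun j => u j ω) j z) ∧
      Differentiable ℂ (xiInfty (y ω) fun j => u j ω) := by
  filter_upwards [ae_exists_markBox h hp hdecay hu] with ω ⟨_, b, d, hd, hbd, hq, _⟩
  have h1 := multipliable_xiFactor (q := (y ω, fun j => u j ω)) hd hbd hq
  have h2 := differentiable_xiInfty (q := (y ω, fun j => u j ω)) hd hbd hq
  exact ⟨fun z => h1 z, h2⟩

/-- For a fixed trajectory the marks are constant and the proportions converge coordinatewise inside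
one `markBox`, so the continuity of the product in its parameters gives the claim. -/
theorem ModifiedCoupling.ae_tendstoUniformlyOn {Mt : (n : ℕ) → Ω → Matrix (Fin n) (Fin n) ℂ}
    (hM : ModifiedCoupling μ y x u Mt) : ∀ᵐ ω ∂μ, ∀ K : Set ℂ, IsCompact K →
      TendstoUniformlyOn (fun (n : ℕ) (z : ℂ) => xiTilde (Mt n ω) z)
        (xiInfty (y ω) fun j => u j ω) atTop K := by
  filter_upwards [ae_exists_markBox h hp hdecay hu, h.ae_goodPoints, hM.corresponds,
    hM.cycle_products] with ω ⟨hlim, b, d, hd, hbd, hq, hqn⟩ hgood hcor hcyc K hK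
  have h1 : Tendsto (fun n : ℕ => ((fun j => (circleCount (fun k => x k ω) n j : ℝ) / n),
      fun j => u j ω)) atTop (𝓝[markBox b d] (y ω, fun j => u j ω)) :=
    tendsto_nhdsWithin_iff.2 ⟨(tendsto_pi_nhds.2 hlim).prodMk_nhds tendsto_const_nhds,
      Eventually.of_forall hqn⟩
  have h2 := (continuousOn_xiInftyMap hd hbd _ hq).tendsto.comp h1
  rw [ContinuousMap.tendsto_iff_forall_isCompact_tendstoUniformlyOn] at h2
  have h3 := h2 K hK
  rw [coe_xiInftyMap hd hbd hq] at h3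
  refine h3.congr ?_
  filter_upwards [eventually_ge_atTop 1] with n hn z _
  simp only [Function.comp_def]
  rw [coe_xiInftyMap hd hbd (hqn n),
    xiTilde_eq_xiInfty hgood (hcor n hn).2 (ne_one_of_mem_markBox hd hq) (hcyc n)]

end

/-! ### Tightness of the empirical marks -/

theorem prod_ite_eq_prod_pow_circleCount (x : ℕ → ℕ × ℝ) (w : ℕ → ℂ) (J n : ℕ) :
    ∏ k ∈ Finset.range n, (if (x k).1 < J then w (x k).1 else 1) =
      ∏ j ∈ Finset.range J, w j ^ circleCount x n j := by
  have h1 : ∀ j, w j ^ circleCount x n j =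
      ∏ k ∈ Finset.range n, if (x k).1 = j then w j else 1 := by
    intro j
    rw [Finset.prod_ite, Finset.prod_const, Finset.prod_const_one, mul_one, circleCount]
  simp_rw [h1]
  rw [Finset.prod_comm]
  refine Finset.prod_congr rfl fun k _ => ?_
  rw [Finset.prod_ite_eq]
  simp

/-- Strict convexity of the disc in quantitative form: the loss a b |1 - w|² drives the decay of the
characteristic functions. -/
theorem normSq_convex_combination {w : ℂ} (hw : ‖w‖ = 1) (a b : ℝ) :
    ‖(b : ℂ) + a * w‖ ^ 2 = (a + b) ^ 2 - a * b * ‖1 - w‖ ^ 2 := by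
  have h1 : w.re ^ 2 + w.im ^ 2 = 1 := by
    have := Complex.normSq_eq_norm_sq w
    rw [hw, Complex.normSq_apply] at this
    nlinarith
  rw [← Complex.normSq_eq_norm_sq, ← Complex.normSq_eq_norm_sq, Complex.normSq_apply,
    Complex.normSq_apply]
  simp
  linear_combination (a ^ 2 + a * b) * h1

/-- The squared modulus is 1 - s ≤ e^{-s}, so the n-th power is at most e^{-ns/2}; then t e^{-t} ≤ 1
with t = ns/2. -/
theorem norm_pow_mul_le {w : ℂ} (hw : ‖w‖ = 1) {a : ℝ} (ha : a ∈ Set.Icc (0 : ℝ) 1) (n : ℕ) :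
    ‖1 + a * (w - 1)‖ ^ n * (n * (a * (1 - a) * ‖1 - w‖ ^ 2)) ≤ 2 := by
  set s := a * (1 - a) * ‖1 - w‖ ^ 2 with hs
  have hs0 : 0 ≤ s := mul_nonneg (mul_nonneg ha.1 (by linarith [ha.2])) (sq_nonneg _)
  have h1 : ‖1 + a * (w - 1)‖ ^ 2 = 1 - s := by
    have := normSq_convex_combination hw a (1 - a)
    rw [show (1 : ℂ) + a * (w - 1) = ((1 - a : ℝ) : ℂ) + a * w by push_cast; ring, this, hs]
    ring
  have h2 : ‖1 + a * (w - 1)‖ ≤ Real.exp (-s / 2) := by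
    refine le_of_sq_le_sq (h1.trans_le ?_) (Real.exp_pos _).le
    rw [← Real.exp_nat_mul]
    have := Real.add_one_le_exp (-s)
    have e : ((2 : ℕ) : ℝ) * (-s / 2) = -s := by push_cast; ring
    rw [e]
    linarith
  have h3 : ‖1 + a * (w - 1)‖ ^ n ≤ Real.exp (-(n * s / 2)) := by
    refine (pow_le_pow_left₀ (norm_nonneg _) h2 n).trans (le_of_eq ?_)
    rw [← Real.exp_nat_mul]
    congr 1; ring
  have h4 : (n : ℝ) * s / 2 ≤ Real.exp (n * s / 2) := by
    linarith [Real.add_one_le_exp (n * s / 2)]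
  calc ‖1 + a * (w - 1)‖ ^ n * (n * s) ≤ Real.exp (-(n * s / 2)) * (2 * Real.exp (n * s / 2)) := by
        refine mul_le_mul h3 (by linarith) (by positivity) (Real.exp_pos _).le
    _ = 2 := by rw [mul_left_comm, ← Real.exp_add]; simp

theorem norm_exp_neg_two_pi (t : ℝ) : ‖Complex.exp (-(2 * Complex.I * Real.pi * t))‖ = 1 := by
  rw [show (-(2 * Complex.I * Real.pi * t) : ℂ) = ((-(2 * Real.pi * t) : ℝ) : ℂ) * Complex.I by
    push_cast; ring]
  exact Complex.norm_exp_ofReal_mul_I _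

theorem norm_angleMark (α : ℝ) (N : ℕ) : ‖angleMark α N‖ = 1 := by
  rw [angleMark]
  split_ifs
  · simp
  · have := norm_exp_neg_two_pi (α * N)
    push_cast at this
    rwa [← mul_assoc] at this

theorem angleMark_of_ne_zero (α : ℝ) {N : ℕ} (hN : N ≠ 0) :
    angleMark α N = Complex.exp (-(2 * Complex.I * Real.pi * (N * α : ℝ))) := by
  rw [angleMark, if_neg hN]
  push_cast
  ring_nf

theorem norm_one_sub_angleMark_zero (α : ℝ) : ‖1 - angleMark α 0‖ = 2 := by
  rw [angleMark, if_pos rfl]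
  norm_num

section

variable {Ω : Type*} [MeasurableSpace Ω] {μ : Measure Ω} [IsProbabilityMeasure μ]
  {p : Measure (ℕ → ℝ)} {y : Ω → ℕ → ℝ} {x : ℕ → Ω → ℕ × ℝ}
  (h : CircleCoupling μ p y x) (hp : ∀ᵐ l ∂p, l ∈ nablaPrime)
include h hp

theorem CircleCoupling.setIntegral_exp_circleCount {B : Set (ℕ → ℝ)} (hB : MeasurableSet B) (w : ℂ)
    (n j : ℕ) :
    ∫ ω in y ⁻¹' B, w ^ circleCount (fun k => x k ω) n j ∂μ =
      ∫ ω in y ⁻¹' B, (1 + y ω j * (w - 1)) ^ n ∂μ := by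
  have hg : StronglyMeasurable (B.indicator fun _ => (1 : ℂ)) :=
    stronglyMeasurable_const.indicator hB
  have := h.integral_mul_prod hp hg (Integrable.of_bound
    (hg.comp_measurable h.measurable_y).aestronglyMeasurable 1 (Eventually.of_forall fun ω => by
      by_cases hω : y ω ∈ B <;> simp [hω])) (fun i => if i = j then w else 1) (j + 1) n
  rw [← integral_indicator (h.measurable_y hB), ← integral_indicator (h.measurable_y hB)]
  have e : ∀ (f : Ω → ℂ) ω,
      (y ⁻¹' B).indicator f ω = B.indicator (fun _ => (1 : ℂ)) (y ω) * f ω := fun f ω => by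
    by_cases hω : y ω ∈ B <;> simp [hω]
  simp_rw [e]
  have e1 : ∀ ω, ∏ i ∈ Finset.range (j + 1),
      (if i = j then w else 1) ^ circleCount (fun k => x k ω) n i =
      w ^ circleCount (fun k => x k ω) n j := by
    intro ω
    rw [Finset.prod_range_succ, Finset.prod_eq_one, one_mul, if_pos rfl]
    intro i hi
    rw [if_neg (Finset.mem_range.1 hi).ne, one_pow]
  have e2 : ∀ ω, ∑ i ∈ Finset.range (j + 1), (y ω i : ℂ) * ((if i = j then w else 1) - 1) =
      y ω j * (w - 1) := by
    intro ω
    rw [Finset.sum_range_succ, Finset.sum_eq_zero, zero_add, if_pos rfl]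
    intro i hi
    rw [if_neg (Finset.mem_range.1 hi).ne, sub_self, mul_zero]
  simp_rw [fun ω => prod_ite_eq_prod_pow_circleCount (fun k => x k ω)
    (fun i => if i = j then w else 1) (j + 1) n, e1, e2] at this
  exact this

theorem CircleCoupling.measureReal_mul_le {B : Set (ℕ → ℝ)} (hB : MeasurableSet B) {n j : ℕ}
    {a : ℝ} (ha : ∀ l ∈ B, l j ≤ a) (ha0 : 0 ≤ a) (t : ℝ) :
    t * μ.real (y ⁻¹' B ∩ {ω | t ≤ circleCount (fun k => x k ω) n j}) ≤ n * a := by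
  have hm := h.measurable_y hB
  have hNm : Measurable fun ω => (circleCount (fun k => x k ω) n j : ℝ) :=
    measurable_from_top.comp (h.measurable_circleCount n j)
  have hi : Integrable (fun ω => (circleCount (fun k => x k ω) n j : ℝ)) μ := by
    refine Integrable.of_bound (C := n) hNm.aestronglyMeasurable (Eventually.of_forall fun ω => ?_)
    rw [Real.norm_natCast]
    exact_mod_cast circleCount_le _ n j
  have h1 := mul_meas_ge_le_integral_of_nonneg (μ := μ.restrict (y ⁻¹' B))
    (Eventually.of_forall fun ω => Nat.cast_nonneg (circleCount (fun k => x k ω) n j))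
    hi.integrableOn t
  rw [h.setIntegral_circleCount hp hB, measureReal_restrict_apply' hm, Set.inter_comm] at h1
  refine h1.trans (mul_le_mul_of_nonneg_left ?_ (by positivity))
  have hyi : Integrable (fun ω => y ω j) μ := by
    refine Integrable.of_bound (C := 1) (h.measurable_y_apply j).aestronglyMeasurable ?_
    filter_upwards [h.ae_y hp] with ω hω
    rw [Real.norm_eq_abs, abs_of_nonneg (hω.1 j).1]
    exact (hω.1 j).2
  have h2 : ∫ ω in y ⁻¹' B, y ω j ∂μ ≤ ∫ ω in y ⁻¹' B, a ∂μ :=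
    setIntegral_mono_on hyi.integrableOn (integrable_const _) hm fun ω hω => ha _ hω
  refine h2.trans ?_
  rw [setIntegral_const, smul_eq_mul]
  exact mul_le_of_le_one_left ha0 measureReal_le_one

/-- For a large circle, the mark corresponding to the angle `α` is rarely close to `1`. -/
theorem CircleCoupling.measureReal_angleMark_le_of_large {α c C : ℝ} {g : ℕ} (hc : 0 < c)
    (hα : ∀ k : ℕ, 0 < k →
      c ≤ (k : ℝ) ^ g * ‖1 - Complex.exp (-(2 * Complex.I * Real.pi * (k * α : ℝ)))‖)
    {B : Set (ℕ → ℝ)} (hB : MeasurableSet B) (hC : 0 < C) {n j K : ℕ} (hK : 0 < K)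
    (hBC : ∀ l ∈ B, 1 / C ≤ 1 - l j) (hBK : ∀ l ∈ B, (K : ℝ) ^ (2 * g + 1) ≤ n * l j) :
    μ.real (y ⁻¹' B ∩ {ω | ‖1 - angleMark α (circleCount (fun k => x k ω) n j)‖ ≤ 1 / K}) ≤
      (4 + 8 * C / c ^ 2) / K := by
  have hm := h.measurable_y hB
  have hK' : (0 : ℝ) < K := by exact_mod_cast hK
  have hK1 : (1 : ℝ) ≤ K := by exact_mod_cast hK
  let e : ℕ → ℂ := fun k => Complex.exp (-(2 * Complex.I * Real.pi * (k * α : ℝ)))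
  have he1 : ∀ k, ‖e k‖ = 1 := fun k => norm_exp_neg_two_pi _
  have hpow : ∀ N k : ℕ, e N ^ k = e k ^ N := by
    intro N k
    simp only [e]
    rw [← Complex.exp_nat_mul, ← Complex.exp_nat_mul]
    push_cast
    ring_nf
  -- The k-th Fourier coefficient is a binomial generating function at e^{-2iπkα}. For k < K, finite
  -- type gives |1 - e^{-2iπkα}|² ≥ c²/K^{2g}. Against n y_j ≥ K^{2g+1} one factor K remains, and
  -- `norm_pow_mul_le` bounds the coefficient by 2C/(c²K).
  have hδ : ∀ k : ℕ, 0 < k → k < K →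
      ‖∫ ω in y ⁻¹' B, e (circleCount (fun k => x k ω) n j) ^ k ∂μ‖ ≤ 2 * C / (c ^ 2 * K) := by
    intro k hk hkK
    simp_rw [hpow _ k]
    rw [h.setIntegral_exp_circleCount hp hB]
    have hle : ∀ᵐ ω ∂(μ.restrict (y ⁻¹' B)), ‖(1 + y ω j * (e k - 1)) ^ n‖ ≤
        2 * C / (c ^ 2 * K) := by
      filter_upwards [ae_restrict_mem hm, ae_restrict_of_ae (h.ae_y hp)] with ω hωB hω
      have h1 := norm_pow_mul_le (he1 k) (hω.1 j) n
      have h2 := hα k hk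
      have h3 : (k : ℝ) ^ g ≤ K ^ g := by gcongr
      have h4 : c ≤ (K : ℝ) ^ g * ‖1 - e k‖ := h2.trans (by gcongr)
      have h5 : c ^ 2 ≤ (K : ℝ) ^ (2 * g) * ‖1 - e k‖ ^ 2 := by
        calc c ^ 2 ≤ ((K : ℝ) ^ g * ‖1 - e k‖) ^ 2 := by gcongr
          _ = _ := by ring
      have h6 : c ^ 2 * K / C ≤ n * (y ω j * (1 - y ω j) * ‖1 - e k‖ ^ 2) := by
        calc c ^ 2 * K / C = c ^ 2 * K * (1 / C) := by ring
          _ ≤ ((K : ℝ) ^ (2 * g) * ‖1 - e k‖ ^ 2) * K * (1 - y ω j) :=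
              mul_le_mul (by gcongr) (hBC _ hωB) (by positivity) (by positivity)
          _ = (K : ℝ) ^ (2 * g + 1) * ((1 - y ω j) * ‖1 - e k‖ ^ 2) := by ring
          _ ≤ n * y ω j * ((1 - y ω j) * ‖1 - e k‖ ^ 2) := by
              refine mul_le_mul_of_nonneg_right (hBK _ hωB) ?_
              exact mul_nonneg (by linarith [(hω.1 j).2]) (sq_nonneg _)
          _ = _ := by ring
      rw [norm_pow, show 2 * C / (c ^ 2 * K) = 2 / (c ^ 2 * K / C) by field_simp,
        le_div_iff₀ (by positivity)]
      exact (mul_le_mul_of_nonneg_left h6 (by positivity)).trans h1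
    have := norm_integral_le_of_norm_le_const hle
    refine this.trans (mul_le_of_le_one_right (by positivity) ?_)
    rw [measureReal_restrict_apply_univ]
    exact measureReal_le_one
  have hfej := measureReal_norm_one_sub_le (ν := μ.restrict (y ⁻¹' B))
    (by rw [measureReal_restrict_apply_univ]; exact measureReal_le_one)
    (v := fun ω => e (circleCount (fun k => x k ω) n j))
    ((measurable_from_top (f := e)).comp (h.measurable_circleCount n j))
    (Eventually.of_forall fun ω => he1 _) hK (by positivity) hδ
  rw [measureReal_restrict_apply' hm, Set.inter_comm] at hfej
  have hsub : y ⁻¹' B ∩ {ω | ‖1 - angleMark α (circleCount (fun k => x k ω) n j)‖ ≤ 1 / K} ⊆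
      y ⁻¹' B ∩ {ω | ‖1 - e (circleCount (fun k => x k ω) n j)‖ ≤ 1 / K} := by
    rintro ω ⟨hω, hle⟩
    refine ⟨hω, ?_⟩
    simp only [Set.mem_ofPred_eq] at hle ⊢
    -- An empty circle has its mark at distance 2 from 1, so it is not in the event.
    by_cases hN : circleCount (fun k => x k ω) n j = 0
    · rw [hN, norm_one_sub_angleMark_zero] at hle
      have : 1 / (K : ℝ) ≤ 1 := by rw [div_le_one hK']; exact hK1
      linarith
    · rwa [angleMark_of_ne_zero α hN] at hle
  refine (measureReal_mono hsub).trans (hfej.trans (le_of_eq ?_))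
  field_simp
  ring

/-- Uniformly in `n`, the mark of a circle corresponding to the angle `α` is rarely close to `1`. -/
theorem CircleCoupling.measureReal_angleMark_lt {α c C : ℝ} {g : ℕ} (hc : 0 < c)
    (hα : ∀ k : ℕ, 0 < k →
      c ≤ (k : ℝ) ^ g * ‖1 - Complex.exp (-(2 * Complex.I * Real.pi * (k * α : ℝ)))‖)
    {B : Set (ℕ → ℝ)} (hB : MeasurableSet B) (hC : 0 < C) {n j K : ℕ} (hK : 0 < K)
    (hBC : ∀ l ∈ B, 1 / C ≤ 1 - l j) :
    μ.real (y ⁻¹' B ∩ {ω | ‖1 - angleMark α (circleCount (fun k => x k ω) n j)‖ <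
      min 1 c / (K : ℝ) ^ ((2 * g + 2) * g + 1)}) ≤ (5 + 8 * C / c ^ 2) / K := by
  have hK' : (0 : ℝ) < K := by exact_mod_cast hK
  have hK1 : (1 : ℝ) ≤ K := by exact_mod_cast hK
  -- If n y_j ≥ T, the Fourier estimate applies. If n y_j < T, Markov's inequality gives N < K T =
  -- K^{2g+2} outside probability 1/K, and finite type then bounds the distance below by
  -- c/K^{(2g+2)g}. The additional power of K in the denominator ensures δ ≤ 1/K.
  set T : ℝ := (K : ℝ) ^ (2 * g + 1) with hT
  have hT0 : 0 < T := by positivity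
  have hBT : MeasurableSet {l : ℕ → ℝ | T ≤ n * l j} :=
    measurableSet_le measurable_const ((measurable_pi_apply j).const_mul _)
  set δ := min 1 c / (K : ℝ) ^ ((2 * g + 2) * g + 1) with hδ
  have hδ1 : δ ≤ 1 / K := by
    refine div_le_div₀ zero_le_one (min_le_left _ _) hK' ?_
    exact le_self_pow₀ hK1 (by positivity)
  have h1 := h.measureReal_angleMark_le_of_large hp hc hα (hB.inter hBT) hC (n := n) (j := j) hK
    (fun l hl => hBC l hl.1) (fun l hl => hl.2)
  have h2 : μ.real (y ⁻¹' (B ∩ {l : ℕ → ℝ | T ≤ n * l j}ᶜ) ∩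
      {ω | K * T ≤ circleCount (fun k => x k ω) n j}) ≤ 1 / K := by
    rcases Nat.eq_zero_or_pos n with rfl | hn
    · have : (y ⁻¹' (B ∩ {l : ℕ → ℝ | T ≤ (0 : ℕ) * l j}ᶜ) ∩
        {ω | K * T ≤ circleCount (fun k => x k ω) 0 j}) = ∅ := by
        refine Set.eq_empty_of_forall_notMem fun ω hω => ?_
        have h3 : K * T ≤ circleCount (fun k => x k ω) 0 j := hω.2
        have h4 : circleCount (fun k => x k ω) 0 j = 0 := by simp [circleCount]
        rw [h4, Nat.cast_zero] at h3
        exact absurd h3 (not_le.2 (by positivity))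
      rw [this, measureReal_empty]
      positivity
    · have hn' : (0 : ℝ) < n := by exact_mod_cast hn
      have := h.measureReal_mul_le hp (hB.inter hBT.compl) (n := n) (j := j) (a := T / n)
        (fun l hl => by
          have : ¬ T ≤ n * l j := hl.2
          rw [le_div_iff₀ hn', mul_comm]
          exact (not_le.1 this).le) (by positivity) (K * T)
      rw [mul_div_cancel₀ _ hn'.ne'] at this
      rw [le_div_iff₀ hK']
      nlinarith
  have hsub : y ⁻¹' B ∩ {ω | ‖1 - angleMark α (circleCount (fun k => x k ω) n j)‖ < δ} ⊆
      (y ⁻¹' (B ∩ {l : ℕ → ℝ | T ≤ n * l j}) ∩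
        {ω | ‖1 - angleMark α (circleCount (fun k => x k ω) n j)‖ ≤ 1 / K}) ∪
      (y ⁻¹' (B ∩ {l : ℕ → ℝ | T ≤ n * l j}ᶜ) ∩
        {ω | K * T ≤ circleCount (fun k => x k ω) n j}) := by
    rintro ω ⟨hω, hlt⟩
    simp only [Set.mem_ofPred_eq] at hlt
    by_cases hyT : T ≤ n * y ω j
    · exact Or.inl ⟨⟨hω, hyT⟩, hlt.le.trans hδ1⟩
    · refine Or.inr ⟨⟨hω, hyT⟩, ?_⟩
      simp only [Set.mem_ofPred_eq]
      by_contra! hcon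
      rcases Nat.eq_zero_or_pos (circleCount (fun k => x k ω) n j) with hN | hN
      · rw [hN, norm_one_sub_angleMark_zero] at hlt
        have : 1 / (K : ℝ) ≤ 1 := by rw [div_le_one hK']; exact hK1
        linarith
      · set N := circleCount (fun k => x k ω) n j
        have h3 := hα N hN
        rw [← angleMark_of_ne_zero α hN.ne'] at h3
        have h4 : (N : ℝ) ^ g ≤ (K * T) ^ g := by gcongr
        have h5 : (K * T) ^ g ≤ (K : ℝ) ^ ((2 * g + 2) * g + 1) := by
          rw [hT, ← pow_succ', ← pow_mul]
          exact pow_le_pow_right₀ hK1 (Nat.le_succ ((2 * g + 2) * g))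
        have h6 : c ≤ (K : ℝ) ^ ((2 * g + 2) * g + 1) * ‖1 - angleMark α N‖ :=
          h3.trans (by gcongr; exact h4.trans h5)
        have h7 : δ ≤ ‖1 - angleMark α N‖ := by
          rw [hδ, div_le_iff₀ (by positivity), mul_comm]
          exact (min_le_right _ _).trans h6
        linarith
  calc _ ≤ _ := measureReal_mono hsub
    _ ≤ _ := measureReal_union_le _ _
    _ ≤ (4 + 8 * C / c ^ 2) / K + 1 / K := add_le_add h1 h2
    _ = _ := by ring

end

/-- The proportions of points on the circles, with the marks corresponding to the angle `α`. -/
noncomputable def empiricalMarks (α : ℝ) (x : ℕ → ℕ × ℝ) (n : ℕ) : (ℕ → ℝ) × (ℕ → ℂ) :=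
  (fun j => circleCount x n j / n, fun j => angleMark α (circleCount x n j))

/-- Sequences with exponential decay that stay away from `1`. -/
def gapDecaySet (C r : ℝ) : Set (ℕ → ℝ) := decaySet C r ∩ {l | ∀ j, 1 / C ≤ 1 - l j}

theorem measurableSet_gapDecaySet (C r : ℝ) : MeasurableSet (gapDecaySet C r) := by
  refine (measurableSet_decaySet C r).inter ?_
  have : {l : ℕ → ℝ | ∀ j, 1 / C ≤ 1 - l j} = ⋂ j, {l | 1 / C ≤ 1 - l j} := by ext; simp
  rw [this]
  exact MeasurableSet.iInter fun j =>
    measurableSet_le measurable_const (measurable_const.sub (measurable_pi_apply j))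

theorem gapDecaySet_mono {C C' r : ℝ} (hC : 0 < C) (hr : 0 ≤ r) (h : C ≤ C') :
    gapDecaySet C r ⊆ gapDecaySet C' r := by
  rintro l ⟨h1, h2⟩
  exact ⟨fun j => (h1 j).trans (by gcongr), fun j => (one_div_le_one_div_of_le hC h).trans (h2 j)⟩

/-- A positive second perimeter forces `l 0 < 1`, and by monotonicity the gap `1 - l 0` serves every
index. -/
theorem exists_mem_gapDecaySet {l : ℕ → ℝ} {r : ℝ} (hl : l ∈ nablaPrime) (hr : 0 ≤ r)
    (hdec : ∃ C > 0, ∀ j : ℕ, l j ≤ C * r ^ (j + 1)) (h1 : 0 < l 1) :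
    ∃ N : ℕ, l ∈ gapDecaySet (N + 1) r := by
  obtain ⟨C, hC, hle⟩ := hdec
  have h01 : l 0 + l 1 ≤ 1 := by
    have := hl.2.2.summable.sum_le_tsum (Finset.range 2) fun j _ => (hl.1 j).1
    rw [hl.2.2.tsum_eq] at this
    simpa [Finset.sum_range_succ] using this
  have hpos : 0 < 1 - l 0 := by linarith
  obtain ⟨N, hN⟩ := exists_nat_ge (max C (1 / (1 - l 0)))
  have hN1 : C ≤ N + 1 := by linarith [le_max_left C (1 / (1 - l 0))]
  have hN2 : 1 / (1 - l 0) ≤ N + 1 := by linarith [le_max_right C (1 / (1 - l 0))]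
  refine ⟨N, fun j => (hle j).trans (by gcongr), fun j => ?_⟩
  have h2 : 1 / ((N : ℝ) + 1) ≤ 1 - l 0 := by
    rw [one_div_le (by positivity) hpos]
    exact hN2
  linarith [hl.2.1 (Nat.zero_le j)]

section

variable {Ω : Type*} [MeasurableSpace Ω] {μ : Measure Ω} [IsProbabilityMeasure μ]

theorem exists_measureReal_compl_le {Ω : Type*} [MeasurableSpace Ω] {μ : Measure Ω}
    [IsProbabilityMeasure μ] {s : ℕ → Set Ω} (hs : Monotone s) (hm : ∀ n, MeasurableSet (s n))
    (hae : ∀ᵐ ω ∂μ, ∃ n, ω ∈ s n) {ε : ℝ} (hε : 0 < ε) : ∃ n, μ.real (s n)ᶜ ≤ ε := by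
  have h1 := tendsto_measure_iUnion_atTop (μ := μ) hs
  have h2 : μ (⋃ n, s n) = 1 := by
    refine (mem_ae_iff_prob_eq_one (MeasurableSet.iUnion hm)).1 ?_
    filter_upwards [hae] with ω hω using Set.mem_iUnion.2 hω
  rw [h2] at h1
  have h3 := (ENNReal.tendsto_toReal ENNReal.one_ne_top).comp h1
  obtain ⟨n, hn⟩ := (h3.eventually_const_lt (u := 1 - ε) (by simpa using hε)).exists
  refine ⟨n, ?_⟩
  rw [probReal_compl_eq_one_sub (hm n)]
  have : 1 - ε < μ.real (s n) := hn
  linarith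

theorem measureReal_iUnion_le_tsum {Ω : Type*} [MeasurableSpace Ω] {μ : Measure Ω}
    [IsFiniteMeasure μ] {s : ℕ → Set Ω} {a : ℕ → ℝ} (ha : Summable a) (h0 : ∀ j, 0 ≤ a j)
    (hs : ∀ j, μ.real (s j) ≤ a j) : μ.real (⋃ j, s j) ≤ ∑' j, a j := by
  have h1 : μ (⋃ j, s j) ≤ ENNReal.ofReal (∑' j, a j) := by
    refine (measure_iUnion_le s).trans ?_
    rw [ENNReal.ofReal_tsum_of_nonneg h0 ha]
    refine ENNReal.tsum_le_tsum fun j => ?_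
    rw [← ofReal_measureReal]
    exact ENNReal.ofReal_le_ofReal (hs j)
  exact ENNReal.toReal_le_of_le_ofReal (tsum_nonneg h0) h1

variable {p : Measure (ℕ → ℝ)} {y : Ω → ℕ → ℝ} {x : ℕ → Ω → ℕ × ℝ} {u : ℕ → Ω → ℂ}
  (h : CircleCoupling μ p y x) (hp : ∀ᵐ l ∂p, l ∈ nablaPrime) (hdecay : ExponentialDecay p)
  (hu : UniformMarks μ y x u) (hpos : ∀ᵐ l ∂p, ∀ j, 0 < l j)
include h hp hdecay hu hpos

/-- Tightness: uniformly in `n`, the empirical marks stay with high probability in a set on which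
the limiting product depends continuously on its parameters. -/
theorem exists_markBox_measureReal_le {α : ℝ} (hα : Irrational α) (hft : IsFiniteType α) {ε : ℝ}
    (hε : 0 < ε) : ∃ b d : ℕ → ℝ, (∀ j, 0 < d j) ∧ (Summable fun j => b j / d j) ∧
      μ.real {ω | (y ω, fun j => u j ω) ∉ markBox b d} ≤ ε ∧
      ∀ n : ℕ, μ.real {ω | empiricalMarks α (fun k => x k ω) n ∉ markBox b d} ≤ ε := by
  obtain ⟨g, c, hc, hgc⟩ := hft.exists_le hα
  obtain ⟨r, hr, hdec⟩ := hdecay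
  have hr0 : 0 < r := hr.1
  obtain ⟨M, hM⟩ := exists_measureReal_compl_le (μ := μ)
    (s := fun N : ℕ => y ⁻¹' gapDecaySet (N + 1) r)
    (fun N N' hN => Set.preimage_mono (gapDecaySet_mono (by positivity) hr0.le (by gcongr)))
    (fun N => h.measurable_y (measurableSet_gapDecaySet _ _)) (by
      filter_upwards [h.ae_y hp, h.ae_y hdec, h.ae_y hpos] with ω h1 h2 h3
      exact exists_mem_gapDecaySet h1 hr0.le h2 (h3 1)) (half_pos hε)
  set C : ℝ := M + 1 with hC
  have hC0 : 0 < C := by positivity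
  set B := gapDecaySet C r with hB
  have hBm : MeasurableSet B := measurableSet_gapDecaySet _ _
  -- The term 5 + 8C/c² comes from the mark being close to 1, and the additional 1 from the
  -- proportion being large.
  set A : ℝ := 6 + 8 * C / c ^ 2 with hA
  have hA0 : 6 ≤ A := le_add_of_nonneg_right (by positivity)
  have hs2 : Summable fun j : ℕ => 1 / ((j : ℝ) + 1) ^ 2 := by
    have := (summable_nat_add_iff 1).2 (Real.summable_one_div_nat_pow.2 one_lt_two)
    simpa using this
  set S := ∑' j : ℕ, 1 / ((j : ℝ) + 1) ^ 2 with hS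
  have hS0 : 0 ≤ S := tsum_nonneg fun j => by positivity
  obtain ⟨m, hm⟩ := exists_nat_ge (A * S / (ε / 2))
  have hmpos : (0 : ℝ) < (m : ℝ) + 1 := by positivity
  have hmε : A / (m + 1) * S ≤ ε / 2 := by
    rw [div_mul_eq_mul_div, div_le_iff₀ hmpos]
    rw [div_le_iff₀ (half_pos hε)] at hm
    nlinarith
  -- The factor `m + 1` brings the sum of the failure probabilities A/K_j below ε/2. Growth in `j`
  -- is polynomial, so b_j/d_j is a polynomial times a geometric sequence.
  let K : ℕ → ℕ := fun j => (m + 1) * (j + 1) ^ 2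
  have hK : ∀ j, 0 < K j := fun j => by positivity
  have hKr : ∀ j, (K j : ℝ) = (m + 1) * ((j : ℝ) + 1) ^ 2 := fun j => by
    simp only [K]; push_cast; ring
  have hK1 : ∀ j, (1 : ℝ) ≤ K j := fun j => by exact_mod_cast hK j
  set E := (2 * g + 2) * g + 1 with hE
  -- K_j times the bound on y_j, so that by Markov's inequality the proportion exceeds b_j with
  -- probability at most 1/K_j.
  let b : ℕ → ℝ := fun j => K j * (C * r ^ (j + 1))
  let d : ℕ → ℝ := fun j => min 1 c / (K j : ℝ) ^ E
  have hd0 : ∀ j, 0 < d j := fun j =>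
    div_pos (lt_min one_pos hc) (pow_pos (zero_lt_one.trans_le (hK1 j)) _)
  have hd1 : ∀ j, d j ≤ 1 / K j := fun j =>
    div_le_div₀ zero_le_one (min_le_left _ _) (zero_lt_one.trans_le (hK1 j))
      (le_self_pow₀ (hK1 j) (by positivity))
  have hsumA : Summable fun j : ℕ => A / (K j : ℝ) := by
    refine (hs2.mul_left (A / (m + 1))).congr fun j => ?_
    rw [hKr]; field_simp
  have htsumA : ∑' j : ℕ, A / (K j : ℝ) ≤ ε / 2 := by
    refine le_trans (le_of_eq ?_) hmε
    rw [hS, ← tsum_mul_left]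
    refine tsum_congr fun j => ?_
    rw [hKr]; field_simp
  have hAK : ∀ j, 0 ≤ A / (K j : ℝ) := fun j => div_nonneg (by linarith) (by linarith [hK1 j])
  have hcombine : ∀ {s : Set Ω} {t : ℕ → Set Ω}, (∀ j, μ.real (t j) ≤ A / K j) →
      (∀ᵐ ω ∂μ, ω ∈ s → ω ∉ (y ⁻¹' B)ᶜ → ∃ j, ω ∈ t j) → μ.real s ≤ ε := by
    intro s t ht hst
    have h1 : μ.real s ≤ μ.real ((y ⁻¹' B)ᶜ ∪ ⋃ j, t j) := by
      refine ENNReal.toReal_mono (measure_ne_top _ _) (measure_mono_ae ?_)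
      filter_upwards [hst] with ω hω hs
      by_cases hB : ω ∈ (y ⁻¹' B)ᶜ
      · exact Or.inl hB
      · exact Or.inr (Set.mem_iUnion.2 (hω hs hB))
    have h2 := measureReal_iUnion_le_tsum hsumA hAK ht
    have h3 := measureReal_union_le (μ := μ) (y ⁻¹' B)ᶜ (⋃ j, t j)
    linarith
  refine ⟨b, d, hd0, ?_, hcombine (t := fun j => {ω | ‖1 - u j ω‖ ≤ 1 / K j}) ?_ ?_, fun n =>
    hcombine (t := fun j => (y ⁻¹' B ∩ {ω | ‖1 - angleMark α (circleCount (fun k => x k ω) n j)‖ <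
      d j}) ∪ (y ⁻¹' B ∩ {ω | b j * n ≤ circleCount (fun k => x k ω) n j} ∩
        {ω | b j < circleCount (fun k => x k ω) n j / n})) ?_ ?_⟩
  · refine ((summable_succ_pow_mul_geometric hr (2 * (E + 1))).mul_left
      ((m + 1) ^ (E + 1) * C / min 1 c)).congr fun j => ?_
    have : 0 < min 1 c := lt_min one_pos hc
    have hKE : (K j : ℝ) ^ (E + 1) = ((m : ℝ) + 1) ^ (E + 1) * ((j : ℝ) + 1) ^ (2 * (E + 1)) := by
      rw [hKr, mul_pow, ← pow_mul]
    have e : b j / d j = (K j : ℝ) ^ (E + 1) * C / min 1 c * r ^ (j + 1) := by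
      simp only [b, d]
      rw [div_div_eq_mul_div]
      ring
    rw [e, hKE]
    ring
  · intro j
    refine (hu.measureReal_le j (hK j)).trans ?_
    have := hK1 j
    gcongr
    linarith
  · filter_upwards [h.ae_y hp, ae_all_iff.2 hu.ae_norm] with ω hω hnorm hnot hBω
    by_contra! hcon
    refine hnot fun j => ⟨⟨hω.1 j, ?_⟩, hnorm j, ?_⟩
    · have hyB : y ω ∈ B := not_not.1 hBω
      refine (hyB.1 j).trans ?_
      have : 0 ≤ C * r ^ (j + 1) := by positivity
      exact le_mul_of_one_le_left this (hK1 j)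
    · exact (hd1 j).trans (hcon j).le
  · intro j
    have h1 := h.measureReal_angleMark_lt hp hc hgc hBm hC0 (n := n) (j := j) (hK j)
      (fun l hl => hl.2 j)
    have h2 : μ.real (y ⁻¹' B ∩ {ω | b j * n ≤ circleCount (fun k => x k ω) n j} ∩
        {ω | b j < circleCount (fun k => x k ω) n j / n}) ≤ 1 / K j := by
      have hb0 : 0 < b j := mul_pos (zero_lt_one.trans_le (hK1 j)) (by positivity)
      -- For `n = 0` the condition `b j * n ≤ N` is always true; the condition on the quotient,
      -- where 0/0 = 0, makes the event empty.
      rcases Nat.eq_zero_or_pos n with rfl | hn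
      · have : {ω | b j < (circleCount (fun k => x k ω) 0 j : ℝ) / (0 : ℕ)} = ∅ := by
          refine Set.eq_empty_of_forall_notMem fun ω hω => ?_
          have h3 : b j < (circleCount (fun k => x k ω) 0 j : ℝ) / (0 : ℕ) := hω
          rw [Nat.cast_zero, div_zero] at h3
          linarith
        rw [this, Set.inter_empty, measureReal_empty]
        have := hK1 j
        positivity
      · have hn' : (0 : ℝ) < n := by exact_mod_cast hn
        have h3 := h.measureReal_mul_le hp hBm (n := n) (j := j) (a := C * r ^ (j + 1))
          (fun l hl => hl.1 j) (by positivity) (b j * n)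
        have h4 : μ.real (y ⁻¹' B ∩ {ω | b j * n ≤ circleCount (fun k => x k ω) n j}) ≤
            1 / K j := by
          have hKj := zero_lt_one.trans_le (hK1 j)
          have h5 : 0 < n * (C * r ^ (j + 1)) := by positivity
          rw [le_div_iff₀ hKj]
          refine le_of_mul_le_mul_left ?_ h5
          simp only [b] at h3 ⊢
          linarith
        exact (measureReal_mono Set.inter_subset_left).trans h4
    refine (measureReal_union_le _ _).trans ((add_le_add h1 h2).trans (le_of_eq ?_))
    rw [hA]; ring
  · refine Eventually.of_forall fun ω hnot hBω => ?_
    have hyB : y ω ∈ B := not_not.1 hBω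
    by_contra! hcon
    refine hnot fun j => ⟨⟨circleCount_div_mem_Icc _ n j, ?_⟩, norm_angleMark α _, ?_⟩
    · by_contra! hlt
      refine hcon j (Or.inr ⟨⟨hyB, ?_⟩, hlt⟩)
      simp only [Set.mem_ofPred_eq]
      change b j < (circleCount (fun k => x k ω) n j : ℝ) / n at hlt
      rcases Nat.eq_zero_or_pos n with rfl | hn
      · simp
      · exact ((lt_div_iff₀ (by exact_mod_cast hn)).1 hlt).le
    · by_contra! hlt
      exact hcon j (Or.inl ⟨hyB, hlt⟩)

end

/-! ### Recovering the perimeters from the permutations -/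

open Classical in
/-- The number of elements of the orbit of `k` under `f`, or `0` if `k` is out of range. -/
noncomputable def orbitCard {n : ℕ} (f : Fin n → Fin n) (k : ℕ) : ℕ :=
  if h : k < n then (Finset.univ.filter fun m => ∃ i, f^[i] ⟨k, h⟩ = m).card else 0

/-- The integers `k` and `m` are in the same orbit of one of the maps `s n`. -/
def SameOrbit (s : (n : ℕ) → Fin n → Fin n) (k m : ℕ) : Prop :=
  ∃ n, ∃ (hk : k < n) (hm : m < n), ∃ i, (s n)^[i] ⟨k, hk⟩ = ⟨m, hm⟩

/-- The asymptotic frequency of the orbit of `k`. -/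
noncomputable def orbitFreq (s : (n : ℕ) → Fin n → Fin n) (k : ℕ) : ENNReal :=
  limsup (fun n : ℕ => (orbitCard (s n) k : ENNReal) / n) atTop

open Classical in
/-- The `j`-th largest asymptotic frequency of an orbit. -/
noncomputable def rankedFreq (s : (n : ℕ) → Fin n → Fin n) (j : ℕ) : ENNReal :=
  ⨆ k : Fin (j + 1) → ℕ,
    if ∀ a b, a ≠ b → ¬ SameOrbit s (k a) (k b) then ⨅ a, orbitFreq s (k a) else 0

theorem measurable_comp_apply {β : Type*} [MeasurableSpace β] (n : ℕ) (g : (Fin n → Fin n) → β) :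
    Measurable fun s : (n : ℕ) → Fin n → Fin n => g (s n) :=
  (measurable_of_countable g).comp (measurable_pi_apply n)

theorem measurable_orbitFreq (k : ℕ) : Measurable fun s => orbitFreq s k :=
  Measurable.limsup fun n =>
    measurable_comp_apply n fun f => (orbitCard f k : ENNReal) / n

theorem measurableSet_sameOrbit (k m : ℕ) : MeasurableSet {s | SameOrbit s k m} := by
  have : {s | SameOrbit s k m} = ⋃ n, (fun s : (n : ℕ) → Fin n → Fin n => s n) ⁻¹'
      {f | ∃ (hk : k < n) (hm : m < n), ∃ i, f^[i] ⟨k, hk⟩ = ⟨m, hm⟩} := by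
    ext s
    simp [SameOrbit]
  rw [this]
  exact MeasurableSet.iUnion fun n => measurable_pi_apply n (Set.to_countable _).measurableSet

theorem measurable_rankedFreq (j : ℕ) : Measurable fun s => rankedFreq s j := by
  refine Measurable.iSup fun k => Measurable.ite ?_
    (Measurable.iInf fun a => measurable_orbitFreq (k a)) measurable_const
  have : {s | ∀ a b, a ≠ b → ¬ SameOrbit s (k a) (k b)} =
      ⋂ a, ⋂ b, ⋂ _ : a ≠ b, {s | SameOrbit s (k a) (k b)}ᶜ := by
    ext s
    simp
  rw [this]
  exact MeasurableSet.iInter fun a => MeasurableSet.iInter fun b => MeasurableSet.iInter fun _ =>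
    (measurableSet_sameOrbit _ _).compl

section

variable {l : ℕ → ℝ} {x : ℕ → ℕ × ℝ}

theorem iterate_circlePerm_fst (hx : GoodPoints l x) {n : ℕ} (k : Fin n) (i : ℕ) :
    (x ((circlePerm l x n)^[i] k)).1 = (x k).1 := by
  induction i with
  | zero => rfl
  | succ i ih => rw [Function.iterate_succ_apply', circlePerm_fst hx, ih]

theorem exists_iterate_circlePerm_iff (hx : GoodPoints l x) {n : ℕ} (k m : Fin n) :
    (∃ i, (circlePerm l x n)^[i] k = m) ↔ (x m).1 = (x k).1 := by
  constructor
  · rintro ⟨i, rfl⟩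
    exact iterate_circlePerm_fst hx k i
  · intro h
    exact mem_of_circlePerm_invariant hx (T := {m | ∃ i, (circlePerm l x n)^[i] k = m})
      (by
        rintro _ ⟨i, rfl⟩
        exact ⟨i + 1, Function.iterate_succ_apply' _ _ _⟩) ⟨0, rfl⟩ h

theorem sameOrbit_circlePerm_iff (hx : GoodPoints l x) (k m : ℕ) :
    SameOrbit (fun n => circlePerm l x n) k m ↔ (x m).1 = (x k).1 := by
  constructor
  · rintro ⟨n, hk, hm, h⟩
    exact (exists_iterate_circlePerm_iff hx _ _).1 h
  · intro h
    exact ⟨max k m + 1, by omega, by omega, (exists_iterate_circlePerm_iff hx ⟨k, _⟩ ⟨m, _⟩).2 h⟩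

theorem orbitCard_circlePerm (hx : GoodPoints l x) {n k : ℕ} (hk : k < n) :
    orbitCard (circlePerm l x n) k = circleCount x n (x k).1 := by
  classical
  rw [orbitCard, dif_pos hk, ← card_filter_fin_eq]
  congr 1
  ext m
  simp only [Finset.mem_filter, Finset.mem_univ, true_and]
  exact exists_iterate_circlePerm_iff hx ⟨k, hk⟩ m

theorem orbitFreq_circlePerm (hx : GoodPoints l x)
    (hlim : ∀ j, Tendsto (fun n : ℕ => (circleCount x n j : ℝ) / n) atTop (𝓝 (l j))) (k : ℕ) :
    orbitFreq (fun n => circlePerm l x n) k = ENNReal.ofReal (l (x k).1) := by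
  refine Tendsto.limsup_eq ?_
  refine (ENNReal.tendsto_ofReal (hlim (x k).1)).congr' ?_
  filter_upwards [eventually_gt_atTop k] with n hn
  have hn0 : (0 : ℝ) < n := by exact_mod_cast (Nat.zero_le k).trans_lt hn
  rw [orbitCard_circlePerm hx hn, ENNReal.ofReal_div_of_pos hn0, ENNReal.ofReal_natCast,
    ENNReal.ofReal_natCast]

/-- The perimeters are the ranked asymptotic frequencies of the cycles. -/
theorem rankedFreq_circlePerm (hx : GoodPoints l x) (hl : Antitone l)
    (hlim : ∀ j, Tendsto (fun n : ℕ => (circleCount x n j : ℝ) / n) atTop (𝓝 (l j))) (j : ℕ) :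
    rankedFreq (fun n => circlePerm l x n) j = ENNReal.ofReal (l j) := by
  refine le_antisymm (iSup_le fun k => ?_) ?_
  · split_ifs with h
    · have hinj : Function.Injective fun a => (x (k a)).1 := by
        intro a b hab
        by_contra hne
        exact h a b hne ((sameOrbit_circlePerm_iff hx _ _).2 hab.symm)
      -- Pigeonhole: among `j + 1` distinct circles one has index at least `j`, hence perimeter at
      -- most `l j`.
      obtain ⟨a, ha⟩ : ∃ a, j ≤ (x (k a)).1 := by
        by_contra! hcon
        have := Fintype.card_le_of_injective (fun a => (⟨(x (k a)).1, hcon a⟩ : Fin j))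
          fun a b hab => hinj (Fin.mk.inj_iff.1 hab)
        simp at this
      refine (iInf_le _ a).trans ?_
      rw [orbitFreq_circlePerm hx hlim]
      exact ENNReal.ofReal_le_ofReal (hl ha)
    · exact zero_le
  · rcases le_or_gt (l j) 0 with h0 | h0
    · simp [ENNReal.ofReal_of_nonpos h0]
    · have hpt : ∀ a : Fin (j + 1), ∃ k : ℕ, (x k).1 = a := by
        intro a
        have ha : 0 < l a := h0.trans_le (hl (Nat.lt_succ_iff.1 a.2))
        obtain ⟨n, hn⟩ := ((hlim a).eventually_const_lt ha).exists
        have hne : circleCount x n a ≠ 0 := by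
          intro h
          simp [h] at hn
        obtain ⟨k, hk⟩ := Finset.card_ne_zero.1 hne
        exact ⟨k, (Finset.mem_filter.1 hk).2⟩
      choose k hk using hpt
      refine le_trans ?_ (le_iSup _ k)
      rw [if_pos]
      · refine le_iInf fun a => ?_
        rw [orbitFreq_circlePerm hx hlim, hk]
        exact ENNReal.ofReal_le_ofReal (hl (Nat.lt_succ_iff.1 a.2))
      · intro a b hab h
        rw [sameOrbit_circlePerm_iff hx, hk, hk] at h
        exact hab (Fin.ext h.symm)

end

section

variable {Ω : Type*} [MeasurableSpace Ω] {μ : Measure Ω} [IsProbabilityMeasure μ]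
  {p : Measure (ℕ → ℝ)} {y : Ω → ℕ → ℝ} {x : ℕ → Ω → ℕ × ℝ} {u : ℕ → Ω → ℂ}

/-- The marks are assumed independent of the permutations, not of y. But y is almost surely a
measurable function of the permutations: the ranked asymptotic frequencies of their cycles. -/
theorem indepFun_perimeters_marks (h : CircleCoupling μ p y x) (hp : ∀ᵐ l ∂p, l ∈ nablaPrime)
    (hdecay : ExponentialDecay p) (hu : UniformMarks μ y x u) :
    IndepFun y (fun ω j => u j ω) μ := by
  obtain ⟨ρ, hρ, hdec⟩ := hdecay.exists_pow_four
  have hΦ : Measurable fun (s : (n : ℕ) → Fin n → Fin n) (j : ℕ) => (rankedFreq s j).toReal :=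
    measurable_pi_lambda _ fun j => (measurable_rankedFreq j).ennreal_toReal
  refine (hu.indep_sigma.comp hΦ measurable_id).congr ?_ ae_eq_rfl
  filter_upwards [h.ae_goodPoints, h.ae_y hp, h.ae_tendsto_and_le hp hρ hdec] with ω h1 h2 h3
  ext j
  have := rankedFreq_circlePerm h1 h2.2.1 h3.1 j
  simp only [Function.comp_apply]
  erw [this, ENNReal.toReal_ofReal (h2.1 j).1]

end

/-! ### Convergence of the moments of the empirical marks -/

/-- The monomials in the perimeters and the marks of the first `J` circles. -/
noncomputable def markMonomial (J : ℕ) (e : ℕ → ℕ) (k : ℕ → ℤ) (q : (ℕ → ℝ) × (ℕ → ℂ)) : ℂ :=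
  (∏ j ∈ Finset.range J, (q.1 j : ℂ) ^ e j) * ∏ j ∈ Finset.range J, q.2 j ^ k j

theorem measurable_markMonomial (J : ℕ) (e : ℕ → ℕ) (k : ℕ → ℤ) :
    Measurable (markMonomial J e k) := by
  unfold markMonomial
  fun_prop

theorem norm_prod_pow_le_one {a : ℕ → ℝ} (ha : ∀ j, a j ∈ Set.Icc (0 : ℝ) 1) (J : ℕ)
    (e : ℕ → ℕ) : ‖∏ j ∈ Finset.range J, (a j : ℂ) ^ e j‖ ≤ 1 := by
  rw [norm_prod]
  refine Finset.prod_le_one (fun _ _ => norm_nonneg _) fun j _ => ?_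
  rw [norm_pow, Complex.norm_real, Real.norm_of_nonneg (ha j).1]
  exact pow_le_one₀ (ha j).1 (ha j).2

theorem norm_prod_zpow {v : ℕ → ℂ} (hv : ∀ j, ‖v j‖ = 1) (J : ℕ) (k : ℕ → ℤ) :
    ‖∏ j ∈ Finset.range J, v j ^ k j‖ = 1 := by
  rw [norm_prod]
  exact Finset.prod_eq_one fun j _ => by rw [norm_zpow, hv, one_zpow]

theorem norm_markMonomial_le {q : (ℕ → ℝ) × (ℕ → ℂ)} (hq : ∀ j, q.1 j ∈ Set.Icc (0 : ℝ) 1)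
    (hq' : ∀ j, ‖q.2 j‖ = 1) (J : ℕ) (e : ℕ → ℕ) (k : ℕ → ℤ) : ‖markMonomial J e k q‖ ≤ 1 := by
  rw [markMonomial, norm_mul, norm_prod_zpow hq', mul_one]
  exact norm_prod_pow_le_one hq J e

theorem exp_neg_two_pi_mul_ne_one {α : ℝ} (hα : Irrational α) {k : ℤ} (hk : k ≠ 0) :
    Complex.exp (-(2 * Complex.I * Real.pi * (k * α : ℝ))) ≠ 1 := by
  intro h
  obtain ⟨m, hm⟩ := Complex.exp_eq_one_iff.1 h
  have h2 : (2 * Real.pi * Complex.I : ℂ) ≠ 0 := Complex.two_pi_I_ne_zero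
  have h3 : (2 * Real.pi * Complex.I : ℂ) * ((k * α : ℝ) : ℂ) =
      (2 * Real.pi * Complex.I : ℂ) * ((-m : ℝ) : ℂ) := by
    push_cast at hm ⊢
    linear_combination -hm
  have h4 : (k * α : ℝ) = -m := by exact_mod_cast mul_left_cancel₀ h2 h3
  exact (hα.intCast_mul hk).ne_int (-m) (by push_cast; exact h4)

/-- A barycentre of points of the unit circle, in which the point 1 has weight 1 - ∑_{j<J} l_j,
positive because l_J > 0. Strict convexity between 1 and `w i` makes the modulus less than 1. -/
theorem norm_one_add_sum_lt_one {l : ℕ → ℝ} (hl : l ∈ nablaPrime) (hpos : ∀ j, 0 < l j) {J : ℕ}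
    {w : ℕ → ℂ} (hw : ∀ j, ‖w j‖ = 1) {i : ℕ} (hi : i < J) (hwi : w i ≠ 1) :
    ‖1 + ∑ j ∈ Finset.range J, (l j : ℂ) * (w j - 1)‖ < 1 := by
  have hsum : ∑ j ∈ Finset.range J, l j < 1 := by
    have := hl.2.2.summable.sum_le_tsum (Finset.range (J + 1)) fun j _ => (hl.1 j).1
    rw [hl.2.2.tsum_eq, Finset.sum_range_succ] at this
    linarith [hpos J]
  set b := 1 - ∑ j ∈ Finset.range J, l j with hb
  have hb0 : 0 < b := by linarith
  have hmem : i ∈ Finset.range J := Finset.mem_range.2 hi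
  have e1 : 1 + ∑ j ∈ Finset.range J, (l j : ℂ) * (w j - 1) =
      ((b : ℂ) + l i * w i) + ∑ j ∈ (Finset.range J).erase i, (l j : ℂ) * w j := by
    rw [add_assoc, Finset.add_sum_erase _ (fun j => (l j : ℂ) * w j) hmem, hb]
    push_cast
    simp_rw [mul_sub, Finset.sum_sub_distrib, mul_one]
    ring
  have h1 : ‖(b : ℂ) + l i * w i‖ < l i + b := by
    refine lt_of_pow_lt_pow_left₀ 2 (by linarith [hpos i]) ?_
    rw [normSq_convex_combination (hw i)]
    have : 0 < ‖1 - w i‖ := norm_pos_iff.2 (sub_ne_zero.2 hwi.symm)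
    have := mul_pos (mul_pos (hpos i) hb0) (pow_pos this 2)
    linarith
  have h2 : ‖∑ j ∈ (Finset.range J).erase i, (l j : ℂ) * w j‖ ≤
      ∑ j ∈ (Finset.range J).erase i, l j := by
    refine (norm_sum_le _ _).trans (Finset.sum_le_sum fun j _ => ?_)
    rw [norm_mul, hw, mul_one, Complex.norm_real, Real.norm_of_nonneg (hl.1 j).1]
  have h3 := Finset.add_sum_erase (Finset.range J) l hmem
  rw [e1]
  refine (norm_add_le _ _).trans_lt ?_
  linarith

section

variable {Ω : Type*} [MeasurableSpace Ω] {μ : Measure Ω} [IsProbabilityMeasure μ]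
  {p : Measure (ℕ → ℝ)} {y : Ω → ℕ → ℝ} {x : ℕ → Ω → ℕ × ℝ} {u : ℕ → Ω → ℂ}

omit [IsProbabilityMeasure μ] in
theorem UniformMarks.integral_prod_zpow_eq_zero (hu : UniformMarks μ y x u) {J : ℕ} {k : ℕ → ℤ}
    {i : ℕ} (hi : i < J) (hk : k i ≠ 0) : ∫ ω, ∏ j ∈ Finset.range J, u j ω ^ k j ∂μ = 0 := by
  have h1 := (hu.indep_u.precomp (g := fun j : Fin J => (j : ℕ))
    Fin.val_injective).integral_fun_prod_comp (𝕜 := ℂ) (f := fun (j : Fin J) (z : ℂ) => z ^ k j)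
    (fun j => (hu.measurable_u j).aemeasurable)
    (fun j => (by fun_prop : Measurable fun z : ℂ => z ^ k j).aestronglyMeasurable)
  have h2 : ∀ ω, ∏ j ∈ Finset.range J, u j ω ^ k j = ∏ j : Fin J, u j ω ^ k j := fun ω =>
    (Fin.prod_univ_eq_prod_range (fun j => u j ω ^ k j) J).symm
  simp_rw [h2]
  refine h1.trans (Finset.prod_eq_zero (Finset.mem_univ (⟨i, hi⟩ : Fin J)) ?_)
  exact hu.integral_zpow i hk

omit [IsProbabilityMeasure μ] in
theorem CircleCoupling.measurable_empiricalMarks (h : CircleCoupling μ p y x) (α : ℝ) (n : ℕ) :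
    Measurable fun ω => empiricalMarks α (fun k => x k ω) n := by
  have := h.measurable_circleCount n
  refine Measurable.prodMk (measurable_pi_lambda _ fun j => ?_) (measurable_pi_lambda _ fun j => ?_)
  · exact (measurable_of_countable fun N : ℕ => (N : ℝ) / n).comp (this j)
  · exact (measurable_of_countable (angleMark α)).comp (this j)

variable (h : CircleCoupling μ p y x) (hp : ∀ᵐ l ∂p, l ∈ nablaPrime)
  (hdecay : ExponentialDecay p) (hu : UniformMarks μ y x u)
  (hpos : ∀ᵐ l ∂p, ∀ j, 0 < l j)
include h hp hdecay hu hpos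

/-- If all the k_j vanish, both sides are equal. Otherwise the base of the power has modulus less
than 1, so the left side tends to 0 by dominated convergence, and the right side is 0 by
independence and uniformity of the marks. -/
theorem tendsto_integral_mul_pow {α : ℝ} (hα : Irrational α) (J : ℕ) (e : ℕ → ℕ) (k : ℕ → ℤ) :
    Tendsto (fun n : ℕ => ∫ ω, (∏ j ∈ Finset.range J, (y ω j : ℂ) ^ e j) *
      (1 + ∑ j ∈ Finset.range J,
        (y ω j : ℂ) * (Complex.exp (-(2 * Complex.I * Real.pi * (k j * α : ℝ))) - 1)) ^ n ∂μ)
      atTop (𝓝 (∫ ω, markMonomial J e k (y ω, fun j => u j ω) ∂μ)) := by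
  by_cases hk : ∀ j < J, k j = 0
  · refine tendsto_const_nhds.congr fun n => integral_congr_ae (Eventually.of_forall fun ω => ?_)
    have h1 : ∏ j ∈ Finset.range J, u j ω ^ k j = 1 := Finset.prod_eq_one fun j hj => by
      rw [hk j (Finset.mem_range.1 hj), zpow_zero]
    have h2 : ∑ j ∈ Finset.range J, (y ω j : ℂ) *
        (Complex.exp (-(2 * Complex.I * Real.pi * (k j * α : ℝ))) - 1) = 0 :=
      Finset.sum_eq_zero fun j hj => by simp [hk j (Finset.mem_range.1 hj)]
    simp only [markMonomial]
    rw [h1, h2]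
    simp
  · push Not at hk
    obtain ⟨i, hi, hki⟩ := hk
    have hm : ∀ j, Measurable fun ω => y ω j := h.measurable_y_apply
    have hlim : ∫ ω, markMonomial J e k (y ω, fun j => u j ω) ∂μ = 0 := by
      have := (indepFun_perimeters_marks h hp hdecay hu).integral_fun_comp_mul_comp (𝕜 := ℂ)
        (f := fun l : ℕ → ℝ => ∏ j ∈ Finset.range J, (l j : ℂ) ^ e j)
        (g := fun v : ℕ → ℂ => ∏ j ∈ Finset.range J, v j ^ k j)
        h.measurable_y.aemeasurable (measurable_pi_lambda _ hu.measurable_u).aemeasurable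
        (by fun_prop : Measurable _).aestronglyMeasurable
        (by fun_prop : Measurable _).aestronglyMeasurable
      refine this.trans ?_
      rw [hu.integral_prod_zpow_eq_zero hi hki, mul_zero]
    rw [hlim, ← integral_zero Ω ℂ (μ := μ)]
    refine tendsto_integral_of_dominated_convergence (fun _ => 1) (fun n => ?_)
      (integrable_const _) (fun n => ?_) ?_
    · exact (by fun_prop : Measurable _).aestronglyMeasurable
    · filter_upwards [h.ae_y hp, h.ae_y hpos] with ω h1 h2
      rw [norm_mul, norm_pow]
      refine mul_le_one₀ (norm_prod_pow_le_one h1.1 J e) (by positivity) ?_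
      exact pow_le_one₀ (norm_nonneg _) (norm_one_add_sum_lt_one h1 h2
        (fun j => norm_exp_neg_two_pi (k j * α)) hi (exp_neg_two_pi_mul_ne_one hα hki)).le
    · filter_upwards [h.ae_y hp, h.ae_y hpos] with ω h1 h2
      have := tendsto_pow_atTop_nhds_zero_of_norm_lt_one (norm_one_add_sum_lt_one h1 h2
        (fun j => norm_exp_neg_two_pi (k j * α)) hi (exp_neg_two_pi_mul_ne_one hα hki))
      simpa using this.const_mul (∏ j ∈ Finset.range J, (y ω j : ℂ) ^ e j)

/-- Replacing N_j/n by y_j costs an error that vanishes by the law of large numbers and dominated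
convergence. As y_j > 0, the first `J` circles are eventually occupied, so the default mark -1
disappears and the generating function of the counts remains. -/
theorem tendsto_integral_markMonomial {α : ℝ} (hα : Irrational α) (J : ℕ) (e : ℕ → ℕ)
    (k : ℕ → ℤ) :
    Tendsto (fun n : ℕ => ∫ ω, markMonomial J e k (empiricalMarks α (fun k => x k ω) n) ∂μ)
      atTop (𝓝 (∫ ω, markMonomial J e k (y ω, fun j => u j ω) ∂μ)) := by
  obtain ⟨ρ, hρ, hdec⟩ := hdecay.exists_pow_four
  set w : ℕ → ℂ := fun j => Complex.exp (-(2 * Complex.I * Real.pi * (k j * α : ℝ))) with hw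
  set g : (ℕ → ℝ) → ℂ := fun l => ∏ j ∈ Finset.range J, (l j : ℂ) ^ e j with hg
  have hgm : Measurable g := by fun_prop
  have hm : ∀ j, Measurable fun ω => y ω j := h.measurable_y_apply
  have hgy : ∀ᵐ ω ∂μ, ‖g (y ω)‖ ≤ 1 := by
    filter_upwards [h.ae_y hp] with ω h1 using norm_prod_pow_le_one h1.1 J e
  have hgi : Integrable (fun ω => g (y ω)) μ :=
    Integrable.of_bound (hgm.comp h.measurable_y).aestronglyMeasurable 1 hgy
  set Y : ℕ → Ω → ℂ := fun n ω => g (y ω) *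
    ∏ j ∈ Finset.range J, w j ^ circleCount (fun k => x k ω) n j with hY
  have hYm : ∀ n, Measurable (Y n) := fun n =>
    (hgm.comp h.measurable_y).mul (Finset.measurable_fun_prod _ fun j _ =>
      (measurable_of_countable fun N : ℕ => w j ^ N).comp (h.measurable_circleCount n j))
  have hw1 : ∀ (n : ℕ) ω, ‖∏ j ∈ Finset.range J, w j ^ circleCount (fun k => x k ω) n j‖ = 1 := by
    intro n ω
    rw [norm_prod]
    exact Finset.prod_eq_one fun j _ => by rw [norm_pow, hw, norm_exp_neg_two_pi, one_pow]
  have hYle : ∀ n, ∀ᵐ ω ∂μ, ‖Y n ω‖ ≤ 1 := by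
    intro n
    filter_upwards [hgy] with ω h1
    rw [hY, norm_mul, hw1, mul_one]
    exact h1
  have hYint : Tendsto (fun n => ∫ ω, Y n ω ∂μ) atTop
      (𝓝 (∫ ω, markMonomial J e k (y ω, fun j => u j ω) ∂μ)) := by
    refine (tendsto_integral_mul_pow h hp hdecay hu hpos hα J e k).congr fun n => ?_
    rw [← h.integral_mul_prod hp hgm.stronglyMeasurable hgi w J n]
    refine integral_congr_ae (Eventually.of_forall fun ω => ?_)
    simp only [hY]
    rw [← prod_ite_eq_prod_pow_circleCount]
  set X : ℕ → Ω → ℂ := fun n ω => markMonomial J e k (empiricalMarks α (fun k => x k ω) n) with hX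
  have hXm : ∀ n, Measurable (X n) := fun n =>
    (measurable_markMonomial J e k).comp (h.measurable_empiricalMarks α n)
  have hXle : ∀ n ω, ‖X n ω‖ ≤ 1 := fun n ω =>
    norm_markMonomial_le (fun j => circleCount_div_mem_Icc _ n j) (fun j => norm_angleMark α _) J e k
  have hdiff : Tendsto (fun n => ∫ ω, (X n ω - Y n ω) ∂μ) atTop (𝓝 0) := by
    rw [← integral_zero Ω ℂ (μ := μ)]
    refine tendsto_integral_of_dominated_convergence (fun _ => 2)
      (fun n => ((hXm n).sub (hYm n)).aestronglyMeasurable) (integrable_const _) (fun n => ?_) ?_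
    · filter_upwards [hYle n] with ω h1
      linarith [norm_sub_le (X n ω) (Y n ω), hXle n ω]
    · filter_upwards [h.ae_tendsto_and_le hp hρ hdec, h.ae_y hpos] with ω h1 h2
      have hev : ∀ᶠ n : ℕ in atTop, ∀ j ∈ Finset.range J,
          circleCount (fun k => x k ω) n j ≠ 0 := by
        rw [Filter.eventually_all_finset]
        intro j _
        filter_upwards [(h1.1 j).eventually_const_lt (h2 j)] with n hn h0
        simp [h0] at hn
      have hg0 : Tendsto (fun n : ℕ => ∏ j ∈ Finset.range J,
          (((circleCount (fun k => x k ω) n j : ℝ) / n : ℝ) : ℂ) ^ e j - g (y ω)) atTop (𝓝 0) := by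
        rw [← sub_self (g (y ω))]
        refine Tendsto.sub_const (tendsto_finsetProd _ fun j _ => ?_) _
        exact ((Complex.continuous_ofReal.tendsto _).comp (h1.1 j)).pow (e j)
      refine squeeze_zero_norm' ?_ (tendsto_zero_iff_norm_tendsto_zero.1 hg0)
      filter_upwards [hev] with n hn
      have e1 : ∏ j ∈ Finset.range J, angleMark α (circleCount (fun k => x k ω) n j) ^ k j =
          ∏ j ∈ Finset.range J, w j ^ circleCount (fun k => x k ω) n j := by
        refine Finset.prod_congr rfl fun j hj => ?_
        rw [angleMark_of_ne_zero α (hn j hj), hw, ← Complex.exp_int_mul, ← Complex.exp_nat_mul]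
        congr 1
        push_cast
        ring
      simp only [hX, hY, markMonomial, empiricalMarks]
      rw [e1, ← sub_mul, norm_mul, hw1, mul_one]
  have hXi : ∀ n, Integrable (X n) μ := fun n =>
    Integrable.of_bound (hXm n).aestronglyMeasurable 1 (Eventually.of_forall (hXle n))
  have hYi : ∀ n, Integrable (Y n) μ := fun n =>
    Integrable.of_bound (hYm n).aestronglyMeasurable 1 (hYle n)
  have := hdiff.add hYint
  rw [zero_add] at this
  refine this.congr fun n => ?_
  rw [integral_sub (hXi n) (hYi n), sub_add_cancel]

end

/-! ### A mapping theorem for maps continuous on closed sets of large probability -/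

section Mapping

variable {Ω E S : Type*} [MeasurableSpace Ω] {μ : Measure Ω} [IsProbabilityMeasure μ]
  [TopologicalSpace E] [MeasurableSpace E] [OpensMeasurableSpace E]
  [TopologicalSpace S] [MeasurableSpace S] [BorelSpace S]

/-- The map is measurable on a countable union of closed sets, whose complement is null for the law
of `V`. -/
theorem aemeasurable_comp_of_continuousOn {V : Ω → E} (hV : Measurable V) {Φ : E → S}
    (hΦ : ∀ ε > 0, ∃ K, IsClosed K ∧ ContinuousOn Φ K ∧ μ.real {ω | V ω ∉ K} ≤ ε) :
    AEMeasurable (fun ω => Φ (V ω)) μ := by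
  have hpos : ∀ k : ℕ, (0 : ℝ) < 1 / (k + 1) := fun k => by positivity
  choose K hK hc hμ using fun k : ℕ => hΦ (1 / (k + 1)) (hpos k)
  refine AEMeasurable.comp_measurable (g := Φ) ?_ hV
  have h1 : AEMeasurable Φ ((μ.map V).restrict (⋃ k, K k)) :=
    aemeasurable_iUnion_iff.2 fun k => (hc k).aemeasurable (hK k).measurableSet
  rwa [Measure.restrict_eq_self_of_ae_mem] at h1
  rw [ae_iff, ← measureReal_eq_zero_iff]
  have hm : MeasurableSet (⋃ k, K k)ᶜ := (MeasurableSet.iUnion fun k => (hK k).measurableSet).compl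
  rw [show {a | a ∉ ⋃ k, K k} = (⋃ k, K k)ᶜ from rfl, map_measureReal_apply hV hm]
  refine le_antisymm (ge_of_tendsto' tendsto_one_div_add_atTop_nhds_zero_nat fun k => ?_)
    measureReal_nonneg
  refine (measureReal_mono ?_).trans (hμ k)
  intro ω hω hk
  exact hω (Set.mem_iUnion.2 ⟨k, hk⟩)

theorem norm_integral_sub_integral_le {f g : Ω → ℝ} (hf : Integrable f μ) (hg : Integrable g μ)
    {C : ℝ} (hfC : ∀ ω, ‖f ω‖ ≤ C) (hgC : ∀ ω, ‖g ω‖ ≤ C) {s : Set Ω} (hs : MeasurableSet s)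
    (hfg : ∀ ω ∉ s, f ω = g ω) : ‖∫ ω, f ω ∂μ - ∫ ω, g ω ∂μ‖ ≤ μ.real s * (2 * C) := by
  rw [← integral_sub hf hg, ← smul_eq_mul, ← integral_indicator_const _ hs]
  refine norm_integral_le_of_norm_le ((integrable_const _).indicator hs)
    (Eventually.of_forall fun ω => ?_)
  by_cases h : ω ∈ s
  · rw [Set.indicator_of_mem h]
    linarith [norm_sub_le (f ω) (g ω), hfC ω, hgC ω]
  · rw [Set.indicator_of_notMem h, hfg ω h, sub_self, norm_zero]

/-- A mapping theorem: convergence in law is preserved by maps that are continuous on closed sets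
of uniformly large probability. -/
theorem tendstoInDistribution_comp_of_continuousOn [NormalSpace E] {V : ℕ → Ω → E} {W : Ω → E}
    (hV : ∀ n, Measurable (V n)) (hW : Measurable W)
    (hlim : ∀ H : BoundedContinuousFunction E ℝ,
      Tendsto (fun n => ∫ ω, H (V n ω) ∂μ) atTop (𝓝 (∫ ω, H (W ω) ∂μ)))
    {Φ : E → S}
    (hΦ : ∀ ε > 0, ∃ K, IsClosed K ∧ ContinuousOn Φ K ∧ μ.real {ω | W ω ∉ K} ≤ ε ∧
      ∀ n, μ.real {ω | V n ω ∉ K} ≤ ε) :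
    TendstoInDistribution (fun n ω => Φ (V n ω)) atTop (fun ω => Φ (W ω)) (fun _ => μ) μ := by
  have hVm : ∀ n, AEMeasurable (fun ω => Φ (V n ω)) μ := fun n =>
    aemeasurable_comp_of_continuousOn (hV n) fun ε hε => by
      obtain ⟨K, h1, h2, -, h4⟩ := hΦ ε hε
      exact ⟨K, h1, h2, h4 n⟩
  have hWm : AEMeasurable (fun ω => Φ (W ω)) μ :=
    aemeasurable_comp_of_continuousOn hW fun ε hε => by
      obtain ⟨K, h1, h2, h3, -⟩ := hΦ ε hε
      exact ⟨K, h1, h2, h3⟩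
  refine ⟨hVm, hWm, ?_⟩
  refine ProbabilityMeasure.tendsto_iff_forall_integral_tendsto.2 fun F => ?_
  have hF : StronglyMeasurable F := F.continuous.stronglyMeasurable
  change Tendsto (fun n => ∫ s, F s ∂(μ.map fun ω => Φ (V n ω))) atTop
    (𝓝 (∫ s, F s ∂(μ.map fun ω => Φ (W ω))))
  rw [integral_map hWm hF.aestronglyMeasurable]
  simp_rw [fun n => integral_map (hVm n) hF.aestronglyMeasurable]
  have hint : ∀ {f : Ω → S}, AEMeasurable f μ → Integrable (fun ω => F (f ω)) μ := fun hf =>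
    Integrable.of_bound (hF.measurable.comp_aemeasurable hf).aestronglyMeasurable ‖F‖
      (Eventually.of_forall fun ω => F.norm_coe_le_norm _)
  rw [Metric.tendsto_atTop]
  intro ε hε
  -- Chosen so that an error of 2‖F‖ with probability δ costs less than ε/3; the added 1 covers F =
  -- 0.
  set δ := ε / (3 * (2 * ‖F‖ + 1)) with hδ
  have hδ0 : 0 < δ := by positivity
  obtain ⟨K, hK, hc, hWK, hVK⟩ := hΦ δ hδ0
  -- Tietze: the restriction of F ∘ Φ to the closed set extends to a bounded continuous `H` of the
  -- same norm, to which the convergence in law applies.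
  set G : BoundedContinuousFunction K ℝ :=
    F.compContinuous ⟨fun q : K => Φ q, hc.domRestrict⟩ with hG
  obtain ⟨H, hHn, hHr⟩ := G.exists_norm_eq_domRestrict_eq_of_closed hK
  have hHK : ∀ q ∈ K, F (Φ q) = H q := fun q hq =>
    (DFunLike.congr_fun hHr (⟨q, hq⟩ : K)).symm
  have hHF : ∀ q, ‖H q‖ ≤ ‖F‖ := fun q => (H.norm_coe_le_norm q).trans
    (hHn.trans_le (BoundedContinuousFunction.norm_le (norm_nonneg _) |>.2
      fun q => F.norm_coe_le_norm _))
  have hHint : ∀ {f : Ω → E}, Measurable f → Integrable (fun ω => H (f ω)) μ := fun hf =>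
    Integrable.of_bound (H.continuous.measurable.comp hf).aestronglyMeasurable ‖F‖
      (Eventually.of_forall fun ω => hHF _)
  have hδε : δ * (2 * ‖F‖) < ε / 3 := by
    rw [hδ, div_mul_eq_mul_div, div_lt_iff₀ (by positivity)]
    nlinarith [norm_nonneg F]
  have key : ∀ {f : Ω → E}, Measurable f → AEMeasurable (fun ω => Φ (f ω)) μ →
      μ.real {ω | f ω ∉ K} ≤ δ →
      ‖∫ ω, F (Φ (f ω)) ∂μ - ∫ ω, H (f ω) ∂μ‖ < ε / 3 := by
    intro f hf hf' hfK
    refine lt_of_le_of_lt ((norm_integral_sub_integral_le (hint hf') (hHint hf)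
      (fun ω => F.norm_coe_le_norm _) (fun ω => hHF _) (s := {ω | f ω ∉ K})
      (hf hK.measurableSet).compl fun ω hω => hHK _ (not_not.1 hω)).trans ?_) hδε
    gcongr
  obtain ⟨N, hN⟩ := Metric.tendsto_atTop.1 (hlim H) (ε / 3) (by positivity)
  refine ⟨N, fun n hn => ?_⟩
  have h1 := key (hV n) (hVm n) (hVK n)
  have h2 := key hW hWm hWK
  have h3 := hN n hn
  rw [Real.dist_eq] at h3 ⊢
  rw [Real.norm_eq_abs] at h1 h2
  rw [abs_lt] at *
  constructor <;> linarith [h1.1, h1.2, h2.1, h2.2, h3.1, h3.2]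

end Mapping

/-! ### Monomials determine convergence in law on a compact space -/

/-- The compact set of sequences of proportions and of marks of modulus one. -/
def markSpace : Set ((ℕ → ℝ) × (ℕ → ℂ)) := {q | ∀ j, q.1 j ∈ Set.Icc (0 : ℝ) 1 ∧ ‖q.2 j‖ = 1}

theorem isCompact_markSpace : IsCompact markSpace := by
  convert isCompact_markBox (fun _ => 1) (fun _ => 0) using 1
  ext q
  refine forall_congr' fun j => ?_
  constructor
  · exact fun h => ⟨⟨h.1, h.1.2⟩, h.2, norm_nonneg _⟩
  · exact fun h => ⟨h.1.1, h.2.1⟩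

instance : CompactSpace markSpace := isCompact_iff_compactSpace.1 isCompact_markSpace

theorem markSpace_ne_zero (q : markSpace) (j : ℕ) : q.1.2 j ≠ 0 := by
  have := (q.2 j).2
  intro h
  simp [h] at this

theorem continuous_markMonomial (J : ℕ) (e : ℕ → ℕ) (k : ℕ → ℤ) :
    Continuous fun q : markSpace => markMonomial J e k q := by
  unfold markMonomial
  refine Continuous.mul (by fun_prop) (continuous_finsetProd _ fun j _ => ?_)
  exact Continuous.zpow₀ (by fun_prop) _ fun q => Or.inl (markSpace_ne_zero q j)

theorem markMonomial_extend {J J' : ℕ} (hJ : J ≤ J') (e : ℕ → ℕ) (k : ℕ → ℤ)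
    (q : (ℕ → ℝ) × (ℕ → ℂ)) :
    markMonomial J e k q =
      markMonomial J' (fun j => if j < J then e j else 0) (fun j => if j < J then k j else 0) q := by
  have hs : Finset.range J ⊆ Finset.range J' := Finset.range_mono hJ
  simp only [markMonomial]
  congr 1
  · refine (Finset.prod_congr rfl fun j hj => ?_).trans (Finset.prod_subset hs fun j _ hj => ?_)
    · rw [if_pos (Finset.mem_range.1 hj)]
    · rw [if_neg (by simpa using hj), pow_zero]
  · refine (Finset.prod_congr rfl fun j hj => ?_).trans (Finset.prod_subset hs fun j _ hj => ?_)
    · rw [if_pos (Finset.mem_range.1 hj)]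
    · rw [if_neg (by simpa using hj), zpow_zero]

theorem markMonomial_mul (J : ℕ) (e e' : ℕ → ℕ) (k k' : ℕ → ℤ) (q : markSpace) :
    markMonomial J e k q * markMonomial J e' k' q =
      markMonomial J (fun j => e j + e' j) (fun j => k j + k' j) q := by
  simp only [markMonomial]
  simp_rw [pow_add, fun j => zpow_add₀ (markSpace_ne_zero q j), Finset.prod_mul_distrib]
  ring

/-- Conjugation is inversion on the unit circle: integer exponents make the monomials stable under
it. -/
theorem star_markMonomial (J : ℕ) (e : ℕ → ℕ) (k : ℕ → ℤ) (q : markSpace) :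
    star (markMonomial J e k q) = markMonomial J e (fun j => -k j) q := by
  have h1 : ∀ j, (starRingEnd ℂ) (q.1.2 j) = (q.1.2 j)⁻¹ := fun j =>
    (Complex.inv_eq_conj (q.2 j).2).symm
  simp only [markMonomial, Complex.star_def, map_mul, map_prod, map_pow, map_zpow₀,
    Complex.conj_ofReal, h1, inv_zpow']

/-- The monomials, as a submonoid of the continuous functions on the space of marks. -/
def markMonomials : Submonoid C(markSpace, ℂ) where
  carrier := {f | ∃ J e k, ∀ q, f q = markMonomial J e k q}
  one_mem' := ⟨0, 0, 0, fun q => by simp [markMonomial]⟩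
  mul_mem' := by
    rintro f g ⟨J, e, k, hf⟩ ⟨J', e', k', hg⟩
    refine ⟨max J J', fun j => (if j < J then e j else 0) + if j < J' then e' j else 0,
      fun j => (if j < J then k j else 0) + if j < J' then k' j else 0, fun q => ?_⟩
    rw [ContinuousMap.mul_apply, hf, hg, markMonomial_extend (le_max_left J J'),
      markMonomial_extend (le_max_right J J'), markMonomial_mul]

theorem separatesPoints_markMonomials :
    (StarAlgebra.adjoin ℂ (markMonomials : Set C(markSpace, ℂ))).SeparatesPoints := by
  intro q q' hne
  by_contra! hcon
  have key : ∀ J e k, markMonomial J e k q = markMonomial J e k q' := fun J e k =>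
    hcon _ ⟨⟨_, continuous_markMonomial J e k⟩,
      StarAlgebra.subset_adjoin ℂ _ ⟨J, e, k, fun _ => rfl⟩, rfl⟩
  refine hne (Subtype.ext (Prod.ext (funext fun j => ?_) (funext fun j => ?_)))
  · have := key (j + 1) (fun i => if i = j then 1 else 0) 0
    simpa [markMonomial, pow_ite, Finset.prod_ite_eq'] using this
  · have := key (j + 1) 0 (fun i => if i = j then 1 else 0)
    have h2 : ∀ q : markSpace, markMonomial (j + 1) 0 (fun i => if i = j then 1 else 0) q =
        q.1.2 j := by
      intro q
      rw [markMonomial, Finset.prod_eq_single_of_mem (f := fun i => q.1.2 i ^ _) j (by simp)]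
      · simp
      · intro i _ hi
        simp [hi]
    rwa [h2, h2] at this

/-- Stone–Weierstrass. The monomials form a monoid stable under conjugation, so the star algebra
they generate is merely their linear span. -/
theorem exists_mem_span_markMonomials (f : C(markSpace, ℂ)) {ε : ℝ} (hε : 0 < ε) :
    ∃ g ∈ Submodule.span ℂ (markMonomials : Set C(markSpace, ℂ)), ∀ q, ‖f q - g q‖ < ε := by
  have h1 := ContinuousMap.starSubalgebra_topologicalClosure_eq_top_of_separatesPoints _
    separatesPoints_markMonomials
  have h2 : f ∈ (StarAlgebra.adjoin ℂ (markMonomials : Set C(markSpace, ℂ))).topologicalClosure :=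
    h1 ▸ StarSubalgebra.mem_top
  obtain ⟨g, hg, hfg⟩ := Metric.mem_closure_iff.1 h2 ε hε
  refine ⟨g, ?_, fun q => ?_⟩
  · have hstar : (markMonomials : Set C(markSpace, ℂ)) ∪ star (markMonomials : Set C(markSpace, ℂ)) =
        markMonomials := by
      refine Set.union_eq_left.2 ?_
      rintro f ⟨J, e, k, hf⟩
      refine ⟨J, e, fun j => -k j, fun q => ?_⟩
      rw [← star_markMonomial, ← hf, ContinuousMap.star_apply, star_star]
    have h3 := StarAlgebra.adjoin_eq_span (R := ℂ) (markMonomials : Set C(markSpace, ℂ))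
    rw [hstar, Submonoid.closure_eq] at h3
    rw [← h3]
    exact hg
  · rw [← dist_eq_norm]
    exact (ContinuousMap.dist_apply_le_dist q).trans_lt hfg

section

variable {Ω : Type*} [MeasurableSpace Ω] {μ : Measure Ω} [IsProbabilityMeasure μ]
  {V : ℕ → Ω → (ℕ → ℝ) × (ℕ → ℂ)} {W : Ω → (ℕ → ℝ) × (ℕ → ℂ)}
  (hV : ∀ n, Measurable (V n)) (hW : Measurable W)
  (hVs : ∀ n, ∀ᵐ ω ∂μ, V n ω ∈ markSpace) (hWs : ∀ᵐ ω ∂μ, W ω ∈ markSpace)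
  (hlim : ∀ J e k, Tendsto (fun n => ∫ ω, markMonomial J e k (V n ω) ∂μ) atTop
    (𝓝 (∫ ω, markMonomial J e k (W ω) ∂μ)))
include hV hW hVs hWs hlim

/-- The variables lie in `markSpace` only almost surely, so an element of the span is represented by
a measurable function on the ambient space. -/
theorem exists_tendsto_integral_of_mem_span {f : C(markSpace, ℂ)}
    (hf : f ∈ Submodule.span ℂ (markMonomials : Set C(markSpace, ℂ))) :
    ∃ P : (ℕ → ℝ) × (ℕ → ℂ) → ℂ, Measurable P ∧ (∀ q : markSpace, P q = f q) ∧
      Tendsto (fun n => ∫ ω, P (V n ω) ∂μ) atTop (𝓝 (∫ ω, P (W ω) ∂μ)) := by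
  have hint : ∀ {P : (ℕ → ℝ) × (ℕ → ℂ) → ℂ} {f : C(markSpace, ℂ)}, Measurable P →
      (∀ q : markSpace, P q = f q) → ∀ {Y : Ω → (ℕ → ℝ) × (ℕ → ℂ)}, Measurable Y →
      (∀ᵐ ω ∂μ, Y ω ∈ markSpace) → Integrable (fun ω => P (Y ω)) μ := by
    intro P f hP hPf Y hY hYs
    refine Integrable.of_bound (hP.comp hY).aestronglyMeasurable ‖f‖ ?_
    filter_upwards [hYs] with ω hω
    rw [hPf ⟨Y ω, hω⟩]
    exact f.norm_coe_le_norm _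
  induction hf using Submodule.span_induction with
  | mem f hf =>
    obtain ⟨J, e, k, hf⟩ := hf
    exact ⟨markMonomial J e k, measurable_markMonomial J e k, fun q => (hf q).symm, hlim J e k⟩
  | zero => exact ⟨fun _ => 0, measurable_const, fun _ => rfl, by simp⟩
  | add f g _ _ ihf ihg =>
    obtain ⟨P, hP, hPf, hPl⟩ := ihf
    obtain ⟨Q, hQ, hQg, hQl⟩ := ihg
    refine ⟨fun q => P q + Q q, hP.add hQ, fun q => by simp [hPf, hQg], ?_⟩
    have := hPl.add hQl
    rw [← integral_add (hint hP hPf hW hWs) (hint hQ hQg hW hWs)] at this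
    exact this.congr fun n =>
      (integral_add (hint hP hPf (hV n) (hVs n)) (hint hQ hQg (hV n) (hVs n))).symm
  | smul c f _ ihf =>
    obtain ⟨P, hP, hPf, hPl⟩ := ihf
    refine ⟨fun q => c * P q, hP.const_mul c, fun q => by simp [hPf], ?_⟩
    simp_rw [integral_const_mul]
    exact hPl.const_mul c

/-- Convergence of the expectations of the monomials implies convergence in law. -/
theorem tendsto_integral_of_forall_markMonomial
    (H : BoundedContinuousFunction ((ℕ → ℝ) × (ℕ → ℂ)) ℝ) :
    Tendsto (fun n => ∫ ω, H (V n ω) ∂μ) atTop (𝓝 (∫ ω, H (W ω) ∂μ)) := by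
  rw [Metric.tendsto_atTop]
  intro ε hε
  obtain ⟨g, hg, hHg⟩ := exists_mem_span_markMonomials
    ⟨fun q : markSpace => (H q : ℂ), by fun_prop⟩ (ε := ε / 4) (by positivity)
  obtain ⟨P, hP, hPg, hPl⟩ := exists_tendsto_integral_of_mem_span hV hW hVs hWs hlim hg
  have key : ∀ {Y : Ω → (ℕ → ℝ) × (ℕ → ℂ)}, Measurable Y → (∀ᵐ ω ∂μ, Y ω ∈ markSpace) →
      ‖((∫ ω, H (Y ω) ∂μ : ℝ) : ℂ) - ∫ ω, P (Y ω) ∂μ‖ ≤ ε / 4 := by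
    intro Y hY hYs
    have h1 : Integrable (fun ω => (H (Y ω) : ℂ)) μ :=
      Integrable.of_bound (Complex.measurable_ofReal.comp
        (H.continuous.measurable.comp hY)).aestronglyMeasurable ‖H‖
        (Eventually.of_forall fun ω => by
          rw [Complex.norm_real]; exact H.norm_coe_le_norm _)
    have h2 : Integrable (fun ω => P (Y ω)) μ := by
      refine Integrable.of_bound (hP.comp hY).aestronglyMeasurable ‖g‖ ?_
      filter_upwards [hYs] with ω hω
      rw [hPg ⟨Y ω, hω⟩]
      exact g.norm_coe_le_norm _
    rw [← integral_complex_ofReal, ← integral_sub h1 h2]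
    refine (norm_integral_le_of_norm_le (integrable_const (ε / 4)) ?_).trans_eq (by simp)
    filter_upwards [hYs] with ω hω
    rw [hPg ⟨Y ω, hω⟩]
    exact (hHg ⟨Y ω, hω⟩).le
  obtain ⟨N, hN⟩ := Metric.tendsto_atTop.1 hPl (ε / 4) (by positivity)
  refine ⟨N, fun n hn => ?_⟩
  have h1 := key (hV n) (hVs n)
  have h2 := key hW hWs
  have h3 := hN n hn
  rw [dist_eq_norm] at h3 ⊢
  rw [← Complex.norm_real, Complex.ofReal_sub]
  set A := ((∫ ω, H (V n ω) ∂μ : ℝ) : ℂ)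
  set B := ((∫ ω, H (W ω) ∂μ : ℝ) : ℂ)
  set a := ∫ ω, P (V n ω) ∂μ
  set b := ∫ ω, P (W ω) ∂μ
  calc ‖A - B‖ = ‖(A - a) + (a - b) - (B - b)‖ := by congr 1; ring
    _ ≤ ‖A - a‖ + ‖a - b‖ + ‖B - b‖ := (norm_sub_le _ _).trans (by gcongr; exact norm_add_le _ _)
    _ < ε := by linarith

end

/-! ### Convergence in law for the permutation matrices -/

section

variable {Ω : Type*} [MeasurableSpace Ω] {μ : Measure Ω} [IsProbabilityMeasure μ]
  {p : Measure (ℕ → ℝ)} {y : Ω → ℕ → ℝ} {x : ℕ → Ω → ℕ × ℝ} {u : ℕ → Ω → ℂ}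

/-- The mapping theorem applied to the product map, the closed sets being the boxes given by
tightness; its value at the empirical marks is almost surely ξ_{n,α}. -/
theorem tendstoInDistribution_xiAlphaMap (h : CircleCoupling μ p y x)
    (hp : ∀ᵐ l ∂p, l ∈ nablaPrime) (hdecay : ExponentialDecay p) (hu : UniformMarks μ y x u)
    (hpos : ∀ᵐ l ∂p, ∀ j, 0 < l j) {α : ℝ} (hα : Irrational α) (hft : IsFiniteType α) :
    TendstoInDistribution (fun (n : ℕ) (ω : Ω) => xiAlphaMap α (permMat (sigma y x n ω)))
      atTop (fun ω => xiInftyMap (y ω) fun j => u j ω) (fun _ => μ) μ := by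
  have hV := h.measurable_empiricalMarks α
  have hW : Measurable fun ω => (y ω, fun j => u j ω) :=
    h.measurable_y.prodMk (measurable_pi_lambda _ hu.measurable_u)
  have hVs : ∀ n ω, empiricalMarks α (fun k => x k ω) n ∈ markSpace := fun n ω j =>
    ⟨circleCount_div_mem_Icc _ n j, norm_angleMark α _⟩
  have hWs : ∀ᵐ ω ∂μ, (y ω, fun j => u j ω) ∈ markSpace := by
    filter_upwards [h.ae_y hp, ae_all_iff.2 hu.ae_norm] with ω h1 h2 j using ⟨h1.1 j, h2 j⟩
  refine (tendstoInDistribution_comp_of_continuousOn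
    (Φ := fun q : (ℕ → ℝ) × (ℕ → ℂ) => xiInftyMap q.1 q.2) hV hW
    (tendsto_integral_of_forall_markMonomial hV hW (fun n => Eventually.of_forall (hVs n)) hWs
      (tendsto_integral_markMonomial h hp hdecay hu hpos hα)) fun ε hε => ?_).congr
    (fun n => ?_) ae_eq_rfl
  · obtain ⟨b, d, hd, hbd, h1, h2⟩ :=
      exists_markBox_measureReal_le h hp hdecay hu hpos hα hft hε
    exact ⟨markBox b d, (isCompact_markBox b d).isClosed, continuousOn_xiInftyMap hd hbd, h1, h2⟩
  · filter_upwards [h.ae_goodPoints] with ω hω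
    have h1 : xiInfty (empiricalMarks α (fun k => x k ω) n).1
        (empiricalMarks α (fun k => x k ω) n).2 = xiAlpha α (permMat (sigma y x n ω)) :=
      funext fun z => (xiAlpha_eq_xiInfty hω α z).symm
    rw [xiInftyMap, dif_pos (h1 ▸ continuous_xiAlpha α _)]
    exact ContinuousMap.ext fun z => congrFun h1 z

end

end PermChar

theorem theorem1 {Ω : Type*} [MeasurableSpace Ω] (μ : Measure Ω) [IsProbabilityMeasure μ]
    (p : Measure (ℕ → ℝ)) [IsProbabilityMeasure p]
    (hp : ∀ᵐ l ∂p, l ∈ PermChar.nablaPrime) (hdecay : PermChar.ExponentialDecay p)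
    (y : Ω → ℕ → ℝ) (x : ℕ → Ω → ℕ × ℝ) (u : ℕ → Ω → ℂ)
    (hyx : PermChar.CircleCoupling μ p y x) (hu : PermChar.UniformMarks μ y x u) :
    -- almost surely, the infinite product converges and defines an entire function
    (∀ᵐ ω ∂μ,
      (∀ z : ℂ, Multipliable fun j => PermChar.xiFactor (y ω) (fun j => u j ω) j z) ∧
      Differentiable ℂ (PermChar.xiInfty (y ω) fun j => u j ω)) ∧
    -- (i) almost sure uniform convergence on compact sets, with the modified matrices
    (∀ Mt : (n : ℕ) → Ω → Matrix (Fin n) (Fin n) ℂ, PermChar.ModifiedCoupling μ y x u Mt →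
      ∀ᵐ ω ∂μ, ∀ K : Set ℂ, IsCompact K →
        TendstoUniformlyOn (fun (n : ℕ) (z : ℂ) => PermChar.xiTilde (Mt n ω) z)
          (PermChar.xiInfty (y ω) fun j => u j ω) atTop K) ∧
    -- (ii) convergence in law in `C(ℂ, ℂ)`, with the permutation matrices
    ((∀ᵐ l ∂p, ∀ j, 0 < l j) →
      ∀ α : ℝ, Irrational α → PermChar.IsFiniteType α →
        TendstoInDistribution
          (fun (n : ℕ) (ω : Ω) =>
            PermChar.xiAlphaMap α (PermChar.permMat (PermChar.sigma y x n ω)))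
          atTop (fun ω => PermChar.xiInftyMap (y ω) fun j => u j ω) (fun _ => μ) μ) := by
  refine ⟨PermChar.ae_multipliable_and_differentiable hyx hp hdecay hu, fun Mt hM => ?_,
    fun hpos α hα hft =>
      PermChar.tendstoInDistribution_xiAlphaMap hyx hp hdecay hu hpos hα hft⟩
  exact PermChar.ModifiedCoupling.ae_tendstoUniformlyOn hyx hp hdecay hu hM
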